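/- \textbf{Definitions.} Let $\mathcal E$ be an elementary topos. An \emph{ordered partial applicative structure} (OPAS) in $\mathcal E$ is an object $A$ with a partial order $\leq$ and a monotone partial binary operation $(x,y)\mapsto xy$ whose domain is downward closed; $xy\downarrow z$ means that $xy$ is defined and equal to $z$. The \emph{partial combinatory arrows} $A^n\rightharpoonup A$ are the members of the least set of partial arrows that contains the projections and is closed under pointwise application. In the internal language, $a\in A$ \emph{realizes} a partial combinatory arrow $f:A^n\rightharpoonup A$ if for all $x_1,\dots,x_n\in A$ the application of $a$ to $x_1,\dots,x_m$ is defined for every $m<n$ and, whenever $f(\vec x)$ is defined, $((ax_1)\cdots)x_n\downarrow y$ for some $y\leq f(\vec x)$. An object is \emph{inhabited} if its map to the terminal object is a regular epimorphism, and two subobjects \emph{intersect} if their intersection is inhabited. An \emph{OPCA pair} $(A',A)$ in $\mathcal E$ is an OPAS $A$ with a subobject $A'\leq A$ that is closed under (defined) application, such that for every partial combinatory arrow $f$ the object of realizers of $f$ intersects $A'$. A functor is \emph{regular} if it preserves finite limits and regular epimorphisms. A category is \emph{exact} if it is regular and every equivalence relation in it is effective. For a regular functor $F$ from $\mathcal E$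 to a regular category, an \emph{$F$-filter} is a subobject $C\leq FA$ that is upward closed and closed under application, and such that $FU$ intersects $C$ whenever $U\leq A$ intersects $A'$. An \emph{exact model} is a regular functor $F:\mathcal E\to\mathcal C$ with $\mathcal C$ exact, together with an $F$-filter $C$. A \emph{morphism} $(F:\mathcal E\to\mathcal C,C)\to(G:\mathcal E\to\mathcal D,D)$ is a regular functor $H:\mathcal C\to\mathcal D$ with a natural isomorphism $\eta:HF\to G$ such that $\eta_A$ restricts to an isomorphism $HC\to D$. An exact model is \emph{pseudoinitial} if there is a morphism from it to every exact model, and any two parallel morphisms $(H,\eta),(H',\eta')$ from it are isomorphic by a unique natural isomorphism $H\cong H'$ compatible with $\eta$ and $\eta'$. An \emph{assembly} is a pair $(X,Y)$ with $X\in\mathcal E$ and $Y\leq A\times X$ such that for all $x\in X$ there is $a\in A$ with $(a,x)\in Y$, and such that $(a,x)\in Y$ and $b\leq a$ imply $(b,x)\in Y$. A subobject $V\leq A$ \emph{tracks} $f:X\to X'$ as a map $(X,Y)\to(X',Y')$ if for all $a\in V$ and $(b,x)\in Y$, $ab$ is defined and $(ab,f(x))\in Y'$. Morphisms of assemblies are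 the arrows $f:X\to X'$ tracked by some $V\leq A$ that intersects $A'$; they form a category $\mathsf{Asm}(A',A)$. Let $\nabla:\mathcal E\to\mathsf{Asm}(A',A)$ be $\nabla X=(X,A\times X)$, $\nabla f=f$, and let $\mathring A\leq\nabla A$ be the subobject represented by $\mathrm{id}_A:(A,\{(x,y)\mid x\leq y\})\to\nabla A$. An \emph{exact completion} of a regular category $\mathcal C$ is a regular functor $I:\mathcal C\to\mathcal C_{\mathrm{ex/reg}}$ to an exact category such that, for every exact category $\mathcal D$, composition with $I$ is an equivalence from the category of regular functors $\mathcal C_{\mathrm{ex/reg}}\to\mathcal D$ to the category of regular functors $\mathcal C\to\mathcal D$. \textbf{Theorem.} Let $\mathcal E$ be a topos and $(A',A)$ an OPCA pair in $\mathcal E$. Then $\mathsf{Asm}(A',A)$ is a regular category, $\nabla$ is a regular functor and $\mathring A$ is a $\nabla$-filter. The category $\mathsf{Asm}(A',A)$ has an exact completion, and for every exact completion $I:\mathsf{Asm}(A',A)\to\mathsf{Asm}(A',A)_{\mathrm{ex/reg}}$ the pair $(I\nabla,I\mathring A)$ is a pseudoinitial exact model for $(A',A)$. In particular a pseudoinitial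 exact model (a relative realizability topos for $(A',A)$) exists for every OPCA pair in every topos. -/

import Mathlib

open CategoryTheory Limits MonoidalCategory CartesianMonoidalCategory

universe u v u₁ v₁ u₂ v₂

namespace RelReal

section Regular

variable {C : Type u₁} [Category.{v₁} C] {D : Type u₂} [Category.{v₂} D]

/-- A regular functor: it preserves finite limits and regular epimorphisms. -/
class IsRegularFunctor (F : C ⥤ D) : Prop where
  preservesFiniteLimits : PreservesFiniteLimits F
  map_regularEpi : ∀ {X Y : C} (f : X ⟶ Y), IsRegularEpi f → IsRegularEpi (F.map f)

attribute [instance] IsRegularFunctor.preservesFiniteLimits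

/-- An exact category (in the sense of Barr): a regular category in which every equivalence
relation is effective, i.e. is the kernel pair of its quotient. -/
class BarrExact (C : Type u₁) [Category.{v₁} C] : Prop extends Regular C where
  effective : ∀ {R X : C} (p₁ p₂ : R ⟶ X) [IsEquivalenceRelation p₁ p₂],
    IsEffectiveEquivalenceRelation p₁ p₂

/-- An object is inhabited (well-supported) if its map to the terminal object is a regular
epimorphism. -/
def IsInhabited [HasFiniteLimits C] (U : C) : Prop := IsRegularEpi (terminal.from U)

/-- Two subobjects of `X` intersect if their intersection is inhabited. -/
def Intersects [HasFiniteLimits C] {X : C} (U V : Subobject X) : Prop :=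
  IsInhabited ((U ⊓ V : Subobject X) : C)

/-- The image `F U ≤ F X` of a subobject `U ≤ X` under a regular functor `F`. -/
noncomputable def mapSub (F : C ⥤ D) [IsRegularFunctor F] {X : C} (U : Subobject X) :
    Subobject (F.obj X) :=
  Subobject.mk (F.map U.arrow)

/-- `I : C ⥤ X` is an exact completion of (the regular category) `C`: `X` is exact, `I` is regular,
and composition with `I` is an equivalence from the category of regular functors `X ⥤ D`
(with all natural transformations) to the category of regular functors `C ⥤ D`,
for every exact category `D`. -/
structure IsExactCompletion {C : Type u} [Category.{v} C] {X : Type u₁} [Category.{v₁} X]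
    (I : C ⥤ X) : Prop where
  exact : BarrExact X
  regular : IsRegularFunctor I
  exists_extension : ∀ (D : Type u₂) [Category.{v₂} D] [BarrExact D] (K : C ⥤ D)
    [IsRegularFunctor K], ∃ L : X ⥤ D, IsRegularFunctor L ∧ Nonempty (I ⋙ L ≅ K)
  bijective_whiskerLeft : ∀ (D : Type u₂) [Category.{v₂} D] [BarrExact D] (L L' : X ⥤ D)
    [IsRegularFunctor L] [IsRegularFunctor L'],
    Function.Bijective (fun α : L ⟶ L' => Functor.whiskerLeft I α)

theorem Intersects.exists_factors [HasFiniteLimits C] {X : C} {U V : Subobject X} (h : Intersects U V) :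
    ∃ (T : C) (a : T ⟶ X), IsInhabited T ∧ U.Factors a ∧ V.Factors a :=
  ⟨_, (U ⊓ V).arrow, h, (Subobject.inf_factors _).1 (Subobject.factors_self _)⟩

end Regular

section OPAS

variable {E : Type u} [Category.{v} E] [CartesianMonoidalCategory E]

/-- For generalized elements `x`, `y`, `z` of `A` and a partial operator `app : dom → A` with
`dom ≤ A ⊗ A`: the statement `x y ↓ z`, i.e. `app` is defined at `(x, y)` with value `z`. -/
def AppTo {A : E} (dom : Subobject (A ⊗ A)) (app : (dom : E) ⟶ A) {T : E} (x y z : T ⟶ A) : Prop :=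
  ∃ d : T ⟶ (dom : E), d ≫ dom.arrow = lift x y ∧ d ≫ app = z

variable (E) in
/-- An ordered partial applicative structure in `E`: a partially ordered object with a monotone
partial binary operator whose domain is downward closed. The axioms are stated for generalized
elements. -/
structure OPAS where
  carrier : E
  le : Subobject (carrier ⊗ carrier)
  dom : Subobject (carrier ⊗ carrier)
  app : (dom : E) ⟶ carrier
  le_refl : ∀ {T : E} (x : T ⟶ carrier), le.Factors (lift x x)
  le_trans : ∀ {T : E} (x y z : T ⟶ carrier),
    le.Factors (lift x y) → le.Factors (lift y z) → le.Factors (lift x z)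
  le_antisymm : ∀ {T : E} (x y : T ⟶ carrier),
    le.Factors (lift x y) → le.Factors (lift y x) → x = y
  app_mono : ∀ {T : E} (a b c d e : T ⟶ carrier),
    le.Factors (lift a b) → le.Factors (lift c d) → AppTo dom app b d e →
      ∃ f : T ⟶ carrier, AppTo dom app a c f ∧ le.Factors (lift f e)

/-- Applicative terms in `n` variables. Each denotes a partial combinatory arrow `Aⁿ ⇀ A`, so that
these arrows are the least set that contains the projections and is closed under pointwise
application. -/
inductive CombTerm (n : ℕ) : Type
  | var (i : Fin n) : CombTerm n
  | app (s t : CombTerm n) : CombTerm n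

namespace OPAS

variable (A : OPAS E) {T : E}

/-- `x ≤ y` for generalized elements of `A`. -/
def Le (x y : T ⟶ A.carrier) : Prop := A.le.Factors (lift x y)

/-- `x y ↓ z` for generalized elements of `A`. -/
def App (x y z : T ⟶ A.carrier) : Prop := AppTo A.dom A.app x y z

theorem App.comp {A : OPAS E} {T S : E} {x y z : T ⟶ A.carrier} (h : A.App x y z)
    (s : S ⟶ T) : A.App (s ≫ x) (s ≫ y) (s ≫ z) := by
  obtain ⟨d, h1, h2⟩ := h
  exact ⟨s ≫ d, by rw [Category.assoc, h1, comp_lift], by rw [Category.assoc, h2]⟩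

theorem App.unique {A : OPAS E} {T : E} {x y z z' : T ⟶ A.carrier} (h : A.App x y z)
    (h' : A.App x y z') : z = z' := by
  obtain ⟨d, h1, h2⟩ := h
  obtain ⟨d', h1', h2'⟩ := h'
  rw [← h2, ← h2', (cancel_mono A.dom.arrow).1 (h1.trans h1'.symm)]

/-- `A.Eval x t y`: the partial combinatory arrow denoted by `t` is defined at `x` with
value `y`. -/
def Eval {n : ℕ} (x : Fin n → (T ⟶ A.carrier)) : CombTerm n → (T ⟶ A.carrier) → Prop
  | .var i, y => y = x i
  | .app s t, y => ∃ y₁ y₂, Eval x s y₁ ∧ Eval x t y₂ ∧ A.App y₁ y₂ y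

/-- `A.AppList a [x₁, …, xₙ] y`: the statement `((a x₁) …) xₙ ↓ y`. -/
def AppList (a : T ⟶ A.carrier) : List (T ⟶ A.carrier) → (T ⟶ A.carrier) → Prop
  | [], y => y = a
  | x :: xs, y => ∃ b, A.App a x b ∧ AppList b xs y

/-- Every element `a` of `V` realizes the `n`-ary partial combinatory arrow `f` denoted by `t`:
for all `x₁, …, xₙ` in `A`, the application `((a x₁) …) xₘ` to fewer than `n` arguments is defined,
and if `f x` is defined, then `((a x₁) …) xₙ ↓ y` for some `y ≤ f x`. -/
def Realizes {n : ℕ} (V : Subobject A.carrier) (t : CombTerm n) : Prop :=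
  ∀ {T : E} (a : T ⟶ A.carrier), V.Factors a → ∀ x : Fin n → (T ⟶ A.carrier),
    (∀ m < n, ∃ y, A.AppList a ((List.ofFn x).take m) y) ∧
    ∀ y, A.Eval x t y → ∃ z, A.AppList a (List.ofFn x) z ∧ A.Le z y

end OPAS

variable (E) in
/-- An OPCA pair `(A', A)`; the subobject `A'` of `A` is the field `sub`. -/
structure OPCAPair [HasFiniteLimits E] extends OPAS E where
  sub : Subobject carrier
  sub_app : ∀ {T : E} (x y z : T ⟶ carrier), sub.Factors x → sub.Factors y →
    toOPAS.App x y z → sub.Factors z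
  complete : ∀ {n : ℕ} (t : CombTerm n), ∃ V : Subobject carrier,
    toOPAS.Realizes V t ∧ Intersects V sub

end OPAS

section OPASLemma

variable {E : Type u} [Category.{v} E] [CartesianMonoidalCategory E] [HasFiniteLimits E]

/-- The arrow `x ↦ x` is realized in `A'`. -/
theorem exists_id_realizer (P : OPCAPair E) : ∃ V : Subobject P.carrier,
    (∀ {T : E} (a b : T ⟶ P.carrier), V.Factors a → ∃ c, P.App a b c ∧ P.Le c b) ∧
      Intersects V P.sub := by
  obtain ⟨V, hV, hV'⟩ := P.complete (CombTerm.var (0 : Fin 1))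
  refine ⟨V, fun a b ha => ?_, hV'⟩
  obtain ⟨z, hz, hz'⟩ := (hV a ha ![b]).2 b rfl
  simp only [List.ofFn_succ, List.ofFn_zero] at hz
  obtain ⟨c, hc, rfl⟩ := hz
  exact ⟨z, hc, hz'⟩

end OPASLemma

section Models

variable {E : Type u} [Category.{v} E] [CartesianMonoidalCategory E] [HasFiniteLimits E]

/-- The subobject `C ≤ F A` is an `F`-filter: it is upward closed, closed under application, and
it intersects `F U` whenever `U ≤ A` intersects `A'`. -/
structure IsFilter (P : OPCAPair E) {D : Type u₁} [Category.{v₁} D] [HasFiniteLimits D]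
    (F : E ⥤ D) [IsRegularFunctor F] (C : Subobject (F.obj P.carrier)) : Prop where
  up : ∀ {T : D} (t : T ⟶ F.obj (P.le : E)),
    C.Factors (t ≫ F.map (P.le.arrow ≫ fst _ _)) → C.Factors (t ≫ F.map (P.le.arrow ≫ snd _ _))
  app : ∀ {T : D} (t : T ⟶ F.obj (P.dom : E)),
    C.Factors (t ≫ F.map (P.dom.arrow ≫ fst _ _)) →
    C.Factors (t ≫ F.map (P.dom.arrow ≫ snd _ _)) → C.Factors (t ≫ F.map P.app)
  meets : ∀ U : Subobject P.carrier, Intersects U P.sub → Intersects (mapSub F U) C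

/-- An exact model for the OPCA pair `P`: a regular functor from `E` to an exact category, together
with a filter for that functor. -/
structure ExactModel (P : OPCAPair E) where
  category : Type u₁
  [cat : Category.{v₁} category]
  [exact : BarrExact category]
  functor : E ⥤ category
  [regular : IsRegularFunctor functor]
  filter : Subobject (functor.obj P.carrier)
  isFilter : IsFilter P functor filter

attribute [instance] ExactModel.cat ExactModel.exact ExactModel.regular

namespace ExactModel

variable {P : OPCAPair E}

/-- A morphism of models `(F, C) → (G, D)`: a regular functor `H` with a natural isomorphism
`η : H F ≅ G` such that `η` at `A` restricts to an isomorphism from `H C` to `D`. -/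
structure Hom (M : ExactModel.{u, v, u₁, v₁} P) (N : ExactModel.{u, v, u₂, v₂} P) where
  functor : M.category ⥤ N.category
  [regular : IsRegularFunctor functor]
  iso : M.functor ⋙ functor ≅ N.functor
  map_filter : Subobject.mk (functor.map M.filter.arrow ≫ iso.hom.app P.carrier) = N.filter

/-- `M` is pseudoinitial: to every exact model there is a morphism from `M`, and any two parallel
morphisms `(H, η)`, `(H', η')` from `M` are isomorphic by a unique natural isomorphism `H ≅ H'` that
is compatible with `η` and `η'`. -/
def IsPseudoinitial (M : ExactModel.{u, v, u₁, v₁} P) : Prop :=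
  ∀ N : ExactModel.{u, v, u₂, v₂} P, Nonempty (M.Hom N) ∧
    ∀ f g : M.Hom N, ∃! θ : f.functor ≅ g.functor,
      ∀ X : E, θ.hom.app (M.functor.obj X) ≫ g.iso.hom.app X = f.iso.hom.app X

end ExactModel

end Models

section Assemblies

section Defs

variable {E : Type u} [Category.{v} E] [CartesianMonoidalCategory E] [HasFiniteLimits E]

/-- An assembly `(X, Y)` for the OPCA pair `P = (A', A)`: an object `X` with a subobject
`Y ≤ A ⊗ X` such that for all `x` there is an `a` with `(a, x) ∈ Y`, and which is downward closed
in the first coordinate. -/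
structure Assembly (P : OPCAPair E) where
  obj : E
  rel : Subobject (P.carrier ⊗ obj)
  total : IsRegularEpi (rel.arrow ≫ snd P.carrier obj)
  down : ∀ {T : E} (a b : T ⟶ P.carrier) (x : T ⟶ obj),
    rel.Factors (lift a x) → P.Le b a → rel.Factors (lift b x)

variable {P : OPCAPair E}

/-- `V ≤ A` tracks `f : X ⟶ X'`: if `a ∈ V` and `(b, x) ∈ Y`, then `a b ↓` and
`(a b, f x) ∈ Y'`. -/
def Tracks {X X' : Assembly P} (V : Subobject P.carrier) (f : X.obj ⟶ X'.obj) : Prop :=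
  ∀ {T : E} (a b : T ⟶ P.carrier) (x : T ⟶ X.obj), V.Factors a → X.rel.Factors (lift b x) →
    ∃ c, P.App a b c ∧ X'.rel.Factors (lift c (x ≫ f))

/-- A morphism of assemblies: an arrow that is tracked by some subobject of `A` that
intersects `A'`. -/
@[ext]
structure Assembly.Hom (X X' : Assembly P) where
  arrow : X.obj ⟶ X'.obj
  tracked : ∃ V : Subobject P.carrier, Tracks (X := X) (X' := X') V arrow ∧ Intersects V P.sub

end Defs

theorem comp_eq_of_pullback {C : Type u₁} [Category.{v₁} C] [HasPullbacks C] {X B Z S : C}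
    {f : X ⟶ B} {g : X ⟶ Z} (hg : pullback.fst f f ≫ g = pullback.snd f f ≫ g) (a b : S ⟶ X)
    (e : a ≫ f = b ≫ f) : a ≫ g = b ≫ g := by
  have h := congrArg (fun w => pullback.lift a b e ≫ w) hg
  simp only [← Category.assoc] at h
  rwa [pullback.lift_fst, pullback.lift_snd] at h

variable {E : Type u} [Category.{v} E] [CartesianMonoidalCategory E] [HasFiniteLimits E]
  [MonoidalClosed E]

theorem epi_fst_of_isInhabited {T : E} (h : IsInhabited T) (X : E) : Epi (fst X T) := by
  have h' : Epi (terminal.from T) := by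
    unfold IsInhabited at h
    infer_instance
  have h'' : Epi (X ◁ terminal.from T) := by
    change Epi ((tensorLeft X).map (terminal.from T))
    infer_instance
  refine ⟨fun {Z} g k e => ?_⟩
  have e' : X ◁ terminal.from T ≫ fst X (⊤_ E) ≫ g = X ◁ terminal.from T ≫ fst X (⊤_ E) ≫ k := by
    simpa using e
  have e'' := (cancel_epi _).1 e'
  have e3 : lift (𝟙 X) (terminal.from X) ≫ fst X (⊤_ E) ≫ g =
      lift (𝟙 X) (terminal.from X) ≫ fst X (⊤_ E) ≫ k := by rw [e'']
  simpa using e3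

theorem epi_snd_of_isInhabited {T : E} (h : IsInhabited T) (X : E) : Epi (snd T X) := by
  have h1 := epi_fst_of_isInhabited h X
  have h2 : snd T X = lift (snd T X) (fst T X) ≫ fst X T := by simp
  refine ⟨fun {Z} g k e => ?_⟩
  rw [← cancel_epi (fst X T)]
  have := congrArg (fun w => lift (snd X T) (fst X T) ≫ w) e
  simpa using this

/-- An object `X` with a map from an inhabited object is inhabited. -/
theorem IsInhabited.of_hom {T U : E} (h : IsInhabited T) (k : T ⟶ U) : IsInhabited U := by
  have hT : IsRegularEpi (terminal.from T) := h
  have hepi : Epi (terminal.from U) := by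
    have : Epi (k ≫ terminal.from U) := by
      rw [show k ≫ terminal.from U = terminal.from T from Subsingleton.elim _ _]
      infer_instance
    exact epi_of_epi k _
  refine IsRegularEpi.of_epi_of_exists fun Z g hg => ?_
  have hg' : ∀ {S : E} (a b : S ⟶ U), a ≫ g = b ≫ g := fun a b =>
    comp_eq_of_pullback hg a b (Subsingleton.elim _ _)
  refine ⟨IsRegularEpi.desc (terminal.from T) (k ≫ g) (by
    simpa only [Category.assoc] using hg' (IsRegularEpi.left (terminal.from T) ≫ k)
      (IsRegularEpi.right (terminal.from T) ≫ k)), ?_⟩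
  have := epi_fst_of_isInhabited h U
  rw [← cancel_epi (fst U T)]
  have h1 : fst U T ≫ terminal.from U = snd U T ≫ terminal.from T := Subsingleton.elim _ _
  rw [← Category.assoc, h1, Category.assoc, IsRegularEpi.fac]
  simpa using hg' (snd U T ≫ k) (fst U T)

theorem isRegularEpi_snd {T : E} (h : IsInhabited T) (X : E) : IsRegularEpi (snd T X) := by
  have hT : IsRegularEpi (terminal.from T) := h
  have hepi := epi_snd_of_isInhabited h X
  refine IsRegularEpi.of_epi_of_exists fun Z g hg => ?_
  have hg' : ∀ {S : E} (a b : S ⟶ T ⊗ X), a ≫ snd T X = b ≫ snd T X → a ≫ g = b ≫ g :=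
    fun a b e => comp_eq_of_pullback hg a b e
  -- transpose `g` to `T ⟶ (X ⟶[E] Z)`, which is constant
  let g' : X ⊗ T ⟶ Z := lift (snd X T) (fst X T) ≫ g
  have hc : IsRegularEpi.left (terminal.from T) ≫ MonoidalClosed.curry g' =
      IsRegularEpi.right (terminal.from T) ≫ MonoidalClosed.curry g' := by
    rw [← MonoidalClosed.curry_natural_left, ← MonoidalClosed.curry_natural_left]
    congr 1
    simp only [g', ← Category.assoc]
    apply hg'
    simp
  let d := IsRegularEpi.desc (terminal.from T) (MonoidalClosed.curry g') hc
  have hd : terminal.from T ≫ d = MonoidalClosed.curry g' := IsRegularEpi.fac _ _ hc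
  refine ⟨lift (𝟙 X) (terminal.from X) ≫ MonoidalClosed.uncurry d, ?_⟩
  have h1 : X ◁ terminal.from T ≫ MonoidalClosed.uncurry d = g' := by
    rw [← MonoidalClosed.uncurry_natural_left, hd, MonoidalClosed.uncurry_curry]
  have h2 : snd T X ≫ lift (𝟙 X) (terminal.from X) =
      lift (snd T X) (fst T X) ≫ X ◁ terminal.from T := by
    ext
    simp
  have h3 : lift (snd T X) (fst T X) ≫ lift (snd X T) (fst X T) = 𝟙 _ := by
    ext <;> simp
  rw [← Category.assoc, h2, Category.assoc, h1, ← Category.assoc, h3, Category.id_comp]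

theorem IsInhabited.tensor {S T : E} (hS : IsInhabited S) (hT : IsInhabited T) :
    IsInhabited (S ⊗ T) := by
  have hT' : IsRegularEpi (terminal.from T) := hT
  have hepi := epi_snd_of_isInhabited hS T
  have h1 := isRegularEpi_snd hS T
  have hepi' : Epi (terminal.from (S ⊗ T)) := by
    rw [show terminal.from (S ⊗ T) = snd S T ≫ terminal.from T from Subsingleton.elim _ _]
    infer_instance
  refine IsRegularEpi.of_epi_of_exists fun Z g hg => ?_
  have hg' : ∀ {R : E} (a b : R ⟶ S ⊗ T), a ≫ g = b ≫ g := fun a b =>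
    comp_eq_of_pullback hg a b (Subsingleton.elim _ _)
  let d := IsRegularEpi.desc (snd S T) g (hg' _ _)
  have hd : snd S T ≫ d = g := IsRegularEpi.fac _ _ _
  have hd' : ∀ {R : E} (a b : R ⟶ T), a ≫ d = b ≫ d := fun {R} a b => by
    have := epi_snd_of_isInhabited hS R
    rw [← cancel_epi (snd S R)]
    have := hg' (lift (fst S R) (snd S R ≫ a)) (lift (fst S R) (snd S R ≫ b))
    rw [← hd] at this
    simpa using this
  refine ⟨IsRegularEpi.desc (terminal.from T) d (hd' _ _), ?_⟩
  rw [show terminal.from (S ⊗ T) = snd S T ≫ terminal.from T from Subsingleton.elim _ _,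
    Category.assoc, IsRegularEpi.fac, hd]

/-- Two subobjects intersect if they have a common generalized element over an inhabited object. -/
theorem Intersects.of_factors {T X : E} (hT : IsInhabited T) {U V : Subobject X} (a : T ⟶ X)
    (hU : U.Factors a) (hV : V.Factors a) : Intersects U V :=
  hT.of_hom ((U ⊓ V).factorThru a ((Subobject.inf_factors a).2 ⟨hU, hV⟩))

variable [HasSubobjectClassifier E]

/-- Universal quantification of a subobject of `Z ⊗ A` along the projection to `A`. -/
theorem exists_forall {Z A : E} (φ : Subobject (Z ⊗ A)) :
    ∃ W : Subobject A, ∀ {T : E} (a : T ⟶ A), W.Factors a ↔ φ.Factors (Z ◁ a) := by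
  let χφ := HasSubobjectClassifier.χ φ.arrow
  let χt : Z ⊗ A ⟶ HasSubobjectClassifier.Ω E :=
    Subobject.Classifier.χ₀ _ (Z ⊗ A) ≫ HasSubobjectClassifier.truth E
  refine ⟨equalizerSubobject (MonoidalClosed.curry χφ) (MonoidalClosed.curry χt), fun a => ?_⟩
  rw [equalizerSubobject_factors_iff, ← MonoidalClosed.curry_natural_left,
    ← MonoidalClosed.curry_natural_left, MonoidalClosed.curry_injective.eq_iff]
  have hp := HasSubobjectClassifier.isPullback_χ φ.arrow
  constructor
  · intro h
    have h' : Z ◁ a ≫ χφ = Subobject.Classifier.χ₀ _ _ ≫ HasSubobjectClassifier.truth E := by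
      rw [h]
      simp only [χt, ← Category.assoc]
      congr 1
      exact Subsingleton.elim _ _
    rw [← hp.lift_fst _ _ h']
    exact Subobject.factors_comp_arrow _
  · intro h
    rw [← Subobject.factorThru_arrow _ _ h]
    simp only [χt, Category.assoc, χφ, hp.w]
    simp only [← Category.assoc]
    congr 1
    exact Subsingleton.elim _ _

variable {P : OPCAPair E}

/-- There is a greatest subobject of `A` that tracks a given arrow. -/
theorem exists_tracker {X X' : Assembly P} (f : X.obj ⟶ X'.obj) :
    ∃ W : Subobject P.carrier, Tracks (X := X) (X' := X') W f ∧
      ∀ {T : E} (a : T ⟶ P.carrier), (∀ {S : E} (s : S ⟶ T) (b : S ⟶ P.carrier) (x : S ⟶ X.obj),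
        X.rel.Factors (lift b x) →
          ∃ c, P.App (s ≫ a) b c ∧ X'.rel.Factors (lift c (x ≫ f))) → W.Factors a := by
  let m : (X.rel : E) ⊗ P.carrier ⟶ P.carrier ⊗ P.carrier :=
    lift (snd _ _) (fst _ _ ≫ X.rel.arrow ≫ fst _ _)
  let D := (Subobject.pullback m).obj P.dom
  let α : (D : E) ⟶ P.carrier ⊗ X'.obj :=
    lift (Subobject.pullbackπ m P.dom ≫ P.app) (D.arrow ≫ fst _ _ ≫ X.rel.arrow ≫ snd _ _ ≫ f)
  let φ : Subobject ((X.rel : E) ⊗ P.carrier) :=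
    Subobject.mk (((Subobject.pullback α).obj X'.rel).arrow ≫ D.arrow)
  have hD : Subobject.pullbackπ m P.dom ≫ P.dom.arrow = D.arrow ≫ m :=
    (Subobject.isPullback m P.dom).w
  obtain ⟨W, hW⟩ := exists_forall φ
  refine ⟨W, ?_, ?_⟩
  · intro T a b x ha hx
    obtain ⟨k, hk⟩ : ∃ k : (X.rel : E) ⊗ T ⟶ (((Subobject.pullback α).obj X'.rel : Subobject _) : E),
        k ≫ ((Subobject.pullback α).obj X'.rel).arrow ≫ D.arrow = (X.rel : E) ◁ a := (hW a).1 ha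
    let y := X.rel.factorThru _ hx
    have hy : y ≫ X.rel.arrow = lift b x := Subobject.factorThru_arrow _ _ _
    let e : T ⟶ (D : E) := lift y (𝟙 T) ≫ k ≫ ((Subobject.pullback α).obj X'.rel).arrow
    have he : e ≫ D.arrow = lift y a := by
      simp only [e, Category.assoc, hk]
      ext <;> simp
    refine ⟨e ≫ Subobject.pullbackπ m P.dom ≫ P.app,
      ⟨e ≫ Subobject.pullbackπ m P.dom, ?_, by simp⟩, ?_⟩
    · rw [Category.assoc, hD, ← Category.assoc, he]
      ext
      · simp [m]
      · simp [m, ← Category.assoc]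
        simp [hy]
    · have h1 : X'.rel.Factors (e ≫ α) := by
        rw [← Limits.pullback_factors_iff]
        simp only [e, ← Category.assoc]
        exact Subobject.factors_comp_arrow _
      have h2 : e ≫ α = lift (e ≫ Subobject.pullbackπ m P.dom ≫ P.app) (x ≫ f) := by
        ext
        · simp [α]
        · simp only [α, comp_lift, lift_snd]
          rw [← Category.assoc, he, lift_fst_assoc, ← Category.assoc, hy, lift_snd_assoc]
      rwa [← h2]
  · intro T a h
    rw [hW]
    let y := fst (X.rel : E) T
    obtain ⟨c, ⟨d, hd1, hd2⟩, hc⟩ := h (snd (X.rel : E) T) (y ≫ X.rel.arrow ≫ fst _ _)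
      (y ≫ X.rel.arrow ≫ snd _ _) (by
        rw [← comp_lift, ← comp_lift, lift_fst_snd, Category.comp_id]
        exact Subobject.factors_comp_arrow _)
    have hw : d ≫ P.dom.arrow = ((X.rel : E) ◁ a) ≫ m := by
      rw [hd1]
      ext <;> simp [m, y]
    let e : (X.rel : E) ⊗ T ⟶ (D : E) := (Subobject.isPullback m P.dom).lift d _ hw
    have he1 : e ≫ Subobject.pullbackπ m P.dom = d := (Subobject.isPullback m P.dom).lift_fst _ _ _
    have he2 : e ≫ D.arrow = (X.rel : E) ◁ a := (Subobject.isPullback m P.dom).lift_snd _ _ _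
    have hα : e ≫ α = lift c ((y ≫ X.rel.arrow ≫ snd _ _) ≫ f) := by
      ext
      · simp only [α, comp_lift, lift_fst]
        rw [← Category.assoc, he1, hd2]
      · simp only [α, comp_lift, lift_snd]
        rw [← Category.assoc, he2]
        simp [y]
    have hf : ((Subobject.pullback α).obj X'.rel).Factors e := by
      rw [Limits.pullback_factors_iff, hα]
      exact hc
    refine ⟨Subobject.factorThru _ e hf, ?_⟩
    change Subobject.factorThru _ e hf ≫ ((Subobject.pullback α).obj X'.rel).arrow ≫ D.arrow = _
    rw [← Category.assoc, Subobject.factorThru_arrow, he2]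

/-- The term `x₀ (x₁ x₂)`. -/
def compTerm : CombTerm 3 := .app (.var 0) (.app (.var 1) (.var 2))

theorem tracked_comp {X Y Z : Assembly P} (f : Assembly.Hom X Y) (g : Assembly.Hom Y Z) :
    ∃ V : Subobject P.carrier, Tracks (X := X) (X' := Z) V (f.arrow ≫ g.arrow) ∧
      Intersects V P.sub := by
  obtain ⟨V₁, h₁, i₁⟩ := f.tracked
  obtain ⟨V₂, h₂, i₂⟩ := g.tracked
  obtain ⟨V₃, h₃, i₃⟩ := P.complete compTerm
  obtain ⟨T₁, v₁, t₁, p₁, q₁⟩ := i₁.exists_factors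
  obtain ⟨T₂, v₂, t₂, p₂, q₂⟩ := i₂.exists_factors
  obtain ⟨T₃, v₃, t₃, p₃, q₃⟩ := i₃.exists_factors
  obtain ⟨W, hW, hW'⟩ := exists_tracker (X := X) (X' := Z) (f.arrow ≫ g.arrow)
  refine ⟨W, hW, ?_⟩
  have hT : IsInhabited (T₁ ⊗ (T₂ ⊗ T₃)) := t₁.tensor (t₂.tensor t₃)
  let w₁ : T₁ ⊗ (T₂ ⊗ T₃) ⟶ P.carrier := fst _ _ ≫ v₁
  let w₂ : T₁ ⊗ (T₂ ⊗ T₃) ⟶ P.carrier := snd _ _ ≫ fst _ _ ≫ v₂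
  let w₃ : T₁ ⊗ (T₂ ⊗ T₃) ⟶ P.carrier := snd _ _ ≫ snd _ _ ≫ v₃
  have hp₁ : V₁.Factors w₁ := Subobject.factors_of_factors_right _ p₁
  have hp₂ : V₂.Factors w₂ :=
    Subobject.factors_of_factors_right _ (Subobject.factors_of_factors_right _ p₂)
  have hp₃ : V₃.Factors w₃ :=
    Subobject.factors_of_factors_right _ (Subobject.factors_of_factors_right _ p₃)
  have hq₁ : P.sub.Factors w₁ := Subobject.factors_of_factors_right _ q₁
  have hq₂ : P.sub.Factors w₂ :=
    Subobject.factors_of_factors_right _ (Subobject.factors_of_factors_right _ q₂)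
  have hq₃ : P.sub.Factors w₃ :=
    Subobject.factors_of_factors_right _ (Subobject.factors_of_factors_right _ q₃)
  obtain ⟨q, hq⟩ := (h₃ w₃ hp₃ ![w₂, w₁, w₁]).1 2 (by norm_num)
  simp only [List.ofFn_succ, List.ofFn_zero, List.take_succ_cons, List.take_zero] at hq
  obtain ⟨r, hr, q', hq', rfl⟩ := hq
  refine Intersects.of_factors hT q (hW' q ?_) (P.sub_app _ _ _ (P.sub_app _ _ _ hq₃ hq₂ hr) hq₁ hq')
  intro S s b x hx
  obtain ⟨c, hc, hc'⟩ := h₁ (s ≫ w₁) b x (Subobject.factors_of_factors_right _ hp₁) hx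
  obtain ⟨d, hd, hd'⟩ := h₂ (s ≫ w₂) c _ (Subobject.factors_of_factors_right _ hp₂) hc'
  obtain ⟨z, hz, hz'⟩ := (h₃ (s ≫ w₃) (Subobject.factors_of_factors_right _ hp₃)
    ![s ≫ w₂, s ≫ w₁, b]).2 d ⟨s ≫ w₂, c, rfl, ⟨s ≫ w₁, b, rfl, rfl, hc⟩, hd⟩
  simp only [List.ofFn_succ, List.ofFn_zero] at hz
  obtain ⟨r', hr', q'', hq'', z', hz'', rfl⟩ := hz
  obtain rfl := hr'.unique (hr.comp s)
  obtain rfl := hq''.unique (hq'.comp s)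
  refine ⟨z, hz'', Z.down _ _ _ ?_ hz'⟩
  simpa using hd'

/-- The category `Asm(A', A)` of assemblies. -/
instance : Category (Assembly P) where
  Hom := Assembly.Hom
  id X := ⟨𝟙 X.obj, by
    obtain ⟨V, hV, hV'⟩ := exists_id_realizer P
    refine ⟨V, fun a b x ha hx => ?_, hV'⟩
    obtain ⟨c, hc, hc'⟩ := hV a b ha
    exact ⟨c, hc, by simpa using X.down _ _ _ hx hc'⟩⟩
  comp f g := ⟨f.arrow ≫ g.arrow, tracked_comp f g⟩

variable (P)

theorem isInhabited_carrier : IsInhabited P.carrier := by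
  obtain ⟨V, -, hV⟩ := exists_id_realizer P
  exact hV.of_hom (V ⊓ P.sub).arrow

/-- The functor `∇ : E ⥤ Asm(A', A)`, which sends `X` to `(X, A ⊗ X)`. -/
def nabla : E ⥤ Assembly P where
  obj X :=
    { obj := X
      rel := ⊤
      total := by
        have h := isRegularEpi_snd (isInhabited_carrier P) X
        exact (MorphismProperty.cancel_left_of_respectsIso (MorphismProperty.regularEpi E)
          (⊤ : Subobject (P.carrier ⊗ X)).arrow _).2 h
      down := fun _ _ _ _ _ => Subobject.top_factors _ }
  map f := ⟨f, by
    obtain ⟨V, hV, hV'⟩ := exists_id_realizer P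
    refine ⟨V, fun a b x ha hx => ?_, hV'⟩
    obtain ⟨c, hc, hc'⟩ := hV a b ha
    exact ⟨c, hc, Subobject.top_factors _⟩⟩

/-- The assembly `(A, {(x, y) | x ≤ y})`. -/
def ringAssembly : Assembly P where
  obj := P.carrier
  rel := P.le
  total := by
    have : IsSplitEpi (P.le.arrow ≫ snd P.carrier P.carrier) :=
      ⟨⟨⟨P.le.factorThru _ (P.le_refl (𝟙 _)), by simp⟩⟩⟩
    infer_instance
  down a b x h h' := P.le_trans _ _ _ h' h

/-- The identity of `A` as a morphism of assemblies from `(A, ≤)` to `∇ A`. -/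
def ringArrow : ringAssembly P ⟶ (nabla P).obj P.carrier :=
  Assembly.Hom.mk (X := ringAssembly P) (X' := (nabla P).obj P.carrier) (𝟙 P.carrier) (by
    obtain ⟨V, hV, hV'⟩ := exists_id_realizer P
    refine ⟨V, fun a b x ha hx => ?_, hV'⟩
    obtain ⟨c, hc, hc'⟩ := hV a b ha
    exact ⟨c, hc, Subobject.top_factors _⟩)

instance : Mono (ringArrow P) where
  right_cancellation f g h := by
    have h' := congrArg Assembly.Hom.arrow h
    apply Assembly.Hom.ext
    change f.arrow ≫ 𝟙 _ = g.arrow ≫ 𝟙 _ at h'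
    simpa using h'

/-- The subobject `Å` of `∇ A` represented by the identity of `A`. -/
noncomputable def ring : Subobject ((nabla P).obj P.carrier) := Subobject.mk (ringArrow P)

end Assemblies

end RelReal

open RelReal

/-! The filter dictates the model. Let F be a regular functor with an F-filter C, and call an
element x of F X realized if (a, x) lies in F Y for some a in C, locally. Trackers meet A', so C
contains them locally, and closure of C under application makes tracked arrows preserve realized
elements. This gives a functor on assemblies that restricts to F along ∇ and sends Å to C
(`IsFilter.functor`, `IsFilter.nablaIso`, `IsFilter.mk_functor_ringArrow`). It is regular because
realizers can be paired (`realized_of_pairing`) and because a regular epimorphism of assemblies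
turns realizers of an element into realizers of a local preimage (`realized_of_cover`).

There is no other choice. An assembly (X, Y) embeds in ∇ X, and it is a regular quotient of the
pullback of Å along ∇ of the projection from Y to A (`exists_regularEpi_pullbackRing`). A regular
functor preserves this presentation, so its value at (X, Y) is the subobject of realized elements
(`mk_extensionArrow`), and comparison isomorphisms are unique (`existsUnique_iso`). Thus (∇, Å) has
the required property among models in regular categories, and the universal property of the exact
completion transfers it to exact ones.

Regularity of the category of assemblies comes from the criterion `regular_of_cover`: it suffices to
exhibit a pullback stable class of covers with image factorizations. The same criterion serves for
the topos, with surjections in the internal logic, and for full subcategories of exact categories.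
Elements of A' exist only over inhabited objects, so realizers are generalized elements and
arguments pass to covers.

The exact completion of a regular category lies inside the topos of sheaves for the regular
topology. The quotients of representables by representable equivalence relations are closed under
finite limits, images and quotients (`isGenerating_of_comp`). Any embedding generated in this way is
an exact completion (`IsGenerating.isExactCompletion`): a regular functor K is extended by a
pointwise left Kan extension, whose value at the quotient of c by R is the quotient of K c by K R.
-/

namespace RelReal

/-! ### Recognizing regular categories by a class of covers -/

section Covers

variable {C : Type u₁} [Category.{v₁} C] [HasFiniteLimits C] {W : MorphismProperty C}

/-- A cover that equalizes two maps factors through their equalizer, which is then a monic cover,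
hence invertible. -/
theorem epi_of_cover
    (hcancel : ∀ {X Y Z : C} (f : X ⟶ Y) (g : Y ⟶ Z), W (f ≫ g) → W g)
    (hmono : ∀ {X Y : C} (f : X ⟶ Y), W f → Mono f → IsIso f) {X Y : C} (f : X ⟶ Y) (hf : W f) :
    Epi f where
  left_cancellation g h e := by
    have h1 : W (equalizer.ι g h) :=
      hcancel (equalizer.lift f e) _ (by rwa [equalizer.lift_ι])
    have h2 := hmono _ h1 inferInstance
    rw [← cancel_epi (equalizer.ι g h), equalizer.condition]

/-- A class of covers that is stable under base change and right cancellable, such that monic covers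
are invertible and every morphism factors as a cover followed by a monomorphism, is the class of
regular epimorphisms of a regular category. -/
theorem isRegularEpi_of_cover [W.IsStableUnderBaseChange]
    (hcancel : ∀ {X Y Z : C} (f : X ⟶ Y) (g : Y ⟶ Z), W (f ≫ g) → W g)
    (hmono : ∀ {X Y : C} (f : X ⟶ Y), W f → Mono f → IsIso f)
    (hfac : ∀ {X Y : C} (f : X ⟶ Y), ∃ (I : C) (e : X ⟶ I) (m : I ⟶ Y), W e ∧ Mono m ∧ e ≫ m = f)
    {X Y : C} (f : X ⟶ Y) (hf : W f) : IsRegularEpi f := by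
  have := epi_of_cover hcancel hmono f hf
  refine IsRegularEpi.of_epi_of_exists fun Z g hg => ?_
  -- The image of `(f, g)` is the graph of the map that should descend: its first projection is a
  -- cover, and it is monic because `g` respects the kernel pair of `f`.
  obtain ⟨I, e, m, he, hm, hem⟩ := hfac (prod.lift f g)
  have e1 : e ≫ m ≫ prod.fst = f := by rw [← Category.assoc, hem, prod.lift_fst]
  have e2 : e ≫ m ≫ prod.snd = g := by rw [← Category.assoc, hem, prod.lift_snd]
  have h1 : W (m ≫ prod.fst) := hcancel e _ (by rwa [e1])
  have h2 : Mono (m ≫ prod.fst) := by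
    refine ⟨fun {T} a b hab => ?_⟩
    -- Both elements of the image lift to `X` after passing to covers.
    have p1 : W (pullback.fst a e) := MorphismProperty.pullback_fst _ _ he
    have := epi_of_cover hcancel hmono _ p1
    have p2 : W (pullback.fst (pullback.fst a e ≫ b) e) := MorphismProperty.pullback_fst _ _ he
    have := epi_of_cover hcancel hmono _ p2
    rw [← cancel_epi (pullback.fst a e), ← cancel_epi (pullback.fst (pullback.fst a e ≫ b) e),
      ← cancel_mono m]
    let x := pullback.fst (pullback.fst a e ≫ b) e ≫ pullback.snd a e
    let y := pullback.snd (pullback.fst a e ≫ b) e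
    have hx : pullback.fst (pullback.fst a e ≫ b) e ≫ pullback.fst a e ≫ a = x ≫ e := by
      simp only [x, Category.assoc, pullback.condition]
    have hy : pullback.fst (pullback.fst a e ≫ b) e ≫ pullback.fst a e ≫ b = y ≫ e := by
      simp only [y, ← pullback.condition]
    have hxy : x ≫ f = y ≫ f := by
      rw [← e1, ← Category.assoc, ← hx, ← Category.assoc y, ← hy]
      simp only [Category.assoc]
      rw [hab]
    rw [hx, hy, Category.assoc x, Category.assoc y, hem]
    ext
    · rwa [Category.assoc x, Category.assoc y, prod.lift_fst]
    · rw [Category.assoc x, Category.assoc y, prod.lift_snd]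
      exact comp_eq_of_pullback hg x y hxy
  have := hmono _ h1 h2
  refine ⟨inv (m ≫ prod.fst) ≫ m ≫ prod.snd, ?_⟩
  rw [← e2]
  conv_lhs => rw [← e1]
  simp

theorem cover_of_isRegularEpi [W.IsStableUnderBaseChange]
    (hfac : ∀ {X Y : C} (f : X ⟶ Y), ∃ (I : C) (e : X ⟶ I) (m : I ⟶ Y), W e ∧ Mono m ∧ e ≫ m = f)
    {X Y : C} (f : X ⟶ Y) (hf : IsRegularEpi f) : W f := by
  obtain ⟨I, e, m, he, hm, rfl⟩ := hfac f
  have := ExtremalEpi.isIso (f := e ≫ m) e m rfl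
  exact (MorphismProperty.cancel_right_of_respectsIso W e m).2 he

/-- If `f` is a cover `e` followed by a monomorphism, then `e` has the same kernel pair as `f` and
is the coequalizer of it. -/
theorem regular_of_cover [W.IsStableUnderBaseChange]
    (hcancel : ∀ {X Y Z : C} (f : X ⟶ Y) (g : Y ⟶ Z), W (f ≫ g) → W g)
    (hmono : ∀ {X Y : C} (f : X ⟶ Y), W f → Mono f → IsIso f)
    (hfac : ∀ {X Y : C} (f : X ⟶ Y), ∃ (I : C) (e : X ⟶ I) (m : I ⟶ Y), W e ∧ Mono m ∧ e ≫ m = f) :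
    Regular C where
  hasCoequalizer_of_isKernelPair {X Y Z f g₁ g₂} h := by
    obtain ⟨I, e, m, he, hm, rfl⟩ := hfac f
    have := isRegularEpi_of_cover hcancel hmono hfac e he
    have h' : IsKernelPair e g₁ g₂ := ⟨⟨by rw [← cancel_mono m]; simpa using h.w⟩,
      ⟨PullbackCone.isLimitOfFactors (e ≫ m) (e ≫ m) m e e rfl rfl _ h.isLimit⟩⟩
    exact ⟨⟨_, h'.toCoequalizer (IsRegularEpi.getStruct e)⟩⟩
  regularEpiIsStableUnderBaseChange := by
    have : MorphismProperty.regularEpi C = W := by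
      ext X Y f
      exact ⟨cover_of_isRegularEpi hfac f, isRegularEpi_of_cover hcancel hmono hfac f⟩
    rw [this]
    infer_instance

end Covers

/-! ### Generalized elements in regular categories -/

section Toolkit

variable {C : Type u₁} [Category.{v₁} C] {D : Type u₂} [Category.{v₂} D]

theorem mk_factors_iff_exists {X Y T : C} (m : Y ⟶ X) [Mono m] (x : T ⟶ X) :
    (Subobject.mk m).Factors x ↔ ∃ k : T ⟶ Y, k ≫ m = x :=
  Subobject.mk_factors_iff _ _

/-- Membership in a subobject is local for regular epimorphisms. -/
theorem factors_of_isRegularEpi {S T X : C} (U : Subobject X) (e : S ⟶ T) (he : IsRegularEpi e)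
    (x : T ⟶ X) (h : U.Factors (e ≫ x)) : U.Factors x := by
  have sq : CommSq (U.factorThru _ h) e U.arrow x := ⟨Subobject.factorThru_arrow _ _ _⟩
  rw [Subobject.factors_iff]
  exact ⟨sq.lift, sq.fac_right⟩

theorem subobject_ext {X : C} {U V : Subobject X}
    (h : ∀ {T : C} (x : T ⟶ X), U.Factors x ↔ V.Factors x) : U = V :=
  le_antisymm (Subobject.le_of_factors ((h _).1 U.factors_self))
    (Subobject.le_of_factors ((h _).2 V.factors_self))

theorem mapSub_factors_iff (F : C ⥤ D) [IsRegularFunctor F] {X : C} (U : Subobject X) {T : D}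
    (x : T ⟶ F.obj X) : (mapSub F U).Factors x ↔ ∃ k : T ⟶ F.obj (U : C), k ≫ F.map U.arrow = x :=
  Subobject.mk_factors_iff _ _

theorem mapSub_mk (F : C ⥤ D) [IsRegularFunctor F] {X Y : C} (m : Y ⟶ X) [Mono m] :
    mapSub F (Subobject.mk m) = Subobject.mk (F.map m) := by
  refine Subobject.mk_eq_mk_of_comm _ _ (F.mapIso (Subobject.underlyingIso m)) ?_
  rw [Functor.mapIso_hom, ← F.map_comp]
  congr 1
  rw [← Iso.eq_inv_comp]
  simp

theorem factors_mapSub (F : C ⥤ D) [IsRegularFunctor F] {X T : C} (U : Subobject X) (x : T ⟶ X)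
    (h : U.Factors x) : (mapSub F U).Factors (F.map x) :=
  (mapSub_factors_iff F U _).2 ⟨F.map (U.factorThru x h), by
    rw [← F.map_comp, Subobject.factorThru_arrow]⟩

theorem isRegularFunctor_of_iso {F G : C ⥤ D} (e : F ≅ G) [IsRegularFunctor F] :
    IsRegularFunctor G where
  preservesFiniteLimits := preservesFiniteLimits_of_natIso e
  map_regularEpi {X Y} f hf := by
    have h := IsRegularFunctor.map_regularEpi (F := F) _ hf
    have h2 : G.map f = e.inv.app X ≫ F.map f ≫ e.hom.app Y := by simp
    rw [h2]
    exact (MorphismProperty.cancel_left_of_respectsIso (MorphismProperty.regularEpi D) _ _).2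
      ((MorphismProperty.cancel_right_of_respectsIso (MorphismProperty.regularEpi D) _ _).2 h)

variable [Regular C]

theorem isRegularEpi_of_isPullback {P X Y Z : C} {f : P ⟶ X} {g : P ⟶ Y} {h : X ⟶ Z} {k : Y ⟶ Z}
    (sq : IsPullback f g h k) (hk : IsRegularEpi k) : IsRegularEpi f :=
  Regular.regularEpiIsStableUnderBaseChange.of_isPullback sq.flip hk

theorem isRegularEpi_comp {X Y Z : C} (f : X ⟶ Y) (g : Y ⟶ Z) (hf : IsRegularEpi f)
    (hg : IsRegularEpi g) : IsRegularEpi (f ≫ g) := by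
  have : StrongEpi (f ≫ g) := strongEpi_comp f g
  infer_instance

theorem isRegularEpi_of_comp {X Y Z : C} (f : X ⟶ Y) (g : Y ⟶ Z) (h : IsRegularEpi (f ≫ g)) :
    IsRegularEpi g := by
  have : StrongEpi g := strongEpi_of_strongEpi f g
  infer_instance

theorem isIso_of_isRegularEpi_of_mono {X Y : C} (f : X ⟶ Y) (hf : IsRegularEpi f) [Mono f] :
    IsIso f := isIso_of_mono_of_strongEpi f

/-- Every morphism factors as a regular epimorphism followed by a monomorphism. -/
theorem exists_image {X Y : C} (f : X ⟶ Y) :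
    ∃ (I : C) (e : X ⟶ I) (m : I ⟶ Y), IsRegularEpi e ∧ Mono m ∧ e ≫ m = f :=
  ⟨_, (Regular.strongEpiMonoFactorisation f).e, (Regular.strongEpiMonoFactorisation f).m,
    inferInstance, inferInstance, (Regular.strongEpiMonoFactorisation f).fac⟩

/-- The image of a subobject, in terms of generalized elements. -/
theorem exists_imageSub {X Y : C} (U : Subobject X) (f : X ⟶ Y) :
    ∃ V : Subobject Y, ∀ {T : C} (y : T ⟶ Y), V.Factors y ↔
      ∃ (S : C) (e : S ⟶ T) (x : S ⟶ X), IsRegularEpi e ∧ U.Factors x ∧ x ≫ f = e ≫ y := by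
  obtain ⟨I, e, m, he, hm, h⟩ := exists_image (U.arrow ≫ f)
  refine ⟨Subobject.mk m, fun y => ⟨fun hy => ?_, ?_⟩⟩
  · obtain ⟨k, hk⟩ := (mk_factors_iff_exists _ _).1 hy
    refine ⟨pullback k e, pullback.fst k e, pullback.snd k e ≫ U.arrow, inferInstance,
      Subobject.factors_comp_arrow _, ?_⟩
    rw [Category.assoc, ← h, ← hk, ← Category.assoc, ← pullback.condition, Category.assoc]
  · rintro ⟨S, p, x, hp, hx, hxy⟩
    refine factors_of_isRegularEpi _ p hp _ ?_
    rw [← hxy, ← Subobject.factorThru_arrow _ _ hx, Category.assoc, ← h, ← Category.assoc]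
    exact (mk_factors_iff_exists m _).2 ⟨_, rfl⟩

theorem isInhabited_of_hom {T U : C} (h : IsInhabited T) (k : T ⟶ U) : IsInhabited U := by
  refine isRegularEpi_of_comp k _ ?_
  rwa [show k ≫ terminal.from U = terminal.from T from Subsingleton.elim _ _]

theorem isInhabited_of_isRegularEpi {S T : C} (h : IsInhabited T) (e : S ⟶ T)
    (he : IsRegularEpi e) : IsInhabited S := by
  have := isRegularEpi_comp e _ he h
  rwa [show e ≫ terminal.from T = terminal.from S from Subsingleton.elim _ _] at this

/-- Cover of `T` over which an inhabited object has an element. -/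
theorem exists_cover_of_isInhabited {U : C} (h : IsInhabited U) (T : C) :
    ∃ (S : C) (e : S ⟶ T) (_ : S ⟶ U), IsRegularEpi e := by
  have : IsRegularEpi (terminal.from U) := h
  exact ⟨pullback (terminal.from T) (terminal.from U), pullback.fst _ _, pullback.snd _ _,
    inferInstance⟩

theorem intersects_of_factors {T X : C} (hT : IsInhabited T) {U V : Subobject X} (a : T ⟶ X)
    (hU : U.Factors a) (hV : V.Factors a) : Intersects U V :=
  isInhabited_of_hom hT ((U ⊓ V).factorThru a ((Subobject.inf_factors a).2 ⟨hU, hV⟩))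

/-- Locally common elements of intersecting subobjects. -/
theorem Intersects.exists_cover {X : C} {U V : Subobject X} (h : Intersects U V) (T : C) :
    ∃ (S : C) (e : S ⟶ T) (a : S ⟶ X), IsRegularEpi e ∧ U.Factors a ∧ V.Factors a := by
  obtain ⟨R, a, hR, hU, hV⟩ := h.exists_factors
  obtain ⟨S, e, k, he⟩ := exists_cover_of_isInhabited hR T
  exact ⟨S, e, k ≫ a, he, Subobject.factors_of_factors_right _ hU,
    Subobject.factors_of_factors_right _ hV⟩

/-- A common cover. -/
theorem exists_pullback_cover {S T R : C} (e : S ⟶ T) (he : IsRegularEpi e) (f : R ⟶ T) :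
    ∃ (Q : C) (e' : Q ⟶ R) (f' : Q ⟶ S), IsRegularEpi e' ∧ e' ≫ f = f' ≫ e :=
  ⟨pullback f e, pullback.fst f e, pullback.snd f e, inferInstance, pullback.condition⟩

theorem isInhabited_map [HasFiniteLimits D] (F : C ⥤ D) [IsRegularFunctor F] {T : C}
    (h : IsInhabited T) : IsInhabited (F.obj T) := by
  have h1 := IsRegularFunctor.map_regularEpi (F := F) _ h
  have h2 : F.map (terminal.from T) ≫ (PreservesTerminal.iso F).hom = terminal.from _ :=
    Subsingleton.elim _ _
  unfold IsInhabited
  rw [← h2]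
  exact (MorphismProperty.cancel_right_of_respectsIso (MorphismProperty.regularEpi D) _ _).2 h1

instance isRegularFunctor_comp {B : Type*} [Category* B] (F : B ⥤ C) (G : C ⥤ D)
    [IsRegularFunctor F] [IsRegularFunctor G] : IsRegularFunctor (F ⋙ G) where
  preservesFiniteLimits := inferInstance
  map_regularEpi f hf := IsRegularFunctor.map_regularEpi (F := G) _
    (IsRegularFunctor.map_regularEpi (F := F) f hf)

end Toolkit

/-- An equivalence relation that is the kernel pair of a regular epimorphism is effective. -/
theorem isEffective_of_isKernelPair {C : Type u₁} [Category.{v₁} C] {R X Q : C} (p₁ p₂ : R ⟶ X)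
    [h : IsEquivalenceRelation p₁ p₂] (q : X ⟶ Q) (hq : IsRegularEpi q)
    (hk : IsKernelPair q p₁ p₂) : IsEffectiveEquivalenceRelation p₁ p₂ := by
  obtain ⟨e⟩ := h.nonempty_equivalenceRelation
  have hc := hk.toCoequalizer (IsRegularEpi.getStruct q)
  -- Reflexivity forces the two legs of a cocone under the span to coincide, so the coequalizer is
  -- also the pushout that effectivity asks for.
  have aux : ∀ {Z : C} (a b : X ⟶ Z), p₁ ≫ a = p₂ ≫ b → a = b := fun a b hab => by
    have := congrArg (fun w => e.r ≫ w) hab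
    simpa using this
  have key : ∀ s : PushoutCocone p₁ p₂, p₁ ≫ s.inl = p₂ ≫ s.inl := fun s => by
    rw [aux _ _ s.condition, ← s.condition, aux _ _ s.condition]
  have fac : ∀ s : PushoutCocone p₁ p₂, q ≫ Cofork.IsColimit.desc hc s.inl (key s) = s.inl :=
    fun s => Cofork.IsColimit.π_desc hc
  exact ⟨⟨{ e with
    B := Q
    π := q
    isKernelPair := hk
    isPushout := ⟨⟨hk.w⟩, ⟨PushoutCocone.IsColimit.mk _
      (fun s => Cofork.IsColimit.desc hc s.inl (key s)) fac
      (fun s => (fac s).trans (aux _ _ s.condition))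
      (fun s m h1 _ => by rw [← cancel_epi q]; exact h1.trans (fac s).symm)⟩⟩ }⟩⟩

/-! ### A topos is an exact category -/

section Topos

variable {E : Type u} [Category.{v} E] [CartesianMonoidalCategory E] [HasFiniteLimits E]

theorem exists_forall_factors_iff [MonoidalClosed E] [HasSubobjectClassifier E] {Z A : E}
    (φ : Subobject (Z ⊗ A)) : ∃ W : Subobject A, ∀ {T : E} (a : T ⟶ A),
      W.Factors a ↔ ∀ {S : E} (s : S ⟶ T) (z : S ⟶ Z), φ.Factors (lift z (s ≫ a)) := by
  obtain ⟨W, hW⟩ := exists_forall φ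
  refine ⟨W, fun {T} a => (hW a).trans ⟨fun h S s z => ?_, fun h => ?_⟩⟩
  · have : lift z (s ≫ a) = lift z s ≫ Z ◁ a := by simp
    rw [this]
    exact Subobject.factors_of_factors_right _ h
  · have : Z ◁ a = lift (fst Z T) (snd Z T ≫ a) := by ext <;> simp
    rw [this]
    exact h _ _

variable (E) in
/-- The object of truth values, in terms of generalized elements. -/
theorem exists_omega [HasSubobjectClassifier E] : ∃ (Ω : E) (t : Subobject Ω),
    (∀ {T : E} (f g : T ⟶ Ω), (∀ {S : E} (s : S ⟶ T), t.Factors (s ≫ f) ↔ t.Factors (s ≫ g)) →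
      f = g) ∧
    ∀ {B : E} (U : Subobject B), ∃ χ : B ⟶ Ω, ∀ {T : E} (b : T ⟶ B),
      U.Factors b ↔ t.Factors (b ≫ χ) := by
  obtain ⟨⟨c⟩⟩ := ‹HasSubobjectClassifier E›
  refine ⟨c.Ω, c.truth_as_subobject, fun f g h => ?_, fun U => ?_⟩
  · refine c.representableBy.homEquiv.injective ?_
    change (Subobject.pullback f).obj c.truth_as_subobject =
      (Subobject.pullback g).obj c.truth_as_subobject
    refine subobject_ext fun x => ?_
    rw [pullback_factors_iff, pullback_factors_iff]
    exact h x
  · refine ⟨c.χ U.arrow, fun b => ?_⟩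
    rw [← pullback_factors_iff, c.pullback_χ_obj_mk_truth, Subobject.mk_arrow]

/-- The implication is the locus where the characteristic maps of `U` and `U ⊓ V` agree. -/
theorem exists_imp [HasSubobjectClassifier E] {B : E} (U V : Subobject B) :
    ∃ W : Subobject B, ∀ {T : E} (b : T ⟶ B),
      W.Factors b ↔ ∀ {S : E} (s : S ⟶ T), U.Factors (s ≫ b) → V.Factors (s ≫ b) := by
  obtain ⟨Ω, t, hext, hchar⟩ := exists_omega E
  obtain ⟨χ, hχ⟩ := hchar U
  obtain ⟨ψ, hψ⟩ := hchar (U ⊓ V)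
  refine ⟨equalizerSubobject χ ψ, fun {T} b => ?_⟩
  rw [equalizerSubobject_factors_iff]
  constructor
  · intro h S s hs
    rw [hχ, Category.assoc, h, ← Category.assoc, ← hψ, Subobject.inf_factors] at hs
    exact hs.2
  · intro h
    refine hext _ _ fun s => ?_
    rw [← Category.assoc, ← Category.assoc, ← hχ, ← hψ, Subobject.inf_factors]
    exact ⟨fun hs => ⟨hs, h s hs⟩, fun hs => hs.1⟩

/-- Arrows that are surjective in the internal logic. -/
def Surj : MorphismProperty E := fun X Y e => ∀ ⦃S : E⦄ (y : S ⟶ Y) (p : Subobject S),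
  (∀ ⦃T : E⦄ (t : T ⟶ S) (x : T ⟶ X), x ≫ e = t ≫ y → p.Factors t) → p.Factors (𝟙 S)

instance : (Surj (E := E)).IsStableUnderBaseChange where
  of_isPullback {X Y Y' S f g f' g'} sq hg Z y p h := by
    refine hg (y ≫ f) p fun T t x e => h t (sq.lift x (t ≫ y) (by simpa using e)) ?_
    exact sq.lift_snd _ _ _

theorem surj_of_comp {X Y Z : E} (f : X ⟶ Y) (g : Y ⟶ Z) (h : Surj (f ≫ g)) : Surj g :=
  fun _ y p hp => h y p fun _ t x e => hp t (x ≫ f) (by rw [Category.assoc, e])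

/-- The test subobject is `f` itself, at the generic element of `Y`; this gives a section of `f`. -/
theorem isIso_of_surj_of_mono {X Y : E} (f : X ⟶ Y) (h : Surj f) (_ : Mono f) : IsIso f := by
  have h1 := h (𝟙 Y) (Subobject.mk f) fun T t x e => by
    rw [Category.comp_id] at e
    exact (mk_factors_iff_exists _ _).2 ⟨x, e⟩
  obtain ⟨k, hk⟩ := (mk_factors_iff_exists _ _).1 h1
  exact ⟨k, by rw [← cancel_mono f, Category.assoc, hk]; simp, hk⟩

variable [MonoidalClosed E] [HasSubobjectClassifier E]

/-- The image has the second-order definition {y | ∀ ω ∈ Ω, (∀ x, f x = y → ω) → ω}, which needs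
only implication and universal quantification. `A₁`, `A₂`, `A₃` and `W` are its successive
subformulas. -/
theorem exists_surj_mono {X Y : E} (f : X ⟶ Y) :
    ∃ (I : E) (e : X ⟶ I) (m : I ⟶ Y), Surj e ∧ Mono m ∧ e ≫ m = f := by
  obtain ⟨Ω, t, hext, hchar⟩ := exists_omega E
  obtain ⟨A₁, h₁⟩ := exists_imp (B := X ⊗ (Ω ⊗ Y))
    (equalizerSubobject (fst _ _ ≫ f) (snd _ _ ≫ snd _ _))
    ((Subobject.pullback (snd _ _ ≫ fst _ _)).obj t)
  obtain ⟨A₂, h₂⟩ := exists_forall_factors_iff A₁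
  obtain ⟨A₃, h₃⟩ := exists_imp A₂ ((Subobject.pullback (fst _ _)).obj t)
  obtain ⟨W, hW⟩ := exists_forall_factors_iff A₃
  simp only [equalizerSubobject_factors_iff, pullback_factors_iff, h₁, h₂, h₃, comp_lift,
    lift_fst, lift_snd, ← Category.assoc] at hW
  simp only [Category.assoc] at hW
  have hf : W.Factors f := by
    rw [hW]
    intro S s z S' s' h
    simpa using h (𝟙 S') (s' ≫ s) (𝟙 S') (by simp)
  refine ⟨W, W.factorThru f hf, W.arrow, fun S y p h => ?_, inferInstance,
    W.factorThru_arrow f hf⟩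
  obtain ⟨χ, hχ⟩ := hchar p
  -- The truth value ω is instantiated with the characteristic map of `p`.
  have := (hW (y ≫ W.arrow)).1 (W.factors_comp_arrow y) (𝟙 S) χ (𝟙 S) (fun s x _ r e => by
    rw [← Category.assoc, ← Category.assoc, ← hχ]
    refine h _ (r ≫ x) ?_
    rw [← cancel_mono W.arrow]
    simpa using e)
  rw [hχ]
  exact this

variable (E)

theorem regular_of_topos : Regular E :=
  regular_of_cover (W := Surj) surj_of_comp isIso_of_surj_of_mono exists_surj_mono

/-- The quotient is the image of the map from `X` to its power object that sends an element to its
equivalence class. -/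
theorem barrExact_of_topos : BarrExact E where
  toRegular := regular_of_topos E
  effective {R X} p₁ p₂ h := by
    have := regular_of_topos E
    obtain ⟨e⟩ := h.nonempty_equivalenceRelation
    obtain ⟨Ω, t, hext, hchar⟩ := exists_omega E
    have : Mono (lift p₁ p₂) := ⟨fun f g hfg => e.right_cancellation f g
      (by simpa using congrArg (· ≫ fst _ _) hfg) (by simpa using congrArg (· ≫ snd _ _) hfg)⟩
    obtain ⟨χ, hχ⟩ := hchar (Subobject.mk (lift p₁ p₂))
    let rel {T : E} (a b : T ⟶ X) : Prop := ∃ r : T ⟶ R, r ≫ p₁ = a ∧ r ≫ p₂ = b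
    have hrel : ∀ {T : E} (a b : T ⟶ X), rel a b ↔ t.Factors (lift a b ≫ χ) := fun {T} a b => by
      rw [← hχ, mk_factors_iff_exists]
      constructor
      · rintro ⟨r, rfl, rfl⟩
        exact ⟨r, comp_lift _ _ _⟩
      · rintro ⟨r, hr⟩
        rw [comp_lift] at hr
        exact ⟨r, by simpa using congrArg (· ≫ fst _ _) hr,
          by simpa using congrArg (· ≫ snd _ _) hr⟩
    have rel_symm : ∀ {T : E} {a b : T ⟶ X}, rel a b → rel b a := by
      rintro T a b ⟨r, rfl, rfl⟩
      exact ⟨r ≫ e.s, by rw [Category.assoc, e.symmetry₁], by rw [Category.assoc, e.symmetry₂]⟩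
    have rel_trans : ∀ {T : E} {a b c : T ⟶ X}, rel a b → rel b c → rel a c := by
      rintro T a b c ⟨r, rfl, rfl⟩ ⟨s, hs, rfl⟩
      refine ⟨PullbackCone.IsLimit.lift e.isLimit r s hs.symm ≫ e.t, ?_, ?_⟩
      · rw [Category.assoc, e.transitivity₁, ← Category.assoc, PullbackCone.IsLimit.lift_fst]
      · rw [Category.assoc, e.transitivity₂, ← Category.assoc, PullbackCone.IsLimit.lift_snd]
    obtain ⟨Q, q, m, hq, hm, hqm⟩ := exists_image (MonoidalClosed.curry χ)
    have key : ∀ {T : E} (a b : T ⟶ X), a ≫ q = b ≫ q ↔ rel a b := fun {T} a b => by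
      rw [← cancel_mono m, Category.assoc, Category.assoc, hqm,
        ← MonoidalClosed.curry_natural_left, ← MonoidalClosed.curry_natural_left,
        MonoidalClosed.curry_injective.eq_iff]
      constructor
      · intro hab
        have h1 : rel a a := ⟨a ≫ e.r, by simp, by simp⟩
        -- Equal classes are compared at the element `a`, which belongs to its own class by
        -- reflexivity.
        have h2 := congrArg (fun w => lift a (𝟙 T) ≫ w) hab
        simp only [lift_whiskerLeft_assoc, Category.id_comp] at h2
        rwa [hrel, h2, ← hrel] at h1
      · intro hab
        refine hext _ _ fun {S} s => ?_
        have h3 : ∀ c : T ⟶ X, s ≫ X ◁ c = lift (s ≫ fst _ _) (s ≫ snd _ _ ≫ c) := fun c => by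
          ext <;> simp
        have h4 : rel (s ≫ snd _ _ ≫ a) (s ≫ snd _ _ ≫ b) := by
          obtain ⟨r, rfl, rfl⟩ := hab
          exact ⟨s ≫ snd _ _ ≫ r, by simp, by simp⟩
        rw [← Category.assoc, ← Category.assoc, h3, h3, ← hrel, ← hrel]
        exact ⟨fun h => rel_trans h h4, fun h => rel_trans h (rel_symm h4)⟩
    refine isEffective_of_isKernelPair p₁ p₂ q hq ⟨⟨(key p₁ p₂).2 ⟨𝟙 R, by simp, by simp⟩⟩, ⟨?_⟩⟩
    refine PullbackCone.IsLimit.mk _ (fun s => ((key _ _).1 s.condition).choose)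
      (fun s => ((key _ _).1 s.condition).choose_spec.1)
      (fun s => ((key _ _).1 s.condition).choose_spec.2) (fun s m h1 h2 => ?_)
    exact e.right_cancellation _ _ (h1.trans ((key _ _).1 s.condition).choose_spec.1.symm)
      (h2.trans ((key _ _).1 s.condition).choose_spec.2.symm)

end Topos

/-! ### Kan extension of regular functors along a generating embedding -/

section Extension

variable {C : Type u} [Category.{v} C] [Regular C] {X : Type u₁} [Category.{v₁} X]
  {D : Type u₂} [Category.{v₂} D]

/-- `I : C ⥤ X` is a fully faithful regular functor to an exact category, every object of which is a
quotient of an object in the image, and whose image is closed under subobjects. -/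
structure IsGenerating (I : C ⥤ X) : Prop where
  exact : BarrExact X
  regular : IsRegularFunctor I
  full : I.Full
  faithful : I.Faithful
  covers : ∀ Q : X, ∃ (c : C) (p : I.obj c ⟶ Q), IsRegularEpi p
  sub : ∀ {c : C} {U : X} (m : U ⟶ I.obj c), Mono m → ∃ d : C, Nonempty (I.obj d ≅ U)

theorem jointlyMono_map {F : C ⥤ X} [PreservesFiniteLimits F] {R A B : C} {a : R ⟶ A} {b : R ⟶ B}
    (h : JointlyMono₂ a b) : JointlyMono₂ (F.map a) (F.map b) where
  right_cancellation Y f g ha hb := by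
    have : Mono (prod.lift a b) := ⟨fun f g e => h.right_cancellation f g
      (by simpa only [Category.assoc, prod.lift_fst] using congrArg (· ≫ prod.fst) e)
      (by simpa only [Category.assoc, prod.lift_snd] using congrArg (· ≫ prod.snd) e)⟩
    rw [← cancel_mono (F.map (prod.lift a b))]
    refine BinaryFan.IsLimit.hom_ext (isLimitOfHasBinaryProductOfPreservesLimit F A B) ?_ ?_
    · change (f ≫ F.map _) ≫ F.map prod.fst = (g ≫ F.map _) ≫ F.map prod.fst
      rwa [Category.assoc, Category.assoc, ← F.map_comp, prod.lift_fst]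
    · change (f ≫ F.map _) ≫ F.map prod.snd = (g ≫ F.map _) ≫ F.map prod.snd
      rwa [Category.assoc, Category.assoc, ← F.map_comp, prod.lift_snd]

theorem jointlyMono_of_isPullback {P A B Z : X} {a : P ⟶ A} {b : P ⟶ B} {f : A ⟶ Z} {g : B ⟶ Z}
    (sq : IsPullback a b f g) : JointlyMono₂ a b where
  right_cancellation _ _ _ ha hb := sq.hom_ext ha hb

theorem isEquivalenceRelation_map (F : C ⥤ D) [PreservesFiniteLimits F] {R A : C} (p₁ p₂ : R ⟶ A)
    [h : IsEquivalenceRelation p₁ p₂] : IsEquivalenceRelation (F.map p₁) (F.map p₂) := by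
  obtain ⟨e⟩ := h.nonempty_equivalenceRelation
  have := jointlyMono_map (F := F) e.toJointlyMono₂
  exact ⟨⟨{ e.toReflexiveRelation.map F, e.toSymmetricRelation.map F, e.toTransitiveRelation.map F
    with }⟩⟩

namespace IsGenerating

variable {I : C ⥤ X} (hI : IsGenerating I)
include hI

/-- The monic part of the image factorization of `f` becomes a monic regular epimorphism under `I`,
and `I` reflects isomorphisms. -/
theorem isRegularEpi_of_map {a b : C} (f : a ⟶ b) (h : IsRegularEpi (I.map f)) :
    IsRegularEpi f := by
  have := hI.exact; have := hI.regular; have := hI.full; have := hI.faithful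
  obtain ⟨J, e, m, he, hm, rfl⟩ := exists_image f
  rw [I.map_comp] at h
  have h1 := isRegularEpi_of_comp _ _ h
  have h2 := isIso_of_isRegularEpi_of_mono _ h1
  have h3 : IsIso m := isIso_of_reflects_iso m I
  exact (MorphismProperty.cancel_right_of_respectsIso (MorphismProperty.regularEpi C) e m).2 he

/-- A relation between objects of the image is a subobject of the image of a product, and the image
is closed under subobjects. -/
theorem exists_iso_of_jointlyMono {U : X} {c d : C} (m₁ : U ⟶ I.obj c) (m₂ : U ⟶ I.obj d)
    (h : JointlyMono₂ m₁ m₂) : ∃ (w : C) (a : w ⟶ c) (b : w ⟶ d) (θ : I.obj w ≅ U),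
      θ.hom ≫ m₁ = I.map a ∧ θ.hom ≫ m₂ = I.map b := by
  have := hI.exact; have := hI.regular; have := hI.full; have := hI.faithful
  let hl := isLimitOfHasBinaryProductOfPreservesLimit I c d
  let m : U ⟶ I.obj (c ⨯ d) := hl.lift (BinaryFan.mk m₁ m₂)
  have e1 : m ≫ I.map prod.fst = m₁ := hl.fac (BinaryFan.mk m₁ m₂) ⟨WalkingPair.left⟩
  have e2 : m ≫ I.map prod.snd = m₂ := hl.fac (BinaryFan.mk m₁ m₂) ⟨WalkingPair.right⟩
  have : Mono m := ⟨fun f g e => h.right_cancellation f g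
    (by rw [← e1, reassoc_of% e]) (by rw [← e2, reassoc_of% e])⟩
  obtain ⟨w, ⟨θ⟩⟩ := hI.sub m this
  exact ⟨w, I.preimage (θ.hom ≫ m) ≫ prod.fst, I.preimage (θ.hom ≫ m) ≫ prod.snd, θ,
    by simp [e1], by simp [e2]⟩

/-- Pullbacks of objects in the image of `I` lie in the image of `I`. -/
theorem exists_isPullback {Q : X} {c d : C} (g : I.obj c ⟶ Q) (p : I.obj d ⟶ Q) :
    ∃ (w : C) (a : w ⟶ c) (b : w ⟶ d), IsPullback (I.map a) (I.map b) g p := by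
  have := hI.exact
  obtain ⟨w, a, b, θ, ha, hb⟩ := hI.exists_iso_of_jointlyMono (pullback.fst g p) (pullback.snd g p)
    (jointlyMono_of_isPullback (IsPullback.of_hasPullback g p))
  refine ⟨w, a, b, IsPullback.of_iso (IsPullback.of_hasPullback g p) θ.symm (Iso.refl _)
    (Iso.refl _) (Iso.refl _) ?_ ?_ ?_ ?_⟩ <;> simp [← ha, ← hb]

theorem exists_isPullback_regularEpi {Q : X} {c d : C} (g : I.obj c ⟶ Q) (p : I.obj d ⟶ Q)
    (hp : IsRegularEpi p) : ∃ (w : C) (a : w ⟶ c) (b : w ⟶ d), IsRegularEpi a ∧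
      IsPullback (I.map a) (I.map b) g p := by
  have := hI.exact
  obtain ⟨w, a, b, h⟩ := hI.exists_isPullback g p
  exact ⟨w, a, b, hI.isRegularEpi_of_map a (isRegularEpi_of_isPullback h hp), h⟩

theorem isEquivalenceRelation_of_isKernelPair {Q : X} {c R : C} {p : I.obj c ⟶ Q} {r₁ r₂ : R ⟶ c}
    (h : IsKernelPair p (I.map r₁) (I.map r₂)) : IsEquivalenceRelation r₁ r₂ := by
  have := hI.full; have := hI.faithful
  have hw := h.w
  have lift : ∀ {T : C} (a b : T ⟶ c), I.map a ≫ p = I.map b ≫ p →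
      ∃ t : T ⟶ R, t ≫ r₁ = a ∧ t ≫ r₂ = b := fun a b e => by
    refine ⟨I.preimage (h.lift _ _ e), I.map_injective ?_, I.map_injective ?_⟩
    · simp
    · simp
  obtain ⟨r, h1, h2⟩ := lift (𝟙 c) (𝟙 c) rfl
  obtain ⟨s, h3, h4⟩ := lift r₂ r₁ hw.symm
  obtain ⟨t, h5, h6⟩ := lift (pullback.fst r₂ r₁ ≫ r₁) (pullback.snd r₂ r₁ ≫ r₂) (by
    rw [I.map_comp_assoc, I.map_comp_assoc, ← hw, hw, ← I.map_comp_assoc, pullback.condition,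
      I.map_comp_assoc, hw])
  exact ⟨⟨{
    right_cancellation := fun Y f g e1 e2 => I.map_injective (h.hom_ext
      (by rw [← I.map_comp, ← I.map_comp, e1]) (by rw [← I.map_comp, ← I.map_comp, e2]))
    r := r, reflexivity₁ := h1, reflexivity₂ := h2
    s := s, symmetry₁ := h3, symmetry₂ := h4
    c := _, isLimit := pullback.isLimit r₂ r₁
    t := t, transitivity₁ := h5, transitivity₂ := h6 }⟩⟩

variable [Regular D] (K : C ⥤ D) [IsRegularFunctor K]

/-- Compatible families under `K`, over the objects of `C` above a quotient `Q` of `I c`, are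
determined by their component at the quotient map. -/
theorem existsUnique_desc {Q : X} {c R : C} {p : I.obj c ⟶ Q} (hp : IsRegularEpi p)
    {r₁ r₂ : R ⟶ c} (h : IsKernelPair p (I.map r₁) (I.map r₂)) {Z : D} (e : K.obj c ⟶ Z)
    (he : K.map r₁ ≫ e = K.map r₂ ≫ e) {d : C} (g : I.obj d ⟶ Q) :
    ∃! φ : K.obj d ⟶ Z, ∀ {w : C} (a : w ⟶ d) (b : w ⟶ c), I.map a ≫ g = I.map b ≫ p →
      K.map a ≫ φ = K.map b ≫ e := by
  have := hI.full; have := hI.faithful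
  -- The pullback of `p` along `g` comes from a regular epimorphism `a` in `C`. The component at `g`
  -- is the descent of `K.map b ≫ e` along `K.map a`.
  obtain ⟨w, a, b, ha, sq⟩ := hI.exists_isPullback_regularEpi g p hp
  have hKa := IsRegularFunctor.map_regularEpi (F := K) a ha
  have hk : IsKernelPair (K.map a) (K.map (pullback.fst a a)) (K.map (pullback.snd a a)) :=
    (IsPullback.of_hasPullback a a).map K
  have hc := hk.toCoequalizer (IsRegularEpi.getStruct _)
  have hw : K.map (pullback.fst a a) ≫ K.map b ≫ e = K.map (pullback.snd a a) ≫ K.map b ≫ e := by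
    -- Two elements of `w` over the same element of `d` have images in `c` that are related by `R`,
    -- and `e` identifies those under `K`.
    have e1 : I.map (pullback.fst a a ≫ b) ≫ p = I.map (pullback.snd a a ≫ b) ≫ p := by
      simp only [I.map_comp, Category.assoc, ← sq.w]
      rw [← I.map_comp_assoc, pullback.condition, I.map_comp_assoc]
    obtain ⟨t, h1, h2⟩ : ∃ t : pullback a a ⟶ R, t ≫ r₁ = pullback.fst a a ≫ b ∧
        t ≫ r₂ = pullback.snd a a ≫ b :=
      ⟨I.preimage (h.lift _ _ e1), I.map_injective (by simp), I.map_injective (by simp)⟩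
    rw [← K.map_comp_assoc, ← K.map_comp_assoc, ← h1, ← h2, K.map_comp_assoc, K.map_comp_assoc, he]
  have hfac : K.map a ≫ Cofork.IsColimit.desc hc (K.map b ≫ e) hw = K.map b ≫ e :=
    Cofork.IsColimit.π_desc hc
  refine ⟨Cofork.IsColimit.desc hc (K.map b ≫ e) hw, fun {w'} a' b' e' => ?_, fun φ hφ => ?_⟩
  · obtain ⟨t, h1, h2⟩ : ∃ t : w' ⟶ w, t ≫ a = a' ∧ t ≫ b = b' :=
      ⟨I.preimage (sq.lift _ _ e'), I.map_injective (by simp), I.map_injective (by simp)⟩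
    rw [← h1, ← h2, K.map_comp_assoc, K.map_comp_assoc, hfac]
  · rw [← cancel_epi (K.map a), hfac, hφ a b sq.w]

/-- The colimit of `K` over the objects of `C` above a quotient `Q` of `I c`. -/
theorem exists_universal_family {Q : X} {c R : C} {p : I.obj c ⟶ Q} (hp : IsRegularEpi p)
    {r₁ r₂ : R ⟶ c} (h : IsKernelPair p (I.map r₁) (I.map r₂)) {Z : D} (e : K.obj c ⟶ Z)
    (he : K.map r₁ ≫ e = K.map r₂ ≫ e) (hc : IsColimit (Cofork.ofπ e he)) :
    ∃ φ : ∀ d : C, (I.obj d ⟶ Q) → (K.obj d ⟶ Z),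
      (∀ (d d' : C) (f : d ⟶ d') (g : I.obj d' ⟶ Q), K.map f ≫ φ d' g = φ d (I.map f ≫ g)) ∧
      φ c p = e ∧
      ∀ {Z' : D} (ψ : ∀ d : C, (I.obj d ⟶ Q) → (K.obj d ⟶ Z')),
        (∀ (d d' : C) (f : d ⟶ d') (g : I.obj d' ⟶ Q), K.map f ≫ ψ d' g = ψ d (I.map f ≫ g)) →
        ∃ m : Z ⟶ Z', (∀ d g, φ d g ≫ m = ψ d g) ∧ ∀ m', e ≫ m' = ψ c p → m' = m := by
  choose φ hφ hφ' using fun (d : C) (g : I.obj d ⟶ Q) => hI.existsUnique_desc K hp h e he g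
  refine ⟨φ, fun d d' f g => hφ' _ _ _ fun a b e => ?_, ?_, fun ψ hψ => ?_⟩
  · rw [← hφ d' g (a ≫ f) b (by simpa using e), K.map_comp, Category.assoc]
  · simpa using hφ c p (𝟙 c) (𝟙 c) rfl
  · have hr : K.map r₁ ≫ ψ c p = K.map r₂ ≫ ψ c p := by rw [hψ, hψ, h.w]
    have h3 : e ≫ Cofork.IsColimit.desc hc (ψ c p) hr = ψ c p := Cofork.IsColimit.π_desc hc
    refine ⟨Cofork.IsColimit.desc hc (ψ c p) hr, fun d g => ?_, fun m' hm' => ?_⟩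
    · obtain ⟨w, a, b, ha, sq⟩ := hI.exists_isPullback_regularEpi g p hp
      have hKa := IsRegularFunctor.map_regularEpi (F := K) a ha
      rw [← cancel_epi (K.map a), reassoc_of% (hφ d g a b sq.w), h3, hψ, hψ, sq.w]
    · exact Cofork.IsColimit.hom_ext hc (hm'.trans h3.symm)

/-- A regular functor on `X` is a pointwise left Kan extension of its restriction to `C`. -/
theorem nonempty_isPointwiseLeftKanExtension (L : X ⥤ D) [IsRegularFunctor L] :
    Nonempty (Functor.LeftExtension.mk L (𝟙 (I ⋙ L))).IsPointwiseLeftKanExtension := by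
  have := hI.regular
  refine ⟨fun Q => Nonempty.some ?_⟩
  obtain ⟨c, p, hp⟩ := hI.covers Q
  obtain ⟨R, r₁, r₂, h⟩ := hI.exists_isPullback p p
  have : Regular X := hI.exact.toRegular
  have hLp := IsRegularFunctor.map_regularEpi (F := L) p hp
  have hk : IsKernelPair (L.map p) ((I ⋙ L).map r₁) ((I ⋙ L).map r₂) := IsPullback.map L h
  have hc := hk.toCoequalizer (IsRegularEpi.getStruct _)
  obtain ⟨φ, hφ, hφp, hu⟩ := hI.exists_universal_family (I ⋙ L) hp h (L.map p) hk.w hc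
  have aux : ∀ (s : Cocone (CostructuredArrow.proj I Q ⋙ I ⋙ L)) (d d' : C) (f : d ⟶ d')
      (g : I.obj d' ⟶ Q), (I ⋙ L).map f ≫ s.ι.app (CostructuredArrow.mk g) =
        s.ι.app (CostructuredArrow.mk (I.map f ≫ g)) := fun s d d' f g =>
    s.w (CostructuredArrow.homMk f : CostructuredArrow.mk (I.map f ≫ g) ⟶ CostructuredArrow.mk g)
  choose m hm hm' using fun s : Cocone (CostructuredArrow.proj I Q ⋙ I ⋙ L) =>
    hu (fun d g => s.ι.app (CostructuredArrow.mk g)) (aux s)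
  -- The maps `L.map g` form a compatible family, which induces the identity of `L Q`; so they are
  -- the universal family.
  obtain ⟨n, hn, hn'⟩ := hu (fun d g => L.map g) (fun d d' f g => (L.map_comp _ _).symm)
  have hn1 : n = 𝟙 _ := (hn' _ (Category.comp_id _)).symm
  have hφL : ∀ d g, φ d g = L.map g := fun d g => by rw [← hn, hn1]; exact (Category.comp_id _).symm
  refine ⟨{ desc := m, fac := fun s g => ?_, uniq := fun s k hk => hm' s k ?_ }⟩
  · refine Eq.trans ?_ (hm s _ g.hom)
    rw [hφL]
    exact congrArg (· ≫ m s) (Category.id_comp _)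
  · refine Eq.trans ?_ (hk (CostructuredArrow.mk p))
    exact congrArg (· ≫ k) (Category.id_comp _).symm

/-- This is the universal property of `L` as a left Kan extension of its own restriction; `L'` may
be any functor. -/
theorem bijective_whiskerLeft (L L' : X ⥤ D) [IsRegularFunctor L] :
    Function.Bijective (fun α : L ⟶ L' => Functor.whiskerLeft I α) := by
  obtain ⟨h⟩ := hI.nonempty_isPointwiseLeftKanExtension L
  have : L.IsLeftKanExtension (𝟙 (I ⋙ L)) := h.isLeftKanExtension
  convert (L.homEquivOfIsLeftKanExtension (𝟙 (I ⋙ L)) L').bijective using 1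
  ext α
  simp

end IsGenerating

end Extension

/-! ### Regularity of the Kan extension -/

section Extension

variable {C : Type u} [Category.{v} C] [Regular C] {X : Type u₁} [Category.{v₁} X]
  {D : Type u₂} [Category.{v₂} D]

/-- The functor `L` maps quotients of objects of `C` to quotients, and preserves their kernel
pairs. -/
def PreservesQuotients (I : C ⥤ X) (L : X ⥤ D) : Prop :=
  ∀ {Q : X} {c R : C} (p : I.obj c ⟶ Q) (r₁ r₂ : R ⟶ c), IsRegularEpi p →
    IsKernelPair p (I.map r₁) (I.map r₂) →
    IsRegularEpi (L.map p) ∧ IsKernelPair (L.map p) (L.map (I.map r₁)) (L.map (I.map r₂))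

theorem exists_lift_map_map {I : C ⥤ X} {L : X ⥤ D} [PreservesFiniteLimits (I ⋙ L)] {c d e : C}
    (f : c ⟶ e) (g : d ⟶ e) {S : D} (x : S ⟶ L.obj (I.obj c)) (y : S ⟶ L.obj (I.obj d))
    (h : x ≫ L.map (I.map f) = y ≫ L.map (I.map g)) :
    ∃ (w : C) (s : w ⟶ c) (t : w ⟶ d) (z : S ⟶ L.obj (I.obj w)), s ≫ f = t ≫ g ∧
      z ≫ L.map (I.map s) = x ∧ z ≫ L.map (I.map t) = y := by
  have sq := (IsPullback.of_hasPullback f g).map (I ⋙ L)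
  exact ⟨_, _, _, sq.lift x y h, pullback.condition, sq.lift_fst _ _ _, sq.lift_snd _ _ _⟩

theorem exists_lift_map_map₂ {I : C ⥤ X} {L : X ⥤ D} [PreservesFiniteLimits (I ⋙ L)] {m n c : C}
    (a₁ b₁ : m ⟶ c) (a₂ b₂ : n ⟶ c) {S : D} (x : S ⟶ L.obj (I.obj m)) (y : S ⟶ L.obj (I.obj n))
    (h : x ≫ L.map (I.map a₁) = y ≫ L.map (I.map a₂))
    (h' : x ≫ L.map (I.map b₁) = y ≫ L.map (I.map b₂)) :
    ∃ (w : C) (s : w ⟶ m) (t : w ⟶ n) (z : S ⟶ L.obj (I.obj w)), s ≫ a₁ = t ≫ a₂ ∧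
      s ≫ b₁ = t ≫ b₂ ∧ z ≫ L.map (I.map s) = x ∧ z ≫ L.map (I.map t) = y := by
  obtain ⟨w, s, t, z, e, e₁, e₂⟩ := exists_lift_map_map (I := I) (L := L) (prod.lift a₁ b₁)
    (prod.lift a₂ b₂) x y (by
      refine BinaryFan.IsLimit.hom_ext (isLimitOfHasBinaryProductOfPreservesLimit (I ⋙ L) c c) ?_ ?_
      · change (x ≫ L.map (I.map _)) ≫ L.map (I.map prod.fst) =
          (y ≫ L.map (I.map _)) ≫ L.map (I.map prod.fst)
        simp only [Category.assoc, ← L.map_comp, ← I.map_comp, prod.lift_fst, h]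
      · change (x ≫ L.map (I.map _)) ≫ L.map (I.map prod.snd) =
          (y ≫ L.map (I.map _)) ≫ L.map (I.map prod.snd)
        simp only [Category.assoc, ← L.map_comp, ← I.map_comp, prod.lift_snd, h'])
  refine ⟨w, s, t, z, ?_, ?_, e₁, e₂⟩
  · simpa only [Category.assoc, prod.lift_fst] using congrArg (· ≫ prod.fst) e
  · simpa only [Category.assoc, prod.lift_snd] using congrArg (· ≫ prod.snd) e

namespace IsGenerating

variable {I : C ⥤ X} (hI : IsGenerating I)
include hI

variable [Regular D]

/-- Locally `x` and `y` come from generators of `Q₁` and `Q₂` whose images in a generator of `Q₀`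
are related by its kernel pair `R`. Such configurations are classified by an iterated pullback in
`C`, which `I ⋙ L` preserves and which maps to `P`. -/
theorem exists_lift_of_isPullback {L : X ⥤ D} [IsRegularFunctor (I ⋙ L)]
    (hL : PreservesQuotients I L) {P Q₁ Q₂ Q₀ : X} {a : P ⟶ Q₁} {b : P ⟶ Q₂} {f : Q₁ ⟶ Q₀}
    {g : Q₂ ⟶ Q₀} (sq : IsPullback a b f g) {T : D} (x : T ⟶ L.obj Q₁) (y : T ⟶ L.obj Q₂)
    (hxy : x ≫ L.map f = y ≫ L.map g) : ∃ (S : D) (e : S ⟶ T) (z : S ⟶ L.obj P),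
      IsRegularEpi e ∧ z ≫ L.map a = e ≫ x ∧ z ≫ L.map b = e ≫ y := by
  have : Regular X := hI.exact.toRegular
  have := hI.regular
  obtain ⟨c₀, p₀, hp₀⟩ := hI.covers Q₀
  obtain ⟨R, r₁, r₂, hR⟩ := hI.exists_isPullback p₀ p₀
  -- Generators of `Q` are refined until `h` lifts to the chosen generator of `Q₀`.
  have lift : ∀ {Q : X} (h : Q ⟶ Q₀), ∃ (w : C) (q : I.obj w ⟶ Q) (v : w ⟶ c₀), IsRegularEpi q ∧
      q ≫ h = I.map v ≫ p₀ := fun {Q} h => by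
    obtain ⟨c, p, hp⟩ := hI.covers Q
    obtain ⟨w, s, t, hs, sq'⟩ := hI.exists_isPullback_regularEpi (p ≫ h) p₀ hp₀
    exact ⟨w, I.map s ≫ p, t, isRegularEpi_comp _ _ (IsRegularFunctor.map_regularEpi s hs) hp,
      by rw [Category.assoc, sq'.w]⟩
  obtain ⟨w₁, q₁, v₁, hq₁, e₁⟩ := lift f
  obtain ⟨w₂, q₂, v₂, hq₂, e₂⟩ := lift g
  have regL : ∀ {Q : X} {c : C} (p : I.obj c ⟶ Q), IsRegularEpi p → IsRegularEpi (L.map p) := by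
    intro Q c p hp
    obtain ⟨R, r₁, r₂, hR⟩ := hI.exists_isPullback p p
    exact (hL p r₁ r₂ hp hR).1
  have hLq₁ := regL q₁ hq₁
  have hLq₂ := regL q₂ hq₂
  obtain ⟨S₁, s₁, x', hs₁, hx'⟩ := exists_pullback_cover (L.map q₁) hLq₁ x
  obtain ⟨S, s₂, y', hs₂, hy'⟩ := exists_pullback_cover (L.map q₂) hLq₂ (s₁ ≫ y)
  have hk := (hL p₀ r₁ r₂ hp₀ hR).2
  have hr : (s₂ ≫ x' ≫ L.map (I.map v₁)) ≫ L.map p₀ = (y' ≫ L.map (I.map v₂)) ≫ L.map p₀ := by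
    have h1 := congrArg (fun w => s₂ ≫ s₁ ≫ w) hxy
    simp only [Category.assoc, ← L.map_comp, ← e₁, ← e₂] at h1 ⊢
    rw [L.map_comp, L.map_comp, ← reassoc_of% hx', h1, ← reassoc_of% hy']
  obtain ⟨r, hr₁, hr₂⟩ : ∃ r, r ≫ L.map (I.map r₁) = s₂ ≫ x' ≫ L.map (I.map v₁) ∧
      r ≫ L.map (I.map r₂) = y' ≫ L.map (I.map v₂) :=
    ⟨hk.lift _ _ hr, hk.lift_fst _ _ hr, hk.lift_snd _ _ hr⟩
  obtain ⟨w₃, i₁, i₂, m₁, e₃, h₁, h₂⟩ := exists_lift_map_map (I := I) v₁ r₁ (s₂ ≫ x') r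
    (by rw [hr₁, Category.assoc])
  obtain ⟨w₄, j₁, j₂, m, e₄, h₃, h₄⟩ := exists_lift_map_map (I := I) (i₂ ≫ r₂) v₂ m₁ y'
    (by rw [I.map_comp, L.map_comp, reassoc_of% h₂, hr₂])
  obtain ⟨k, hk₁, hk₂⟩ : ∃ k : I.obj w₄ ⟶ P, k ≫ a = I.map (j₁ ≫ i₁) ≫ q₁ ∧
      k ≫ b = I.map j₂ ≫ q₂ := by
    have w : (I.map (j₁ ≫ i₁) ≫ q₁) ≫ f = (I.map j₂ ≫ q₂) ≫ g := by
      rw [Category.assoc, Category.assoc, e₁, e₂, ← I.map_comp_assoc, ← I.map_comp_assoc,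
        ← e₄, Category.assoc, e₃, I.map_comp_assoc, I.map_comp_assoc, I.map_comp_assoc,
        I.map_comp_assoc, hR.w]
    exact ⟨sq.lift _ _ w, sq.lift_fst _ _ _, sq.lift_snd _ _ _⟩
  refine ⟨S, s₂ ≫ s₁, m ≫ L.map k, isRegularEpi_comp _ _ hs₂ hs₁, ?_, ?_⟩
  · rw [Category.assoc, ← L.map_comp, hk₁, L.map_comp, I.map_comp, L.map_comp, Category.assoc,
      reassoc_of% h₃, reassoc_of% h₁, ← hx', Category.assoc]
  · rw [Category.assoc, ← L.map_comp, hk₂, L.map_comp, reassoc_of% h₄, ← hy', Category.assoc]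

/-- Elements with the same two images lift locally to a pair of generators that lies in the kernel
pairs of both `p ≫ a` and `p ≫ b`. The intersection of these relations is formed in `C`, and `p`
identifies its two projections because `a` and `b` are jointly monic. -/
theorem jointlyMono_of_preservesQuotients {L : X ⥤ D} [IsRegularFunctor (I ⋙ L)]
    (hL : PreservesQuotients I L) {P Q₁ Q₂ : X} {a : P ⟶ Q₁} {b : P ⟶ Q₂}
    (h : JointlyMono₂ a b) : JointlyMono₂ (L.map a) (L.map b) where
  right_cancellation T x y ha hb := by
    have : Regular X := hI.exact.toRegular
    obtain ⟨c, p, hp⟩ := hI.covers P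
    obtain ⟨n₁, a₁, b₁, sq₁⟩ := hI.exists_isPullback (p ≫ a) (p ≫ a)
    obtain ⟨n₂, a₂, b₂, sq₂⟩ := hI.exists_isPullback (p ≫ b) (p ≫ b)
    obtain ⟨R, r₁, r₂, hR⟩ := hI.exists_isPullback p p
    have hLp := (hL p r₁ r₂ hp hR).1
    obtain ⟨S₁, s₁, x', hs₁, hx'⟩ := exists_pullback_cover (L.map p) hLp x
    obtain ⟨S₂, s₂, y', hs₂, hy'⟩ := exists_pullback_cover (L.map p) hLp (s₁ ≫ y)
    obtain ⟨S₃, s₃, z₁, hs₃, h₁, h₁'⟩ := hI.exists_lift_of_isPullback hL sq₁ (s₂ ≫ x') y' (by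
      rw [L.map_comp, Category.assoc, ← reassoc_of% hx', ← reassoc_of% hy', ha])
    obtain ⟨S₄, s₄, z₂, hs₄, h₂, h₂'⟩ := hI.exists_lift_of_isPullback hL sq₂ (s₃ ≫ s₂ ≫ x')
      (s₃ ≫ y') (by
        rw [L.map_comp, Category.assoc, Category.assoc, ← reassoc_of% hx', Category.assoc,
          ← reassoc_of% hy', hb])
    obtain ⟨w, i, j, z, e₁, e₂, h₃, -⟩ := exists_lift_map_map₂ (I := I) a₁ b₁ a₂ b₂ (s₄ ≫ z₁) z₂
      (by rw [Category.assoc, h₁, h₂]) (by rw [Category.assoc, h₁', h₂'])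
    have hab : I.map (i ≫ a₁) ≫ p = I.map (i ≫ b₁) ≫ p := by
      refine h.right_cancellation _ _ ?_ ?_
      · rw [I.map_comp, I.map_comp, Category.assoc, Category.assoc, Category.assoc, Category.assoc,
          sq₁.w]
      · rw [e₁, e₂, I.map_comp, I.map_comp, Category.assoc, Category.assoc, Category.assoc,
          Category.assoc, sq₂.w]
    have h₄ := congrArg (fun w => z ≫ L.map w) hab
    simp only [L.map_comp, I.map_comp, Category.assoc, reassoc_of% h₃, reassoc_of% h₁,
      reassoc_of% h₁', ← hx', ← hy'] at h₄
    rw [← cancel_epi s₁, ← cancel_epi s₂, ← cancel_epi s₃, ← cancel_epi s₄]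
    exact h₄

/-- The comparison map from `L` of a pullback to the pullback in `D` is monic by joint monicity and
a regular epimorphism by the existence of local lifts. -/
theorem isRegularFunctor_of_preservesQuotients {L : X ⥤ D} [IsRegularFunctor (I ⋙ L)]
    (hL : PreservesQuotients I L) : IsRegularFunctor L := by
  have : Regular X := hI.exact.toRegular
  have := hI.regular
  have regL : ∀ {Q : X} {c : C} (p : I.obj c ⟶ Q), IsRegularEpi p → IsRegularEpi (L.map p) := by
    intro Q c p hp
    obtain ⟨R, r₁, r₂, hR⟩ := hI.exists_isPullback p p
    exact (hL p r₁ r₂ hp hR).1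
  have h1 : PreservesLimit (Functor.empty.{0} X) L :=
    preservesTerminal_of_iso L (L.mapIso (PreservesTerminal.iso I).symm ≪≫
      PreservesTerminal.iso (I ⋙ L))
  have h1' : PreservesLimitsOfShape (Discrete PEmpty.{1}) L :=
    preservesLimitsOfShape_pempty_of_preservesTerminal L
  have h2 : PreservesLimitsOfShape WalkingCospan L := by
    refine preservesLimitsOfShape_walkingCospan_of_forall_isPullback fun {Q₁ Q₂ Q₀} f g _ => ?_
    have sq := IsPullback.of_hasPullback f g
    have w : L.map (pullback.fst f g) ≫ L.map f = L.map (pullback.snd f g) ≫ L.map g := by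
      rw [← L.map_comp, ← L.map_comp, pullback.condition]
    let k := pullback.lift _ _ w
    have k1 : k ≫ pullback.fst _ _ = L.map (pullback.fst f g) := pullback.lift_fst _ _ _
    have k2 : k ≫ pullback.snd _ _ = L.map (pullback.snd f g) := pullback.lift_snd _ _ _
    have hj := hI.jointlyMono_of_preservesQuotients hL (jointlyMono_of_isPullback sq)
    have : Mono k := ⟨fun x y e => hj.right_cancellation x y
      (by rw [← k1, reassoc_of% e]) (by rw [← k2, reassoc_of% e])⟩
    obtain ⟨S, e, z, he, hz₁, hz₂⟩ := hI.exists_lift_of_isPullback hL sq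
      (pullback.fst (L.map f) (L.map g)) (pullback.snd (L.map f) (L.map g)) pullback.condition
    have hzk : z ≫ k = e := by
      ext
      · rw [Category.assoc, k1, hz₁]
      · rw [Category.assoc, k2, hz₂]
    have := isIso_of_isRegularEpi_of_mono k (isRegularEpi_of_comp z k (by rwa [hzk]))
    exact ⟨_, _, _, sq, IsPullback.of_iso_pullback ⟨w⟩ (asIso k) k1 k2⟩
  exact {
    preservesFiniteLimits := preservesFiniteLimits_of_preservesTerminal_and_pullbacks L
    map_regularEpi := fun {Q Q'} f hf => by
      obtain ⟨c, p, hp⟩ := hI.covers Q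
      have h3 := regL _ (isRegularEpi_comp p f hp hf)
      rw [L.map_comp] at h3
      exact isRegularEpi_of_comp _ _ h3 }

end IsGenerating

/-- Exactness of `D` makes the image under `K` of the kernel pair of a presentation effective. Its
quotient is the value of the Kan extension, which therefore preserves presented quotients and their
kernel pairs. -/
theorem IsGenerating.exists_extension {I : C ⥤ X} (hI : IsGenerating I) [BarrExact D] (K : C ⥤ D)
    [IsRegularFunctor K] : ∃ L : X ⥤ D, IsRegularFunctor L ∧ Nonempty (I ⋙ L ≅ K) := by
  have : Regular D := BarrExact.toRegular
  have := hI.full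
  have := hI.faithful
  have key : ∀ {Q : X} {c R : C} (p : I.obj c ⟶ Q) (r₁ r₂ : R ⟶ c), IsRegularEpi p →
      IsKernelPair p (I.map r₁) (I.map r₂) →
      ∃ (s : Cocone (CostructuredArrow.proj I Q ⋙ K)) (_ : IsColimit s) (e : K.obj c ⟶ s.pt),
        e = s.ι.app (CostructuredArrow.mk p) ∧
        IsRegularEpi e ∧ IsKernelPair e (K.map r₁) (K.map r₂) := by
    intro Q c R p r₁ r₂ hp h
    have := hI.isEquivalenceRelation_of_isKernelPair h
    have := isEquivalenceRelation_map K r₁ r₂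
    obtain ⟨⟨ε⟩⟩ := BarrExact.effective (K.map r₁) (K.map r₂)
    obtain ⟨φ, hφ, hφp, hu⟩ := hI.exists_universal_family K hp h ε.π ε.isPushout.w
      ε.isCoequalizer
    have aux : ∀ (s : Cocone (CostructuredArrow.proj I Q ⋙ K)) (d d' : C) (f : d ⟶ d')
        (g : I.obj d' ⟶ Q), K.map f ≫ s.ι.app (CostructuredArrow.mk g) =
          s.ι.app (CostructuredArrow.mk (I.map f ≫ g)) := fun s d d' f g =>
      s.w (CostructuredArrow.homMk f : CostructuredArrow.mk (I.map f ≫ g) ⟶ CostructuredArrow.mk g)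
    choose m hm hm' using fun s : Cocone (CostructuredArrow.proj I Q ⋙ K) =>
      hu (fun d g => s.ι.app (CostructuredArrow.mk g)) (aux s)
    refine ⟨{ pt := ε.B, ι := { app := fun g => φ _ g.hom, naturality := fun g g' f => ?_ } },
      { desc := m
        fac := fun s g => hm s _ g.hom
        uniq := fun s k hk => hm' s k ?_ }, ε.π, hφp.symm, inferInstance, ε.isKernelPair⟩
    · refine (hφ _ _ f.left g'.hom).trans ?_
      rw [CostructuredArrow.w]
      exact (Category.comp_id _).symm
    · refine Eq.trans ?_ (hk (CostructuredArrow.mk p))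
      exact congrArg (· ≫ k) hφp.symm
  have : I.HasPointwiseLeftKanExtension K := fun Q => by
    obtain ⟨c, p, hp⟩ := hI.covers Q
    obtain ⟨R, r₁, r₂, h⟩ := hI.exists_isPullback p p
    obtain ⟨s, hs, -⟩ := key p r₁ r₂ hp h
    exact ⟨s, hs⟩
  obtain ⟨L, α, ⟨hpt⟩⟩ : ∃ (L : X ⥤ D) (α : K ⟶ I ⋙ L),
      Nonempty (Functor.LeftExtension.mk L α).IsPointwiseLeftKanExtension :=
    ⟨_, _, ⟨I.pointwiseLeftKanExtensionIsPointwiseLeftKanExtension K⟩⟩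
  -- The unit of a pointwise Kan extension along a fully faithful functor is invertible.
  have hα : IsIso α := hpt.isIso_hom
  have : IsRegularFunctor (I ⋙ L) := isRegularFunctor_of_iso (asIso α)
  refine ⟨L, hI.isRegularFunctor_of_preservesQuotients (fun {Q c R} p r₁ r₂ hp h => ?_),
    ⟨(asIso α).symm⟩⟩
  obtain ⟨s, hs, e, he, hreg, hk⟩ := key p r₁ r₂ hp h
  let θ : s.pt ≅ L.obj Q := hs.coconePointUniqueUpToIso (hpt Q)
  have hθ : e ≫ θ.hom = α.app c ≫ L.map p := by
    rw [he]
    exact (hs.comp_coconePointUniqueUpToIso_hom (hpt Q) (CostructuredArrow.mk p)).trans (by simp; rfl)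
  have hθ' : L.map p = inv (α.app c) ≫ e ≫ θ.hom := by
    rw [hθ]
    exact (IsIso.inv_hom_id_assoc (α.app c) (L.map p)).symm
  constructor
  · rw [hθ']
    exact (MorphismProperty.cancel_left_of_respectsIso (MorphismProperty.regularEpi D) _ _).2
      ((MorphismProperty.cancel_right_of_respectsIso (MorphismProperty.regularEpi D) e θ.hom).2
        hreg)
  · exact IsPullback.of_iso hk (asIso (α.app R)) (asIso (α.app c)) (asIso (α.app c)) θ
      (α.naturality r₁) (α.naturality r₂) hθ hθ

theorem IsGenerating.isExactCompletion {I : C ⥤ X} (hI : IsGenerating I) :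
    IsExactCompletion.{u, v, u₁, v₁, u₂, v₂} I where
  exact := hI.exact
  regular := hI.regular
  exists_extension _ := hI.exists_extension
  bijective_whiskerLeft D _ _ L L' _ _ := by
    have : Regular D := BarrExact.toRegular
    exact hI.bijective_whiskerLeft L L'

end Extension

/-! ### The embedding of a regular category in its topos of sheaves -/

section RegularSheaves

variable (C : Type max u v) [Category.{v} C]

/-- Categories of presheaves are cartesian closed. -/
noncomputable abbrev presheafMonoidalClosed : MonoidalClosed (Cᵒᵖ ⥤ Type max u v) :=
  FunctorToTypes.monoidalClosed.{max u v, v, max u v}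

attribute [local instance] presheafMonoidalClosed

variable [Regular C]

/-- The category of sheaves on a regular category is exact, because it is a topos. -/
theorem barrExact_sheaf : BarrExact (Sheaf (regularTopology C) (Type max u v)) :=
  let h : MonoidalClosed (Sheaf (regularTopology C) (Type max u v)) := inferInstance
  @barrExact_of_topos _ _ _ _ h _

/-- The Yoneda embedding of a regular category in the category of sheaves on it. -/
noncomputable abbrev sheafYoneda : C ⥤ Sheaf (regularTopology C) (Type max u v) :=
  GrothendieckTopology.uliftYoneda.{max u v} (regularTopology C)

variable {C}

/-- Epimorphisms of sheaves are locally surjective, so the identity section of the representable at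
`a` lifts on a covering sieve; in the regular topology such a sieve contains a single effective
epimorphism. -/
theorem exists_lift_sheafYoneda {F : Sheaf (regularTopology C) (Type max u v)} {a : C}
    (e : F ⟶ (sheafYoneda.{u, v} C).obj a) (he : IsRegularEpi e) :
    ∃ (a' : C) (s : a' ⟶ a) (t : (sheafYoneda.{u, v} C).obj a' ⟶ F),
      IsRegularEpi s ∧ t ≫ e = (sheafYoneda.{u, v} C).map s := by
  have : Epi e := inferInstance
  rw [← Sheaf.isLocallySurjective_iff_epi] at this
  have h := Presheaf.imageSieve_mem (regularTopology C) e.hom (U := .op a) ⟨𝟙 a⟩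
  rw [regularTopology.mem_sieves_iff_hasEffectiveEpi] at h
  obtain ⟨a', s, hs, t, ht⟩ := h
  refine ⟨a', s, ⟨uliftYonedaEquiv.{max u v}.symm t⟩, inferInstance, ?_⟩
  refine ObjectProperty.hom_ext _ ((uliftYonedaEquiv_symm_comp t e.hom).trans ?_)
  refine uliftYonedaEquiv.{max u v}.symm_apply_eq.2 (ht.trans ?_)
  exact (congrArg ULift.up (Category.comp_id s)).trans
    (uliftYonedaEquiv_uliftYoneda_map.{max u v} s).symm

/-- A section `s` of the representable at `Y` lifts to `X` over the pullback of `f` along `s`, which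
covers. Epimorphisms of sheaves are regular. -/
theorem isRegularFunctor_sheafYoneda : IsRegularFunctor (sheafYoneda.{u, v} C) where
  preservesFiniteLimits := ⟨fun J _ _ => inferInstance⟩
  map_regularEpi {X Y} f hf := by
    have := (barrExact_sheaf C).toRegular
    have : Sheaf.IsLocallySurjective ((sheafYoneda.{u, v} C).map f) := by
      refine ⟨fun {U} s => ?_⟩
      apply regularTopology.mem_sieves_of_hasEffectiveEpi
      refine ⟨pullback s.down f, pullback.fst _ _, inferInstance, ⟨pullback.snd _ _⟩, ?_⟩
      exact congrArg ULift.up pullback.condition.symm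
    have : Epi ((sheafYoneda.{u, v} C).map f) := inferInstance
    have : IsRegularEpiCategory (Sheaf (regularTopology C) (Type max u v)) := inferInstance
    exact IsRegularEpiCategory.regularEpiOfEpi _

end RegularSheaves

/-! ### Exactness of full subcategories -/

section FullSubcategory

variable {X : Type u} [Category.{v} X] {S : Type u₁} [Category.{v₁} S] [BarrExact S] (ι : X ⥤ S)
  [ι.Full] [ι.Faithful]

/-- A full subcategory of an exact category that is closed under finite limits, images and quotients
of equivalence relations is exact. -/
theorem barrExact_of_fullyFaithful (hterm : ∃ x, Nonempty (IsTerminal (ι.obj x)))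
    (hpb : ∀ {x y z : X} (f : x ⟶ z) (g : y ⟶ z), ∃ (w : X) (a : w ⟶ x) (b : w ⟶ y),
      IsPullback (ι.map a) (ι.map b) (ι.map f) (ι.map g))
    (him : ∀ {x y : X} (f : x ⟶ y), ∃ (w : X) (e : x ⟶ w) (m : w ⟶ y), IsRegularEpi (ι.map e) ∧
      Mono (ι.map m) ∧ e ≫ m = f)
    (hq : ∀ {r x : X} (r₁ r₂ : r ⟶ x), IsEquivalenceRelation (ι.map r₁) (ι.map r₂) →
      ∃ (y : X) (q : x ⟶ y), IsRegularEpi (ι.map q) ∧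
        IsKernelPair (ι.map q) (ι.map r₁) (ι.map r₂)) :
    BarrExact X ∧ IsRegularFunctor ι ∧ ∀ {x y : X} (f : x ⟶ y), IsRegularEpi (ι.map f) →
      IsRegularEpi f := by
  obtain ⟨t, ⟨ht⟩⟩ := hterm
  have ht' : IsTerminal t := IsTerminal.isTerminalOfObj ι t ht
  have h1 : HasTerminal X := ht'.hasTerminal
  have h2 : HasPullbacks X := by
    have (x y z : X) (f : x ⟶ z) (g : y ⟶ z) : HasLimit (cospan f g) := by
      obtain ⟨w, a, b, h⟩ := hpb f g
      exact (IsPullback.of_map ι (ι.map_injective (by simpa using h.w)) h).hasPullback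
    exact hasPullbacks_of_hasLimit_cospan X
  have h3 : HasFiniteLimits X := hasFiniteLimits_of_hasTerminal_and_pullbacks
  have h4 : PreservesLimit (Functor.empty.{0} X) ι :=
    preservesTerminal_of_iso ι (ht'.conePointUniqueUpToIso terminalIsTerminal |>.symm
      |> ι.mapIso |>.trans (ht.uniqueUpToIso terminalIsTerminal))
  have h5 : PreservesLimitsOfShape (Discrete PEmpty.{1}) ι :=
    preservesLimitsOfShape_pempty_of_preservesTerminal ι
  have h6 : PreservesLimitsOfShape WalkingCospan ι := by
    refine preservesLimitsOfShape_walkingCospan_of_forall_isPullback fun {x y z} f g _ => ?_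
    obtain ⟨w, a, b, h⟩ := hpb f g
    exact ⟨_, _, _, IsPullback.of_map ι (ι.map_injective (by simpa using h.w)) h, h⟩
  have h7 : PreservesFiniteLimits ι := preservesFiniteLimits_of_preservesTerminal_and_pullbacks ι
  -- The covers are the maps that become regular epimorphisms in `S`; the criterion shows that they
  -- are the regular epimorphisms of `X`.
  let W : MorphismProperty X := (MorphismProperty.regularEpi S).inverseImage ι
  have hW : W.IsStableUnderBaseChange := ⟨fun {_ _ _ _ _ _ _ _} sq h =>
    isRegularEpi_of_isPullback (sq.map ι).flip h⟩
  have c1 : ∀ {x y z : X} (f : x ⟶ y) (g : y ⟶ z), W (f ≫ g) → W g := fun f g h => by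
    have h : IsRegularEpi (ι.map (f ≫ g)) := h
    rw [ι.map_comp] at h
    exact isRegularEpi_of_comp _ _ h
  have c2 : ∀ {x y : X} (f : x ⟶ y), W f → Mono f → IsIso f := fun f h _ => by
    have := isIso_of_isRegularEpi_of_mono (ι.map f) h
    exact isIso_of_reflects_iso f ι
  have c3 : ∀ {x y : X} (f : x ⟶ y), ∃ (w : X) (e : x ⟶ w) (m : w ⟶ y), W e ∧ Mono m ∧
      e ≫ m = f := fun f => by
    obtain ⟨w, e, m, he, hm, h⟩ := him f
    exact ⟨w, e, m, he, ι.mono_of_mono_map hm, h⟩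
  have hreg : Regular X := regular_of_cover (W := W) c1 c2 c3
  refine ⟨{ toRegular := hreg, effective := fun {r x} r₁ r₂ h => ?_ },
    ⟨h7, fun f hf => cover_of_isRegularEpi (W := W) c3 f hf⟩,
    fun f hf => isRegularEpi_of_cover (W := W) c1 c2 c3 f hf⟩
  obtain ⟨y, q, hq, hk⟩ := hq r₁ r₂ (isEquivalenceRelation_map ι r₁ r₂)
  exact isEffective_of_isKernelPair r₁ r₂ q (isRegularEpi_of_cover (W := W) c1 c2 c3 q hq)
    (IsPullback.of_map ι (ι.map_injective (by simpa using hk.w)) hk)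

end FullSubcategory

/-! ### Closure properties of the presented quotients -/

section Quotients

variable {C : Type u} [Category.{v} C] [Regular C] {S : Type u₁} [Category.{v₁} S] [BarrExact S]

/-- In a regular category, a square with jointly monic projections is a pullback as soon as lifts
exist locally. -/
theorem isPullback_of_exists_cover {P A B Q : S} {s : P ⟶ A} {t : P ⟶ B} {f : A ⟶ Q} {g : B ⟶ Q}
    (w : s ≫ f = t ≫ g) (hst : JointlyMono₂ s t)
    (h : ∀ {T : S} (x : T ⟶ A) (y : T ⟶ B), x ≫ f = y ≫ g → ∃ (T' : S) (e : T' ⟶ T) (z : T' ⟶ P),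
      IsRegularEpi e ∧ z ≫ s = e ≫ x ∧ z ≫ t = e ≫ y) : IsPullback s t f g := by
  have h' : ∀ {T : S} (x : T ⟶ A) (y : T ⟶ B), x ≫ f = y ≫ g →
      ∃ z : T ⟶ P, z ≫ s = x ∧ z ≫ t = y := fun {T} x y e => by
    obtain ⟨T', p, z, hp, h1, h2⟩ := h x y e
    -- By joint monicity the local lift respects the kernel pair of `p`, so it descends to `T`.
    obtain ⟨l, hl⟩ : ∃ l : T ⟶ P, p ≫ l = z := by
      refine ⟨IsRegularEpi.desc p z (hst.right_cancellation _ _ ?_ ?_), IsRegularEpi.fac _ _ _⟩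
      · rw [Category.assoc, h1, Category.assoc, h1, reassoc_of% IsRegularEpi.w p]
      · rw [Category.assoc, h2, Category.assoc, h2, reassoc_of% IsRegularEpi.w p]
    refine ⟨l, ?_, ?_⟩
    · rw [← cancel_epi p, reassoc_of% hl, h1]
    · rw [← cancel_epi p, reassoc_of% hl, h2]
  exact ⟨⟨w⟩, ⟨PullbackCone.IsLimit.mk w (fun c => (h' c.fst c.snd c.condition).choose)
    (fun c => (h' c.fst c.snd c.condition).choose_spec.1)
    (fun c => (h' c.fst c.snd c.condition).choose_spec.2)
    (fun c m h1 h2 => hst.right_cancellation _ _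
      (h1.trans (h' c.fst c.snd c.condition).choose_spec.1.symm)
      (h2.trans (h' c.fst c.snd c.condition).choose_spec.2.symm))⟩⟩

variable (I : C ⥤ S) [IsRegularFunctor I]

/-- The object `Q` is a quotient of an object in the image of `I` by an equivalence relation in the
image of `I`. -/
def IsQuotient (Q : S) : Prop :=
  ∃ (c R : C) (p : I.obj c ⟶ Q) (r₁ r₂ : R ⟶ c), IsRegularEpi p ∧
    IsKernelPair p (I.map r₁) (I.map r₂)

variable {I}

/-- A span from `C` that has local lifts becomes a pullback once it is replaced by its image in the
product, and `I` preserves this image. -/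
theorem exists_isPullback_of_cover {Q : S} {a b d : C} {f : I.obj a ⟶ Q} {g : I.obj b ⟶ Q}
    (s : d ⟶ a) (t : d ⟶ b) (w : I.map s ≫ f = I.map t ≫ g)
    (h : ∀ {T : S} (x : T ⟶ I.obj a) (y : T ⟶ I.obj b), x ≫ f = y ≫ g →
      ∃ (T' : S) (e : T' ⟶ T) (z : T' ⟶ I.obj d), IsRegularEpi e ∧ z ≫ I.map s = e ≫ x ∧
        z ≫ I.map t = e ≫ y) :
    ∃ (w : C) (s : w ⟶ a) (t : w ⟶ b), IsPullback (I.map s) (I.map t) f g := by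
  obtain ⟨R, e, m, he, hm, hem⟩ := exists_image (prod.lift s t)
  have hs : e ≫ m ≫ prod.fst = s := by rw [reassoc_of% hem, prod.lift_fst]
  have ht : e ≫ m ≫ prod.snd = t := by rw [reassoc_of% hem, prod.lift_snd]
  have hIe : IsRegularEpi (I.map e) := IsRegularFunctor.map_regularEpi e he
  refine ⟨R, m ≫ prod.fst, m ≫ prod.snd, isPullback_of_exists_cover ?_
    (jointlyMono_map ⟨fun _ x y h1 h2 => ?_⟩) fun {T} x y hxy => ?_⟩
  · rw [← cancel_epi (I.map e), ← I.map_comp_assoc, ← I.map_comp_assoc, hs, ht, w]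
  · rw [← cancel_mono m]
    ext
    · simpa using h1
    · simpa using h2
  · obtain ⟨T', p, z, hp, h1, h2⟩ := h x y hxy
    exact ⟨T', p, z ≫ I.map e, hp, by rw [Category.assoc, ← I.map_comp, hs, h1],
      by rw [Category.assoc, ← I.map_comp, ht, h2]⟩

theorem exists_lift_map {c d e : C} (f : c ⟶ e) (g : d ⟶ e) {T : S} (x : T ⟶ I.obj c)
    (y : T ⟶ I.obj d) (h : x ≫ I.map f = y ≫ I.map g) :
    ∃ z : T ⟶ I.obj (pullback f g), z ≫ I.map (pullback.fst f g) = x ∧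
      z ≫ I.map (pullback.snd f g) = y := by
  have sq := (IsPullback.of_hasPullback f g).map I
  exact ⟨sq.lift x y h, sq.lift_fst _ _ _, sq.lift_snd _ _ _⟩

/-- Every regular epimorphism onto an object `I a` splits locally, over the image of a regular
epimorphism onto `a`. -/
def LiftsLocally (I : C ⥤ S) : Prop :=
  ∀ {F : S} {a : C} (e : F ⟶ I.obj a), IsRegularEpi e →
    ∃ (a' : C) (s : a' ⟶ a) (t : I.obj a' ⟶ F), IsRegularEpi s ∧ t ≫ e = I.map s

theorem isQuotient_obj (c : C) : IsQuotient I (I.obj c) :=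
  ⟨c, c, 𝟙 _, 𝟙 c, 𝟙 c, inferInstance, by
    rw [I.map_id]
    exact IsKernelPair.id_of_mono _⟩

variable [I.Full] [I.Faithful] (hI : LiftsLocally I)
include hI

/-- On covers of `a` and `b` coming from `C`, the maps `f` and `g` lift along `p` to `c`. The pairs
whose lifts are related by `R` form an object of `C`, which covers the pullback. -/
theorem IsQuotient.exists_isPullback {Q : S} (hQ : IsQuotient I Q) {a b : C} (f : I.obj a ⟶ Q)
    (g : I.obj b ⟶ Q) : ∃ (w : C) (s : w ⟶ a) (t : w ⟶ b),
      IsPullback (I.map s) (I.map t) f g := by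
  obtain ⟨c, R, p, r₁, r₂, hp, hk⟩ := hQ
  have lift : ∀ {a : C} (f : I.obj a ⟶ Q), ∃ (a' : C) (s : a' ⟶ a) (u : a' ⟶ c), IsRegularEpi s ∧
      I.map s ≫ f = I.map u ≫ p := fun {a} f => by
    obtain ⟨F, e, k, he, hk⟩ := exists_pullback_cover p hp f
    obtain ⟨a', s, t, hs, hst⟩ := hI e he
    exact ⟨a', s, I.preimage (t ≫ k), hs, by
      rw [I.map_preimage, Category.assoc, ← hk, reassoc_of% hst]⟩
  obtain ⟨a', s₁, u₁, hs₁, e₁⟩ := lift f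
  obtain ⟨b', s₂, u₂, hs₂, e₂⟩ := lift g
  refine exists_isPullback_of_cover (pullback.fst (pullback.snd u₁ r₁ ≫ r₂) u₂ ≫ pullback.fst _ _ ≫
    s₁) (pullback.snd _ _ ≫ s₂) ?_ fun {T} x y hxy => ?_
  · have c₁ := congrArg I.map (pullback.condition (f := u₁) (g := r₁))
    have c₂ := congrArg I.map (pullback.condition (f := pullback.snd u₁ r₁ ≫ r₂) (g := u₂))
    simp only [I.map_comp] at c₁ c₂
    rw [I.map_comp_assoc, I.map_comp_assoc, I.map_comp_assoc, e₁, e₂, reassoc_of% c₁,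
      ← reassoc_of% c₂, hk.w]
  · obtain ⟨T₁, q₁, x', hq₁, hx⟩ := exists_pullback_cover (I.map s₁)
      (IsRegularFunctor.map_regularEpi s₁ hs₁) x
    obtain ⟨T₂, q₂, y', hq₂, hy⟩ := exists_pullback_cover (I.map s₂)
      (IsRegularFunctor.map_regularEpi s₂ hs₂) (q₁ ≫ y)
    have hw : ((q₂ ≫ x') ≫ I.map u₁) ≫ p = (y' ≫ I.map u₂) ≫ p := by
      rw [Category.assoc, Category.assoc, Category.assoc, ← e₁, ← e₂, ← reassoc_of% hx,
        ← reassoc_of% hy, hxy]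
    obtain ⟨r, hr₁, hr₂⟩ : ∃ r, r ≫ I.map r₁ = (q₂ ≫ x') ≫ I.map u₁ ∧
      r ≫ I.map r₂ = y' ≫ I.map u₂ := ⟨hk.lift _ _ hw, hk.lift_fst _ _ hw, hk.lift_snd _ _ hw⟩
    obtain ⟨m₁, h₁, h₂⟩ := exists_lift_map u₁ r₁ (q₂ ≫ x') r hr₁.symm
    obtain ⟨m, h₃, h₄⟩ := exists_lift_map (pullback.snd u₁ r₁ ≫ r₂) u₂ m₁ y'
      (by rw [I.map_comp, reassoc_of% h₂, hr₂])
    refine ⟨T₂, q₂ ≫ q₁, m, isRegularEpi_comp _ _ hq₂ hq₁, ?_, ?_⟩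
    · rw [I.map_comp, I.map_comp, reassoc_of% h₃, reassoc_of% h₁, ← hx, Category.assoc]
    · rw [I.map_comp, reassoc_of% h₄, ← hy, Category.assoc]

/-- The kernel pairs of `e` and `e ≫ m` agree, and the latter is a pullback over the presented
quotient `Q`. -/
theorem IsQuotient.of_mono {Q U : S} (hQ : IsQuotient I Q) (m : U ⟶ Q) [Mono m] {d : C}
    (e : I.obj d ⟶ U) (he : IsRegularEpi e) : IsQuotient I U := by
  obtain ⟨R, r₁, r₂, h⟩ := hQ.exists_isPullback hI (e ≫ m) (e ≫ m)
  exact ⟨d, R, e, r₁, r₂, he, ⟨by rw [← cancel_mono m, Category.assoc, Category.assoc, h.w]⟩,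
    ⟨PullbackCone.isLimitOfFactors (e ≫ m) (e ≫ m)
    m e e rfl rfl _ h.isLimit⟩⟩

theorem IsQuotient.image {Q Q' U : S} (hQ : IsQuotient I Q) (hQ' : IsQuotient I Q') (e : Q ⟶ U)
    (m : U ⟶ Q') [Mono m] (he : IsRegularEpi e) : IsQuotient I U := by
  obtain ⟨c, -, p, -, -, hp, -⟩ := hQ
  exact hQ'.of_mono hI m (p ≫ e) (isRegularEpi_comp _ _ hp he)

/-- The pullback of the generators covers `P`. The kernel pair of this cover is the intersection of
the kernel pairs of its composites with `a` and `b`, both of which come from `C`. -/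
theorem IsQuotient.pullback {P Q₁ Q₂ Q : S} (h₁ : IsQuotient I Q₁) (h₂ : IsQuotient I Q₂)
    (h : IsQuotient I Q) {a : P ⟶ Q₁} {b : P ⟶ Q₂} {f : Q₁ ⟶ Q} {g : Q₂ ⟶ Q}
    (sq : IsPullback a b f g) : IsQuotient I P := by
  obtain ⟨c₁, -, p₁, -, -, hp₁, -⟩ := id h₁
  obtain ⟨c₂, -, p₂, -, -, hp₂, -⟩ := id h₂
  obtain ⟨w, s, t, sq'⟩ := h.exists_isPullback hI (p₁ ≫ f) (p₂ ≫ g)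
  have e : (I.map s ≫ p₁) ≫ f = (I.map t ≫ p₂) ≫ g := by simpa using sq'.w
  obtain ⟨p, hpa, hpb⟩ : ∃ p : I.obj w ⟶ P, p ≫ a = I.map s ≫ p₁ ∧ p ≫ b = I.map t ≫ p₂ :=
    ⟨sq.lift _ _ e, sq.lift_fst _ _ _, sq.lift_snd _ _ _⟩
  have hp : IsRegularEpi p := by
    obtain ⟨T₁, q₁, x, hq₁, hx⟩ := exists_pullback_cover p₁ hp₁ a
    obtain ⟨T₂, q₂, y, hq₂, hy⟩ := exists_pullback_cover p₂ hp₂ (q₁ ≫ b)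
    have hw : (q₂ ≫ x) ≫ p₁ ≫ f = y ≫ p₂ ≫ g := by
      rw [Category.assoc, ← reassoc_of% hx, ← reassoc_of% hy, sq.w]
    have hl : sq'.lift _ _ hw ≫ p = q₂ ≫ q₁ := by
      apply sq.hom_ext
      · rw [Category.assoc, hpa, sq'.lift_fst_assoc, Category.assoc, ← hx, Category.assoc]
      · rw [Category.assoc, hpb, sq'.lift_snd_assoc, ← hy, Category.assoc]
    refine isRegularEpi_of_comp (sq'.lift _ _ hw) p ?_
    rw [hl]
    exact isRegularEpi_comp _ _ hq₂ hq₁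
  obtain ⟨R₁, s₁, t₁, k₁⟩ := h₁.exists_isPullback hI (p ≫ a) (p ≫ a)
  obtain ⟨R₂, s₂, t₂, k₂⟩ := h₂.exists_isPullback hI (p ≫ b) (p ≫ b)
  have hc := pullback.condition (f := prod.lift s₁ t₁) (g := prod.lift s₂ t₂)
  have hc₁ : pullback.fst (prod.lift s₁ t₁) (prod.lift s₂ t₂) ≫ s₁ = pullback.snd _ _ ≫ s₂ := by
    simpa only [Category.assoc, prod.lift_fst] using congrArg (· ≫ prod.fst) hc
  have hc₂ : pullback.fst (prod.lift s₁ t₁) (prod.lift s₂ t₂) ≫ t₁ = pullback.snd _ _ ≫ t₂ := by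
    simpa only [Category.assoc, prod.lift_snd] using congrArg (· ≫ prod.snd) hc
  obtain ⟨R, r₁, r₂, k⟩ := exists_isPullback_of_cover (f := p) (g := p)
    (pullback.fst (prod.lift s₁ t₁) (prod.lift s₂ t₂) ≫ s₁)
    (pullback.fst (prod.lift s₁ t₁) (prod.lift s₂ t₂) ≫ t₁) (by
      apply sq.hom_ext
      · simp only [I.map_comp, Category.assoc, k₁.w]
      · simp only [hc₁, hc₂, I.map_comp, Category.assoc, k₂.w])
    fun {T} x y hxy => by
      have w₁ : x ≫ p ≫ a = y ≫ p ≫ a := by rw [reassoc_of% hxy]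
      have w₂ : x ≫ p ≫ b = y ≫ p ≫ b := by rw [reassoc_of% hxy]
      obtain ⟨z, hz, -⟩ := exists_lift_map (prod.lift s₁ t₁) (prod.lift s₂ t₂) (k₁.lift _ _ w₁)
        (k₂.lift _ _ w₂) (by
          refine BinaryFan.IsLimit.hom_ext (isLimitOfHasBinaryProductOfPreservesLimit I w w) ?_ ?_
          · change (_ ≫ I.map _) ≫ I.map prod.fst = (_ ≫ I.map _) ≫ I.map prod.fst
            simp only [Category.assoc, ← I.map_comp, prod.lift_fst, k₁.lift_fst, k₂.lift_fst]
          · change (_ ≫ I.map _) ≫ I.map prod.snd = (_ ≫ I.map _) ≫ I.map prod.snd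
            simp only [Category.assoc, ← I.map_comp, prod.lift_snd, k₁.lift_snd, k₂.lift_snd])
      refine ⟨T, 𝟙 T, z, inferInstance, ?_, ?_⟩
      · rw [I.map_comp, reassoc_of% hz, k₁.lift_fst, Category.id_comp]
      · rw [I.map_comp, reassoc_of% hz, k₁.lift_snd, Category.id_comp]
  exact ⟨w, R, p, r₁, r₂, hp, k⟩

/-- The kernel pair of `p ≫ q` consists of the pairs of generators whose classes are related by `R`.
It is covered by triples of two generators of `Q` and a generator of `R` that relates them. -/
theorem IsQuotient.quotient {R Q Q' : S} (hR : IsQuotient I R) (hQ : IsQuotient I Q) {q : Q ⟶ Q'}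
    (hq : IsRegularEpi q) {r₁ r₂ : R ⟶ Q} (hk : IsKernelPair q r₁ r₂) : IsQuotient I Q' := by
  obtain ⟨c, -, p, -, -, hp, -⟩ := id hQ
  obtain ⟨d, -, e, -, -, he, -⟩ := hR
  obtain ⟨w₁, s₁, t₁, k₁⟩ := hQ.exists_isPullback hI p (e ≫ r₁)
  obtain ⟨w₂, s₂, t₂, k₂⟩ := hQ.exists_isPullback hI p (e ≫ r₂)
  obtain ⟨N, n₁, n₂, k⟩ := exists_isPullback_of_cover (f := p ≫ q) (g := p ≫ q)
    (pullback.fst t₁ t₂ ≫ s₁) (pullback.snd t₁ t₂ ≫ s₂) (by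
      rw [I.map_comp_assoc, I.map_comp_assoc, reassoc_of% k₁.w, reassoc_of% k₂.w, hk.w,
        ← I.map_comp_assoc, ← I.map_comp_assoc, pullback.condition])
    fun {T} x y hxy => by
      have w : (x ≫ p) ≫ q = (y ≫ p) ≫ q := by simpa using hxy
      obtain ⟨T', f, z, hf, hz⟩ := exists_pullback_cover e he (hk.lift _ _ w)
      obtain ⟨z', hz₁, hz₂⟩ := exists_lift_map t₁ t₂
        (k₁.lift (f ≫ x) z (by
          rw [← reassoc_of% hz, hk.lift_fst, Category.assoc]))
        (k₂.lift (f ≫ y) z (by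
          rw [← reassoc_of% hz, hk.lift_snd, Category.assoc])) (by
          rw [k₁.lift_snd, k₂.lift_snd])
      refine ⟨T', f, z', hf, ?_, ?_⟩
      · rw [I.map_comp, reassoc_of% hz₁, k₁.lift_fst]
      · rw [I.map_comp, reassoc_of% hz₂, k₂.lift_fst]
  exact ⟨c, N, p ≫ q, n₁, n₂, isRegularEpi_comp _ _ hp hq, k⟩

end Quotients

theorem exists_iso_of_image {S : Type u} [Category.{v} S] [Regular S] {X Y U V : S} {e : X ⟶ U}
    {m : U ⟶ Y} {e' : X ⟶ V} {m' : V ⟶ Y} (h : e ≫ m = e' ≫ m') (he : IsRegularEpi e)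
    (he' : IsRegularEpi e') [Mono m] [Mono m'] : Nonempty (U ≅ V) := by
  have sq : CommSq e' e m' m := ⟨h.symm⟩
  have h1 : IsRegularEpi sq.lift := isRegularEpi_of_comp e _ (by rwa [sq.fac_left])
  have h2 : Mono (sq.lift ≫ m') := by rwa [sq.fac_right]
  have h3 : Mono sq.lift := mono_of_mono _ m'
  have := isIso_of_isRegularEpi_of_mono _ h1
  exact ⟨asIso sq.lift⟩

/-! ### Construction of the exact completion -/

section Subcategory

variable {C : Type u} [Category.{v} C] [Regular C] {X : Type u₂} [Category.{v₂} X]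
  {S : Type u₁} [Category.{v₁} S] [BarrExact S]

theorem isGenerating_of_comp (I : C ⥤ X) (ι : X ⥤ S) [ι.Full] [ι.Faithful]
    [IsRegularFunctor (I ⋙ ι)] [hfull : (I ⋙ ι).Full] [hfaithful : (I ⋙ ι).Faithful]
    (hI : LiftsLocally (I ⋙ ι)) (hobj : ∀ x, IsQuotient (I ⋙ ι) (ι.obj x))
    (hess : ∀ Q, IsQuotient (I ⋙ ι) Q → ∃ x, Nonempty (ι.obj x ≅ Q)) : IsGenerating I := by
  obtain ⟨h1, h2, h3⟩ : BarrExact X ∧ IsRegularFunctor ι ∧ ∀ {x y : X} (f : x ⟶ y),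
      IsRegularEpi (ι.map f) → IsRegularEpi f := by
    refine barrExact_of_fullyFaithful ι ?_ ?_ ?_ ?_
    · obtain ⟨x, ⟨θ⟩⟩ := hess _ (isQuotient_obj (I := I ⋙ ι) (⊤_ C))
      exact ⟨x, ⟨(terminalIsTerminal.isTerminalObj (I ⋙ ι) _).ofIso θ.symm⟩⟩
    · intro x y z f g
      have sq := IsPullback.of_hasPullback (ι.map f) (ι.map g)
      obtain ⟨w, ⟨θ⟩⟩ := hess _ ((hobj x).pullback hI (hobj y) (hobj z) sq)
      refine ⟨w, ι.preimage (θ.hom ≫ pullback.fst _ _), ι.preimage (θ.hom ≫ pullback.snd _ _), ?_⟩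
      exact IsPullback.of_iso sq θ.symm (Iso.refl _) (Iso.refl _) (Iso.refl _) (by simp) (by simp)
        (by simp) (by simp)
    · intro x y f
      obtain ⟨U, e, m, he, hm, h⟩ := exists_image (ι.map f)
      obtain ⟨w, ⟨θ⟩⟩ := hess _ ((hobj x).image hI (hobj y) e m he)
      refine ⟨w, ι.preimage (e ≫ θ.inv), ι.preimage (θ.hom ≫ m), ?_, ?_, ι.map_injective ?_⟩
      · rw [ι.map_preimage]
        exact (MorphismProperty.cancel_right_of_respectsIso (MorphismProperty.regularEpi S) e _).2 he
      · rw [ι.map_preimage]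
        infer_instance
      · simpa using h
    · intro r x r₁ r₂ hr
      obtain ⟨⟨ε⟩⟩ := BarrExact.effective (ι.map r₁) (ι.map r₂)
      have hπ : IsRegularEpi ε.π := inferInstance
      obtain ⟨y, ⟨θ⟩⟩ := hess _ ((hobj r).quotient hI (hobj x) hπ ε.isKernelPair)
      refine ⟨y, ι.preimage (ε.π ≫ θ.inv), ?_, ?_⟩
      · rw [ι.map_preimage]
        exact (MorphismProperty.cancel_right_of_respectsIso (MorphismProperty.regularEpi S) _ _).2 hπ
      · rw [ι.map_preimage]
        exact ε.isKernelPair.comp_of_mono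
  refine ⟨h1, ⟨⟨fun J _ _ => preservesLimitsOfShape_of_reflects_of_preserves I ι⟩,
    fun f hf => h3 _ (IsRegularFunctor.map_regularEpi (F := I ⋙ ι) f hf)⟩,
    Functor.Full.of_comp_faithful I ι, Functor.Faithful.of_comp I ι, fun Q => ?_,
    fun {c U} m hm => ?_⟩
  · obtain ⟨c, -, p, -, -, hp, -⟩ := hobj Q
    exact ⟨c, ι.preimage p, h3 _ (by rwa [ι.map_preimage])⟩
  · obtain ⟨d, -, p, -, -, hp, -⟩ := hobj U
    have : Mono (ι.map m) := inferInstance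
    -- A subobject of `I c` is the image of a map between objects of `C`, and its image in `C`
    -- represents the same subobject.
    obtain ⟨w, e, m', he, hm', hf⟩ := exists_image ((I ⋙ ι).preimage (Y := c) (p ≫ ι.map m))
    have h := congrArg (I ⋙ ι).map hf
    rw [Functor.map_comp, Functor.map_preimage] at h
    obtain ⟨θ⟩ := exists_iso_of_image h (IsRegularFunctor.map_regularEpi e he) hp
    exact ⟨w, ⟨ι.preimageIso θ⟩⟩

end Subcategory

section Presented

variable {C : Type max u v} [Category.{v} C] {S : Type u₁} [Category.{max u v} S]

/-- Presentations of quotients of objects `I c` by equivalence relations in the image of `I`. -/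
structure QuotientPresentation (I : C ⥤ S) : Type max u v where
  gen : C
  rel : C
  left : rel ⟶ gen
  right : rel ⟶ gen
  exists_quotient : ∃ (Q : S) (p : I.obj gen ⟶ Q), IsRegularEpi p ∧
    IsKernelPair p (I.map left) (I.map right)

/-- The objects `I c` together with the presented quotients. -/
noncomputable def presentedObj (I : C ⥤ S) : C ⊕ QuotientPresentation I → S :=
  Sum.elim I.obj fun x => x.exists_quotient.choose

/-- The functor `I`, with values in the full subcategory of presented quotients. -/
noncomputable def toPresented (I : C ⥤ S) : C ⥤ InducedCategory S (presentedObj I) where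
  obj c := Sum.inl c
  map f := ⟨I.map f⟩

/-- Naming the quotients by their presentations in `C`, instead of taking all such objects of `S`,
keeps the objects in the universe of `C`. Nothing is lost, since a quotient is determined up to
isomorphism by its kernel pair. -/
theorem exists_isGenerating [Regular C] [BarrExact S] (I : C ⥤ S) [IsRegularFunctor I] [I.Full]
    [I.Faithful] (hI : LiftsLocally I) :
    ∃ (X : Type max u v) (_ : Category.{max u v} X) (J : C ⥤ X), IsGenerating J := by
  refine ⟨_, _, toPresented I, @isGenerating_of_comp _ _ _ _ _ _ _ _ (toPresented I)
    (inducedFunctor (presentedObj I)) _ _ ‹IsRegularFunctor I› ‹I.Full› ‹I.Faithful› hI ?_ ?_⟩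
  · rintro (c | x)
    · exact isQuotient_obj (I := I) c
    · obtain ⟨p, hp, hk⟩ := x.exists_quotient.choose_spec
      exact ⟨_, _, p, _, _, hp, hk⟩
  · rintro Q ⟨c, R, p, r₁, r₂, hp, hk⟩
    let x : QuotientPresentation I := ⟨c, R, r₁, r₂, Q, p, hp, hk⟩
    obtain ⟨p', hp', hk'⟩ := x.exists_quotient.choose_spec
    exact ⟨.inr x, ⟨(hk'.toCoequalizer (IsRegularEpi.getStruct p')).coconePointUniqueUpToIso
      (hk.toCoequalizer (IsRegularEpi.getStruct p))⟩⟩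

end Presented

/-- Every regular category has an exact completion. -/
theorem exists_isExactCompletion (C : Type max u v) [Category.{v} C] [Regular C] :
    ∃ (X : Type max u v) (_ : Category.{max u v} X) (I : C ⥤ X),
      IsExactCompletion.{max u v, v, max u v, max u v, u₂, v₂} I := by
  have := barrExact_sheaf.{u, v} C
  have := isRegularFunctor_sheafYoneda.{u, v} (C := C)
  obtain ⟨X, _, I, hI⟩ := exists_isGenerating.{u, v} (sheafYoneda.{u, v} C) exists_lift_sheafYoneda
  exact ⟨X, _, I, hI.isExactCompletion⟩

/-! ### Applicative terms with parameters in A' -/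

section Combinators

variable {E : Type u} [Category.{v} E] [CartesianMonoidalCategory E]

theorem OPAS.App.mono {A : OPAS E} {T : E} {a b c d e : T ⟶ A.carrier} (h : A.App b d e)
    (hab : A.Le a b) (hcd : A.Le c d) : ∃ f, A.App a c f ∧ A.Le f e :=
  A.app_mono a b c d e hab hcd h

theorem OPAS.Le.comp {A : OPAS E} {T S : E} {x y : T ⟶ A.carrier} (h : A.Le x y) (s : S ⟶ T) :
    A.Le (s ≫ x) (s ≫ y) := by
  unfold OPAS.Le
  rw [← comp_lift]
  exact Subobject.factors_of_factors_right _ h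

theorem OPAS.AppList.append {A : OPAS E} {T : E} {l : List (T ⟶ A.carrier)}
    {a b y : T ⟶ A.carrier} : A.AppList a (l ++ [b]) y ↔ ∃ z, A.AppList a l z ∧ A.App z b y := by
  induction l generalizing a with
  | nil =>
    constructor
    · rintro ⟨c, hc, rfl⟩
      exact ⟨a, rfl, hc⟩
    · rintro ⟨z, rfl, h⟩
      exact ⟨y, h, rfl⟩
  | cons x l ih =>
    constructor
    · rintro ⟨c, hc, h⟩
      obtain ⟨z, hz, h'⟩ := ih.1 h
      exact ⟨z, ⟨c, hc, hz⟩, h'⟩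
    · rintro ⟨z, ⟨c, hc, hz⟩, h'⟩
      exact ⟨c, hc, ih.2 ⟨z, hz, h'⟩⟩

theorem OPAS.AppList.comp {A : OPAS E} {T S : E} {l : List (T ⟶ A.carrier)} {a y : T ⟶ A.carrier}
    (h : A.AppList a l y) (s : S ⟶ T) : A.AppList (s ≫ a) (l.map (s ≫ ·)) (s ≫ y) := by
  induction l generalizing a with
  | nil => exact congrArg (s ≫ ·) h
  | cons x l ih =>
    obtain ⟨c, hc, h⟩ := h
    exact ⟨s ≫ c, hc.comp s, ih h⟩

theorem OPAS.AppList.unique {A : OPAS E} {T : E} {l : List (T ⟶ A.carrier)}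
    {a y z : T ⟶ A.carrier} (h : A.AppList a l y) (h' : A.AppList a l z) : y = z := by
  induction l generalizing a with
  | nil => exact h.trans h'.symm
  | cons x l ih =>
    obtain ⟨c, hc, h⟩ := h
    obtain ⟨c', hc', h'⟩ := h'
    obtain rfl := hc.unique hc'
    exact ih h h'

theorem OPCAPair.sub_appList [HasFiniteLimits E] (P : OPCAPair E) {T : E}
    {l : List (T ⟶ P.carrier)} {a y : T ⟶ P.carrier} (h : P.AppList a l y) (ha : P.sub.Factors a)
    (hl : ∀ x ∈ l, P.sub.Factors x) : P.sub.Factors y := by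
  induction l generalizing a with
  | nil => rwa [show y = a from h]
  | cons x l ih =>
    obtain ⟨c, hc, h⟩ := h
    exact ih h (P.sub_app _ _ _ ha (hl x (by simp)) hc) fun z hz => hl z (by simp [hz])

variable [HasFiniteLimits E] [MonoidalClosed E]

/-- Substituting elements of `A'` for all but the last variable of an applicative term gives a
partial arrow which is realized by an element of `A'`. -/
theorem OPCAPair.exists_element (P : OPCAPair E) {n : ℕ} (t : CombTerm (n + 1)) {T : E}
    (hT : IsInhabited T) (x : Fin n → (T ⟶ P.carrier)) (hx : ∀ i, P.sub.Factors (x i)) :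
    ∃ (T' : E) (e : T' ⟶ T) (q : T' ⟶ P.carrier), IsInhabited T' ∧ P.sub.Factors q ∧
      ∀ {S : E} (s : S ⟶ T') (b y : S ⟶ P.carrier),
        P.Eval (Fin.snoc (α := fun _ => S ⟶ P.carrier) (fun i => s ≫ e ≫ x i) b) t y →
          ∃ z, P.App (s ≫ q) b z ∧ P.Le z y := by
  obtain ⟨V, hV, hV'⟩ := P.complete t
  obtain ⟨T₁, v, hT₁, hv, hv'⟩ := hV'.exists_factors
  have aux : ∀ {S : E} (x : Fin n → (S ⟶ P.carrier)) (b : S ⟶ P.carrier),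
      List.ofFn (Fin.snoc (α := fun _ => S ⟶ P.carrier) x b) = List.ofFn x ++ [b] := fun x b => by
    rw [List.ofFn_succ', List.concat_eq_append]
    simp
  let w : T ⊗ T₁ ⟶ P.carrier := snd _ _ ≫ v
  -- Definedness of partial applications is stated for tuples of full length; `w` fills the last
  -- slot, which `List.take` discards.
  obtain ⟨q, hq⟩ := (hV w (Subobject.factors_of_factors_right _ hv)
    (Fin.snoc (α := fun _ => T ⊗ T₁ ⟶ P.carrier) (fun i => fst _ _ ≫ x i) w)).1 n (by omega)
  rw [aux, List.take_left' (by simp)] at hq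
  refine ⟨T ⊗ T₁, fst _ _, q, hT.tensor hT₁, P.sub_appList hq
    (Subobject.factors_of_factors_right _ hv') ?_, fun {S} s b y hy => ?_⟩
  · intro z hz
    obtain ⟨i, rfl⟩ := (List.mem_ofFn' _ _).1 hz
    exact Subobject.factors_of_factors_right _ (hx i)
  · obtain ⟨z, hz, hz'⟩ := (hV (s ≫ w) (Subobject.factors_of_factors_right _
      (Subobject.factors_of_factors_right _ hv)) _).2 y hy
    rw [aux, OPAS.AppList.append] at hz
    obtain ⟨q', hq', hz⟩ := hz
    have h := hq.comp s
    rw [List.map_ofFn] at h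
    obtain rfl := h.unique hq'
    exact ⟨z, hz, hz'⟩

theorem isInhabited_terminal : IsInhabited (⊤_ E) := by
  have : IsIso (terminal.from (⊤_ E)) := ⟨terminal.from _, Subsingleton.elim _ _,
    Subsingleton.elim _ _⟩
  unfold IsInhabited
  infer_instance

end Combinators

/-! ### Uniformly realized entailment -/

section Entailment

variable {E : Type u} [Category.{v} E] [CartesianMonoidalCategory E] [HasFiniteLimits E]
  {P : OPCAPair E}

theorem factors_lift_comp {X Y T S : E} {R : Subobject (X ⊗ Y)} {x : T ⟶ X} {y : T ⟶ Y}
    (h : R.Factors (lift x y)) (s : S ⟶ T) : R.Factors (lift (s ≫ x) (s ≫ y)) := by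
  rw [← comp_lift]
  exact Subobject.factors_of_factors_right _ h

/-- Definedness is membership in the domain, which is local, and the value is unique. -/
theorem App.of_isRegularEpi {S T : E} (e : S ⟶ T) (he : IsRegularEpi e) {a b : T ⟶ P.carrier}
    {c : S ⟶ P.carrier} (h : P.App (e ≫ a) (e ≫ b) c) : ∃ c', P.App a b c' ∧ e ≫ c' = c := by
  obtain ⟨d, h1, h2⟩ := id h
  have h3 : P.dom.Factors (lift a b) := by
    refine factors_of_isRegularEpi _ e he _ ?_
    rw [comp_lift, ← h1]
    exact Subobject.factors_comp_arrow _
  have h4 : P.App a b (P.dom.factorThru _ h3 ≫ P.app) :=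
    ⟨_, Subobject.factorThru_arrow _ _ h3, rfl⟩
  exact ⟨_, h4, (h4.comp e).unique h⟩

/-- The entailment of predicates on `X` with values in downward closed subobjects of `A`: it is
realized by the elements of a subobject of `A` that intersects `A'`. -/
def Entails {X : E} (R R' : Subobject (P.carrier ⊗ X)) : Prop :=
  ∃ V : Subobject P.carrier, Intersects V P.sub ∧ ∀ {T : E} (a b : T ⟶ P.carrier) (x : T ⟶ X),
    V.Factors a → R.Factors (lift b x) → ∃ c, P.App a b c ∧ R'.Factors (lift c x)

theorem Entails.exists_element {X : E} {R R' : Subobject (P.carrier ⊗ X)} (h : Entails R R') :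
    ∃ (T : E) (q : T ⟶ P.carrier), IsInhabited T ∧ P.sub.Factors q ∧
      ∀ {S : E} (s : S ⟶ T) (b : S ⟶ P.carrier) (x : S ⟶ X), R.Factors (lift b x) →
        ∃ c, P.App (s ≫ q) b c ∧ R'.Factors (lift c x) := by
  obtain ⟨V, hV, h⟩ := h
  obtain ⟨T, q, hT, hq, hq'⟩ := hV.exists_factors
  exact ⟨T, q, hT, hq', fun s b x hx => h _ b x (Subobject.factors_of_factors_right _ hq) hx⟩

/-- The subobject `R` of `A ⊗ X` is downward closed in the first coordinate. -/
def DownClosed {X : E} (R : Subobject (P.carrier ⊗ X)) : Prop :=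
  ∀ {T : E} (a b : T ⟶ P.carrier) (x : T ⟶ X), R.Factors (lift a x) → P.Le b a →
    R.Factors (lift b x)

variable [MonoidalClosed E] [HasSubobjectClassifier E]

attribute [local instance] regular_of_topos

/-- The required subobject of `A` is the image of `q`. Its elements come locally from `T`, and
application and membership can be checked locally. -/
theorem entails_of_element {X : E} {R R' : Subobject (P.carrier ⊗ X)} {T : E} (hT : IsInhabited T)
    (q : T ⟶ P.carrier) (hq : P.sub.Factors q)
    (h : ∀ {S : E} (s : S ⟶ T) (b : S ⟶ P.carrier) (x : S ⟶ X), R.Factors (lift b x) →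
        ∃ c, P.App (s ≫ q) b c ∧ R'.Factors (lift c x)) : Entails R R' := by
  obtain ⟨V, hV⟩ := exists_imageSub (⊤ : Subobject T) q
  refine ⟨V, intersects_of_factors hT q ((hV q).2 ⟨T, 𝟙 T, 𝟙 T, inferInstance,
    Subobject.top_factors _, rfl⟩) hq, fun {S} a b x ha hx => ?_⟩
  obtain ⟨S', e, s, he, -, hs⟩ := (hV a).1 ha
  obtain ⟨c, hc, hc'⟩ := h s (e ≫ b) (e ≫ x) (factors_lift_comp hx e)
  rw [hs] at hc
  obtain ⟨c', hc₁, rfl⟩ := App.of_isRegularEpi e he hc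
  refine ⟨c', hc₁, factors_of_isRegularEpi _ e he _ ?_⟩
  rwa [comp_lift]

/-- An entailment is realized by an applicative term with parameters from `A'`. -/
theorem entails_of_term {X : E} {R R' : Subobject (P.carrier ⊗ X)} (hR' : DownClosed R') {n : ℕ}
    (t : CombTerm (n + 1)) {T : E} (hT : IsInhabited T) (q : Fin n → (T ⟶ P.carrier))
    (hq : ∀ i, P.sub.Factors (q i))
    (h : ∀ {S : E} (s : S ⟶ T) (b : S ⟶ P.carrier) (x : S ⟶ X), R.Factors (lift b x) →
      ∃ c, P.Eval (Fin.snoc (α := fun _ => S ⟶ P.carrier) (fun i => s ≫ q i) b) t c ∧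
        R'.Factors (lift c x)) : Entails R R' := by
  obtain ⟨T', e, q', hT', hq', H⟩ := P.exists_element t hT q hq
  refine entails_of_element hT' q' hq' fun {S} s b x hx => ?_
  obtain ⟨c, hc, hc'⟩ := h (s ≫ e) b x hx
  simp only [Category.assoc] at hc
  obtain ⟨z, hz, hz'⟩ := H s b c hc
  exact ⟨z, hz, hR' _ _ _ hc' hz'⟩

theorem entails_of_imp {X : E} {R R' : Subobject (P.carrier ⊗ X)} (hR' : DownClosed R')
    (h : ∀ {S : E} (b : S ⟶ P.carrier) (x : S ⟶ X), R.Factors (lift b x) →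
      R'.Factors (lift b x)) : Entails R R' :=
  entails_of_term hR' (n := 0) (.var 0) isInhabited_terminal Fin.elim0 (fun i => i.elim0)
    fun _ b x hx => ⟨b, rfl, h b x hx⟩

theorem Entails.trans {X : E} {R R' R'' : Subobject (P.carrier ⊗ X)} (h : Entails R R')
    (h' : Entails R' R'') (hd : DownClosed R'') : Entails R R'' := by
  obtain ⟨T₁, q₁, hT₁, hq₁, h₁⟩ := h.exists_element
  obtain ⟨T₂, q₂, hT₂, hq₂, h₂⟩ := h'.exists_element
  refine entails_of_term hd (n := 2) (.app (.var 1) (.app (.var 0) (.var 2))) (hT₁.tensor hT₂)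
    ![fst _ _ ≫ q₁, snd _ _ ≫ q₂] (fun i => ?_) fun {S} s b x hx => ?_
  · fin_cases i
    · exact Subobject.factors_of_factors_right _ hq₁
    · exact Subobject.factors_of_factors_right _ hq₂
  · obtain ⟨c, hc, hc'⟩ := h₁ (s ≫ fst _ _) b x hx
    obtain ⟨d, hd, hd'⟩ := h₂ (s ≫ snd _ _) c x hc'
    rw [Category.assoc] at hc hd
    exact ⟨d, ⟨_, c, rfl, ⟨_, _, rfl, rfl, hc⟩, hd⟩, hd'⟩

end Entailment

/-! ### Conjunction and direct image of predicates -/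

section Relations

variable {E : Type u} [Category.{v} E] [CartesianMonoidalCategory E] [HasFiniteLimits E]
  {P : OPCAPair E}

/-- The subobject of those elements of `B` at which `x y` is defined and satisfies `φ`. -/
theorem exists_app_subobject {B : E} (x y : B ⟶ P.carrier) (φ : Subobject (P.carrier ⊗ B)) :
    ∃ U : Subobject B, ∀ {T : E} (b : T ⟶ B),
      U.Factors b ↔ ∃ c, P.App (b ≫ x) (b ≫ y) c ∧ φ.Factors (lift c b) := by
  let D := (Subobject.pullback (lift x y)).obj P.dom
  have sq := Subobject.isPullback (lift x y) P.dom
  let α : (D : E) ⟶ P.carrier ⊗ B := lift (Subobject.pullbackπ _ P.dom ≫ P.app) D.arrow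
  refine ⟨Subobject.mk (((Subobject.pullback α).obj φ).arrow ≫ D.arrow), fun {T} b => ?_⟩
  rw [mk_factors_iff_exists]
  constructor
  · rintro ⟨k, hk⟩
    rw [← Category.assoc] at hk
    let d := k ≫ ((Subobject.pullback α).obj φ).arrow
    refine ⟨d ≫ Subobject.pullbackπ _ P.dom ≫ P.app, ⟨d ≫ Subobject.pullbackπ _ P.dom, ?_, ?_⟩, ?_⟩
    · rw [Category.assoc, sq.w, ← Category.assoc, hk, comp_lift]
    · rw [Category.assoc]
    · have h : φ.Factors (d ≫ α) := by
        rw [← Limits.pullback_factors_iff]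
        exact Subobject.factors_comp_arrow _
      simp only [α, comp_lift] at h
      rwa [hk] at h
  · rintro ⟨c, ⟨d, hd, rfl⟩, hc⟩
    have w : d ≫ P.dom.arrow = b ≫ lift x y := by rw [hd, comp_lift]
    obtain ⟨l, h1, h2⟩ : ∃ l : T ⟶ (D : E), l ≫ Subobject.pullbackπ _ P.dom = d ∧ l ≫ D.arrow = b :=
      ⟨sq.lift d b w, sq.lift_fst _ _ _, sq.lift_snd _ _ _⟩
    have h : ((Subobject.pullback α).obj φ).Factors l := by
      rw [Limits.pullback_factors_iff]
      simp only [α, comp_lift]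
      rwa [← Category.assoc, h1, h2]
    exact ⟨Subobject.factorThru _ l h, by rw [← Category.assoc, Subobject.factorThru_arrow, h2]⟩

theorem pullback_whiskerLeft_factors_iff {A X Y T : E} (R : Subobject (A ⊗ Y)) (f : X ⟶ Y)
    (a : T ⟶ A) (x : T ⟶ X) : ((Subobject.pullback (A ◁ f)).obj R).Factors (lift a x) ↔
      R.Factors (lift a (x ≫ f)) := by
  rw [Limits.pullback_factors_iff, lift_whiskerLeft]

theorem DownClosed.pullback {X Y : E} {R : Subobject (P.carrier ⊗ Y)} (hR : DownClosed R)
    (f : X ⟶ Y) : DownClosed ((Subobject.pullback (P.carrier ◁ f)).obj R) := fun a b x h hab => by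
  rw [pullback_whiskerLeft_factors_iff] at h ⊢
  exact hR _ _ _ h hab

variable [MonoidalClosed E] [HasSubobjectClassifier E]

theorem exists_forall_app {W : E} (K : Subobject P.carrier) (R : Subobject (P.carrier ⊗ W)) :
    ∃ R' : Subobject (P.carrier ⊗ W), ∀ {T : E} (a : T ⟶ P.carrier) (z : T ⟶ W),
      R'.Factors (lift a z) ↔ ∀ {S : E} (s : S ⟶ T) (k : S ⟶ P.carrier), K.Factors k →
        ∃ c, P.App (s ≫ a) k c ∧ R.Factors (lift c (s ≫ z)) := by
  obtain ⟨U, hU⟩ := exists_app_subobject (B := P.carrier ⊗ (P.carrier ⊗ W)) (snd _ _ ≫ fst _ _)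
    (fst _ _) ((Subobject.pullback (P.carrier ◁ (snd _ _ ≫ snd _ _))).obj R)
  obtain ⟨I, hI⟩ := exists_imp ((Subobject.pullback (fst _ _)).obj K) U
  obtain ⟨R', hR'⟩ := exists_forall_factors_iff I
  refine ⟨R', fun {T} a z => (hR' _).trans ?_⟩
  simp only [hI, hU, Limits.pullback_factors_iff, Category.assoc, lift_fst, lift_snd_assoc]
  refine ⟨fun h S s k hk => ?_, fun h S s k S' s' hk => ?_⟩
  · simpa using h s k (𝟙 S) (by simpa using hk)
  · simpa using h (s' ≫ s) (s' ≫ k) hk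

attribute [local instance] regular_of_topos

/-- The conjunction of two predicates with values in downward closed subobjects of `A`. -/
theorem exists_inf {W : E} {R₁ R₂ : Subobject (P.carrier ⊗ W)} (h₁ : DownClosed R₁)
    (h₂ : DownClosed R₂) : ∃ R : Subobject (P.carrier ⊗ W), DownClosed R ∧ Entails R R₁ ∧
      Entails R R₂ ∧ ∃ V : Subobject P.carrier, Intersects V P.sub ∧
        ∀ {T : E} (p a b : T ⟶ P.carrier) (z : T ⟶ W), V.Factors p → R₁.Factors (lift a z) →
          R₂.Factors (lift b z) → ∃ r c, P.App p a r ∧ P.App r b c ∧ R.Factors (lift c z) := by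
  -- Pairing sends `a`, `b` to λk. k a b, with realizers in `V`; elements of `K₁` and `K₂` extract
  -- the components.
  obtain ⟨K₁, hK₁, hK₁'⟩ := P.complete (n := 2) (.var 0)
  obtain ⟨K₂, hK₂, hK₂'⟩ := P.complete (n := 2) (.var 1)
  obtain ⟨V, hV, hV'⟩ := P.complete (n := 3) (.app (.app (.var 2) (.var 0)) (.var 1))
  -- A realizer of a conjunct is a code that works for every projection in `K₁`. The quantifier
  -- avoids the choice of a projection, of which there need not be a global one.
  obtain ⟨R₁', hR₁'⟩ := exists_forall_app K₁ R₁
  obtain ⟨R₂', hR₂'⟩ := exists_forall_app K₂ R₂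
  have entails : ∀ {R : Subobject (P.carrier ⊗ W)} (_ : DownClosed R) {K : Subobject P.carrier}
      (_ : Intersects K P.sub) {R' : Subobject (P.carrier ⊗ W)} (_ : ∀ {T : E} (a : T ⟶ P.carrier)
      (z : T ⟶ W), R'.Factors (lift a z) ↔ ∀ {S : E} (s : S ⟶ T) (k : S ⟶ P.carrier),
        K.Factors k → ∃ c, P.App (s ≫ a) k c ∧ R.Factors (lift c (s ≫ z))), Entails R' R := by
    intro R hR K hK R' hR'
    obtain ⟨T, k, hT, hk, hk'⟩ := hK.exists_factors
    refine entails_of_term hR (n := 1) (.app (.var 1) (.var 0)) hT ![k] (fun i => by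
      fin_cases i; exact hk') fun {S} s b x hx => ?_
    obtain ⟨c, hc, hc'⟩ := (hR' _ _).1 hx (𝟙 S) (s ≫ k) (Subobject.factors_of_factors_right _ hk)
    rw [Category.id_comp] at hc hc'
    exact ⟨c, ⟨_, _, rfl, rfl, hc⟩, hc'⟩
  have down : ∀ {R : Subobject (P.carrier ⊗ W)} (_ : DownClosed R) {K : Subobject P.carrier}
      {R' : Subobject (P.carrier ⊗ W)} (_ : ∀ {T : E} (a : T ⟶ P.carrier)
      (z : T ⟶ W), R'.Factors (lift a z) ↔ ∀ {S : E} (s : S ⟶ T) (k : S ⟶ P.carrier),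
        K.Factors k → ∃ c, P.App (s ≫ a) k c ∧ R.Factors (lift c (s ≫ z))), DownClosed R' := by
    intro R hR K R' hR' T a b z h hab
    rw [hR'] at h ⊢
    intro S s k hk
    obtain ⟨c, hc, hc'⟩ := h s k hk
    obtain ⟨c', hd, hd'⟩ := hc.mono (OPAS.Le.comp hab s) (P.le_refl k)
    exact ⟨c', hd, hR _ _ _ hc' hd'⟩
  -- If `c` is the value of `p a b`, then `c k` is at most `k a b`, which is at most the selected
  -- component.
  have proj : ∀ {K : Subobject P.carrier} {i : Fin 2} (_ : P.Realizes K (.var i)) {S : E}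
      (p a b k r c : S ⟶ P.carrier), V.Factors p → P.App p a r → P.App r b c → K.Factors k →
      ∃ d, P.App c k d ∧ P.Le d (![a, b] i) := by
    intro K i hK S p a b k r c hp hr hc hk
    obtain ⟨y, hy, hy'⟩ := (hK k hk ![a, b]).2 _ rfl
    simp only [List.ofFn_succ, List.ofFn_zero] at hy
    obtain ⟨y₁, h₁, y₂, h₂, rfl⟩ := hy
    obtain ⟨z, hz, hz'⟩ := (hV p hp ![a, b, k]).2 y ⟨y₁, b, ⟨k, a, rfl, rfl, h₁⟩, rfl, h₂⟩
    simp only [List.ofFn_succ, List.ofFn_zero] at hz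
    obtain ⟨r', hr', c', hc', d, hd, rfl⟩ := hz
    obtain rfl := hr.unique hr'
    obtain rfl := hc.unique hc'
    exact ⟨z, hd, P.le_trans _ _ _ hz' hy'⟩
  refine ⟨R₁' ⊓ R₂', fun a b z h hab => ?_, ?_, ?_, V, hV', ?_⟩
  · rw [Subobject.inf_factors] at h ⊢
    exact ⟨down h₁ hR₁' _ _ _ h.1 hab, down h₂ hR₂' _ _ _ h.2 hab⟩
  · obtain ⟨V, hV, H⟩ := entails h₁ hK₁' hR₁'
    exact ⟨V, hV, fun a b x ha hx => H a b x ha ((Subobject.inf_factors _).1 hx).1⟩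
  · obtain ⟨V, hV, H⟩ := entails h₂ hK₂' hR₂'
    exact ⟨V, hV, fun a b x ha hx => H a b x ha ((Subobject.inf_factors _).1 hx).2⟩
  · intro T p a b z hp ha hb
    obtain ⟨c, hc⟩ := (hV p hp ![a, b, b]).1 2 (by norm_num)
    simp only [List.ofFn_succ, List.ofFn_zero, List.take_succ_cons, List.take_zero] at hc
    obtain ⟨r, hr, c', hc, rfl⟩ := hc
    refine ⟨r, c, hr, hc, (Subobject.inf_factors _).2 ⟨(hR₁' _ _).2 fun {S} s k hk => ?_,
      (hR₂' _ _).2 fun {S} s k hk => ?_⟩⟩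
    · obtain ⟨d, hd, hd'⟩ := proj hK₁ _ _ _ k _ _ (Subobject.factors_of_factors_right s hp)
        (hr.comp s) (hc.comp s) hk
      exact ⟨d, hd, h₁ _ _ _ (factors_lift_comp ha s) hd'⟩
    · obtain ⟨d, hd, hd'⟩ := proj hK₂ _ _ _ k _ _ (Subobject.factors_of_factors_right s hp)
        (hr.comp s) (hc.comp s) hk
      exact ⟨d, hd, h₂ _ _ _ (factors_lift_comp hb s) hd'⟩

/-- Realizers of a pair combine two entailments. -/
theorem entails_of_pairing {W Z : E} {R R₁ R₂ : Subobject (P.carrier ⊗ W)} (hR : DownClosed R)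
    (h : ∃ V : Subobject P.carrier, Intersects V P.sub ∧
      ∀ {T : E} (p a b : T ⟶ P.carrier) (z : T ⟶ W), V.Factors p → R₁.Factors (lift a z) →
        R₂.Factors (lift b z) → ∃ r c, P.App p a r ∧ P.App r b c ∧ R.Factors (lift c z))
    {S : Subobject (P.carrier ⊗ Z)} (f : Z ⟶ W)
    (h₁ : Entails S ((Subobject.pullback (P.carrier ◁ f)).obj R₁))
    (h₂ : Entails S ((Subobject.pullback (P.carrier ◁ f)).obj R₂)) :
    Entails S ((Subobject.pullback (P.carrier ◁ f)).obj R) := by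
  obtain ⟨V, hV, H⟩ := h
  obtain ⟨T, p, hT, hp, hp'⟩ := hV.exists_factors
  obtain ⟨T₁, q₁, hT₁, hq₁, H₁⟩ := h₁.exists_element
  obtain ⟨T₂, q₂, hT₂, hq₂, H₂⟩ := h₂.exists_element
  refine entails_of_term (hR.pullback f) (n := 3)
    (.app (.app (.var 0) (.app (.var 1) (.var 3))) (.app (.var 2) (.var 3)))
    (hT.tensor (hT₁.tensor hT₂)) ![fst _ _ ≫ p, snd _ _ ≫ fst _ _ ≫ q₁, snd _ _ ≫ snd _ _ ≫ q₂]
    (fun i => ?_) fun {S'} s b x hx => ?_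
  · fin_cases i
    · exact Subobject.factors_of_factors_right _ hp'
    · exact Subobject.factors_of_factors_right _ (Subobject.factors_of_factors_right _ hq₁)
    · exact Subobject.factors_of_factors_right _ (Subobject.factors_of_factors_right _ hq₂)
  · obtain ⟨c₁, hc₁, hc₁'⟩ := H₁ (s ≫ snd _ _ ≫ fst _ _) b x hx
    obtain ⟨c₂, hc₂, hc₂'⟩ := H₂ (s ≫ snd _ _ ≫ snd _ _) b x hx
    rw [pullback_whiskerLeft_factors_iff] at hc₁' hc₂'
    simp only [Category.assoc] at hc₁ hc₂
    obtain ⟨r, c, hr, hc, hc'⟩ := H (s ≫ fst _ _ ≫ p) c₁ c₂ _ (Subobject.factors_of_factors_right _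
      (Subobject.factors_of_factors_right _ hp)) hc₁' hc₂'
    exact ⟨c, ⟨r, c₂, ⟨_, c₁, rfl, ⟨_, _, rfl, rfl, hc₁⟩, hr⟩, ⟨_, _, rfl, rfl, hc₂⟩, hc⟩,
      (pullback_whiskerLeft_factors_iff _ _ _ _).2 hc'⟩

/-- The direct image of a predicate. -/
theorem exists_imageRel {X Y : E} {R : Subobject (P.carrier ⊗ X)} (hR : DownClosed R)
    (f : X ⟶ Y) : ∃ R' : Subobject (P.carrier ⊗ Y), DownClosed R' ∧
      ∀ {T : E} (a : T ⟶ P.carrier) (y : T ⟶ Y), R'.Factors (lift a y) ↔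
        ∃ (S : E) (e : S ⟶ T) (x : S ⟶ X), IsRegularEpi e ∧ R.Factors (lift (e ≫ a) x) ∧
          x ≫ f = e ≫ y := by
  obtain ⟨R', hR'⟩ := exists_imageSub R (P.carrier ◁ f)
  have key : ∀ {T : E} (a : T ⟶ P.carrier) (y : T ⟶ Y), R'.Factors (lift a y) ↔
        ∃ (S : E) (e : S ⟶ T) (x : S ⟶ X), IsRegularEpi e ∧ R.Factors (lift (e ≫ a) x) ∧
          x ≫ f = e ≫ y := fun a y => by
    rw [hR']
    constructor
    · rintro ⟨S, e, x, he, hx, h⟩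
      have h1 := congrArg (· ≫ fst _ _) h
      have h2 := congrArg (· ≫ snd _ _) h
      simp only [Category.assoc, whiskerLeft_fst, whiskerLeft_snd, lift_fst, lift_snd] at h1 h2
      refine ⟨S, e, x ≫ snd _ _, he, ?_, by rw [Category.assoc, h2]⟩
      rwa [← h1, ← comp_lift, lift_fst_snd, Category.comp_id]
    · rintro ⟨S, e, x, he, hx, h⟩
      exact ⟨S, e, _, he, hx, by rw [lift_whiskerLeft, comp_lift, h]⟩
  refine ⟨R', fun a b y h hab => ?_, key⟩
  rw [key] at h ⊢
  obtain ⟨S, e, x, he, hx, h⟩ := h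
  exact ⟨S, e, x, he, hR _ _ _ hx (hab.comp e), h⟩

end Relations

/-! ### Finite limits of assemblies -/

section AssemblyCategory

variable {E : Type u} [Category.{v} E] [CartesianMonoidalCategory E] [HasFiniteLimits E]
  [MonoidalClosed E] [HasSubobjectClassifier E] {P : OPCAPair E}

attribute [local instance] regular_of_topos

theorem factors_lift_of_isRegularEpi {X Y S T : E} (R : Subobject (X ⊗ Y)) (e : S ⟶ T)
    (he : IsRegularEpi e) (x : T ⟶ X) (y : T ⟶ Y) (h : R.Factors (lift (e ≫ x) (e ≫ y))) :
    R.Factors (lift x y) := factors_of_isRegularEpi R e he _ (by rwa [comp_lift])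

theorem isRegularEpi_arrow_snd {A X S : E} {R : Subobject (A ⊗ X)} (e : S ⟶ X)
    (he : IsRegularEpi e) (a : S ⟶ A) (h : R.Factors (lift a e)) :
    IsRegularEpi (R.arrow ≫ snd A X) := by
  refine isRegularEpi_of_comp (R.factorThru _ h) _ ?_
  rwa [← Category.assoc, Subobject.factorThru_arrow, lift_snd]

namespace Assembly

theorem exists_cover (X : Assembly P) {T : E} (x : T ⟶ X.obj) :
    ∃ (S : E) (e : S ⟶ T) (a : S ⟶ P.carrier), IsRegularEpi e ∧
      X.rel.Factors (lift a (e ≫ x)) := by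
  obtain ⟨S, e, r, he, h⟩ := exists_pullback_cover _ X.total x
  refine ⟨S, e, r ≫ X.rel.arrow ≫ fst _ _, he, ?_⟩
  rw [h, ← Category.assoc, ← Category.assoc, ← comp_lift, lift_fst_snd, Category.comp_id]
  exact Subobject.factors_comp_arrow _

theorem hom_ext {X Y : Assembly P} {f g : X ⟶ Y} (h : f.arrow = g.arrow) : f = g :=
  Assembly.Hom.ext h

@[simp]
theorem comp_arrow {X Y Z : Assembly P} (f : X ⟶ Y) (g : Y ⟶ Z) :
    (f ≫ g).arrow = f.arrow ≫ g.arrow := rfl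

@[simp]
theorem id_arrow (X : Assembly P) : Assembly.Hom.arrow (𝟙 X) = 𝟙 X.obj := rfl

/-- A morphism of assemblies from an entailment. -/
def homMk {X Y : Assembly P} (f : X.obj ⟶ Y.obj)
    (h : Entails X.rel ((Subobject.pullback (P.carrier ◁ f)).obj Y.rel)) : X ⟶ Y :=
  Assembly.Hom.mk (X := X) (X' := Y) f (by
    obtain ⟨V, hV, h⟩ := h
    refine ⟨V, fun a b x ha hx => ?_, hV⟩
    obtain ⟨c, hc, hc'⟩ := h a b x ha hx
    exact ⟨c, hc, (pullback_whiskerLeft_factors_iff _ _ _ _).1 hc'⟩)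

@[simp]
theorem homMk_arrow {X Y : Assembly P} (f : X.obj ⟶ Y.obj)
    (h : Entails X.rel ((Subobject.pullback (P.carrier ◁ f)).obj Y.rel)) :
    (homMk f h).arrow = f := rfl

theorem Hom.entails {X Y : Assembly P} (f : X ⟶ Y) :
    Entails X.rel ((Subobject.pullback (P.carrier ◁ f.arrow)).obj Y.rel) := by
  obtain ⟨V, h, hV⟩ := f.tracked
  refine ⟨V, hV, fun a b x ha hx => ?_⟩
  obtain ⟨c, hc, hc'⟩ := h a b x ha hx
  exact ⟨c, hc, (pullback_whiskerLeft_factors_iff _ _ _ _).2 hc'⟩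

/-- For maps `u` and `w` from `W` to the underlying objects of two assemblies, there is an initial
assembly structure on `W` that makes both maps tracked. -/
theorem exists_initial (X Y : Assembly P) {W : E} (u : W ⟶ X.obj) (w : W ⟶ Y.obj) :
    ∃ R : Subobject (P.carrier ⊗ W), DownClosed R ∧ IsRegularEpi (R.arrow ≫ snd _ _) ∧
      Entails R ((Subobject.pullback (P.carrier ◁ u)).obj X.rel) ∧
      Entails R ((Subobject.pullback (P.carrier ◁ w)).obj Y.rel) ∧
      ∃ V : Subobject P.carrier, Intersects V P.sub ∧
        ∀ {T : E} (p a b : T ⟶ P.carrier) (z : T ⟶ W), V.Factors p →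
          ((Subobject.pullback (P.carrier ◁ u)).obj X.rel).Factors (lift a z) →
          ((Subobject.pullback (P.carrier ◁ w)).obj Y.rel).Factors (lift b z) →
            ∃ r c, P.App p a r ∧ P.App r b c ∧ R.Factors (lift c z) := by
  have hX : DownClosed X.rel := X.down
  have hY : DownClosed Y.rel := Y.down
  obtain ⟨R, hR, h₁, h₂, V, hV, H⟩ := exists_inf (hX.pullback u) (hY.pullback w)
  refine ⟨R, hR, ?_, h₁, h₂, V, hV, H⟩
  obtain ⟨S₁, e₁, a, he₁, ha⟩ := X.exists_cover u
  obtain ⟨S₂, e₂, b, he₂, hb⟩ := Y.exists_cover (e₁ ≫ w)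
  obtain ⟨S, e, p, he, hp, -⟩ := hV.exists_cover S₂
  obtain ⟨r, c, -, -, hc⟩ := H p (e ≫ e₂ ≫ a) (e ≫ b) (e ≫ e₂ ≫ e₁) hp
    (by rw [pullback_whiskerLeft_factors_iff]
        simpa using factors_lift_comp ha (e ≫ e₂))
    (by rw [pullback_whiskerLeft_factors_iff]
        simpa using factors_lift_comp hb e)
  exact isRegularEpi_arrow_snd _ (isRegularEpi_comp _ _ he (isRegularEpi_comp _ _ he₂ he₁)) c hc

/-- The pullback in `E` carries the initial structure, whose realizers are pairs. The pairing
subobject is kept in the conclusion for the stability of covers and for the functor induced by a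
filter. -/
theorem exists_isPullback {X Y Z : Assembly P} (f : X ⟶ Z) (g : Y ⟶ Z) :
    ∃ (W : Assembly P) (a : W ⟶ X) (b : W ⟶ Y), IsPullback a b f g ∧
      IsPullback a.arrow b.arrow f.arrow g.arrow ∧
      ∃ V : Subobject P.carrier, Intersects V P.sub ∧
        ∀ {T : E} (p x y : T ⟶ P.carrier) (z : T ⟶ W.obj), V.Factors p →
          X.rel.Factors (lift x (z ≫ a.arrow)) → Y.rel.Factors (lift y (z ≫ b.arrow)) →
            ∃ r c, P.App p x r ∧ P.App r y c ∧ W.rel.Factors (lift c z) := by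
  have sq := IsPullback.of_hasPullback f.arrow g.arrow
  obtain ⟨R, hR, ht, h₁, h₂, H⟩ := exists_initial X Y (pullback.fst f.arrow g.arrow)
    (pullback.snd f.arrow g.arrow)
  let W : Assembly P := ⟨_, R, ht, hR⟩
  have lift : ∀ {T : Assembly P} (x : T ⟶ X) (y : T ⟶ Y), x ≫ f = y ≫ g →
      ∃ z : T ⟶ W, z ≫ homMk _ h₁ = x ∧ z ≫ homMk _ h₂ = y := fun {T} x y h => by
    have h' : x.arrow ≫ f.arrow = y.arrow ≫ g.arrow := congrArg Assembly.Hom.arrow h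
    refine ⟨homMk (pullback.lift _ _ h') (entails_of_pairing hR H _ ?_ ?_),
      hom_ext (pullback.lift_fst _ _ _), hom_ext (pullback.lift_snd _ _ _)⟩
    · rw [← Subobject.pullback_comp, ← MonoidalCategory.whiskerLeft_comp, pullback.lift_fst]
      exact x.entails
    · rw [← Subobject.pullback_comp, ← MonoidalCategory.whiskerLeft_comp, pullback.lift_snd]
      exact y.entails
  refine ⟨W, homMk _ h₁, homMk _ h₂, ⟨⟨hom_ext sq.w⟩, ⟨PullbackCone.IsLimit.mk _
    (fun c => (lift c.fst c.snd c.condition).choose)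
    (fun c => (lift c.fst c.snd c.condition).choose_spec.1)
    (fun c => (lift c.fst c.snd c.condition).choose_spec.2)
    (fun c m e₁ e₂ => hom_ext (sq.hom_ext ?_ ?_))⟩⟩, sq, ?_⟩
  · exact congrArg Assembly.Hom.arrow (e₁.trans (lift c.fst c.snd c.condition).choose_spec.1.symm)
  · exact congrArg Assembly.Hom.arrow (e₂.trans (lift c.fst c.snd c.condition).choose_spec.2.symm)
  · obtain ⟨V, hV, H⟩ := H
    exact ⟨V, hV, fun p x y z hp hx hy => H p x y z hp
      ((pullback_whiskerLeft_factors_iff _ _ _ _).2 hx)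
      ((pullback_whiskerLeft_factors_iff _ _ _ _).2 hy)⟩

/-- With the initial structure on a test object, both test arrows become morphisms of assemblies. -/
theorem mono_arrow {X Y : Assembly P} (f : X ⟶ Y) [Mono f] : Mono f.arrow where
  right_cancellation {T} a b h := by
    obtain ⟨R, hR, ht, h₁, h₂, -⟩ := exists_initial X X a b
    let W : Assembly P := ⟨_, R, ht, hR⟩
    have h' : homMk (X := W) a h₁ ≫ f = homMk (X := W) b h₂ ≫ f := hom_ext h
    exact congrArg Assembly.Hom.arrow ((cancel_mono f).1 h')

end Assembly

variable (P) in
/-- Morphisms to `∇ Z` are arbitrary arrows to `Z`. -/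
def toNabla {X : Assembly P} {Z : E} (f : X.obj ⟶ Z) : X ⟶ (nabla P).obj Z :=
  Assembly.Hom.mk (X := X) (X' := (nabla P).obj Z) f (by
    obtain ⟨V, hV, hV'⟩ := exists_id_realizer P
    refine ⟨V, fun a b x ha hx => ?_, hV'⟩
    obtain ⟨c, hc, hc'⟩ := hV a b ha
    exact ⟨c, hc, Subobject.top_factors _⟩)

variable (P) in
/-- The functor that forgets the realizers of an assembly. -/
def forgetAssembly : Assembly P ⥤ E where
  obj X := X.obj
  map f := f.arrow

variable (P) in
/-- The functor `∇` is right adjoint to the forgetful functor. -/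
def forgetNablaAdjunction : forgetAssembly P ⊣ nabla P :=
  Adjunction.mkOfHomEquiv
    { homEquiv := fun X Z =>
      { toFun := fun f => toNabla P f
        invFun := fun f => f.arrow
        left_inv := fun _ => rfl
        right_inv := fun _ => rfl } }

theorem Assembly.hasFiniteLimits : HasFiniteLimits (Assembly P) := by
  have := (forgetNablaAdjunction P).rightAdjoint_preservesLimits
  have h1 : HasTerminal (Assembly P) :=
    (terminalIsTerminal.isTerminalObj (nabla P) _).hasTerminal
  have h2 : HasPullbacks (Assembly P) := by
    have (X Y Z : Assembly P) (f : X ⟶ Z) (g : Y ⟶ Z) : HasLimit (cospan f g) := by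
      obtain ⟨W, a, b, h, -⟩ := Assembly.exists_isPullback f g
      exact h.hasPullback
    exact hasPullbacks_of_hasLimit_cospan _
  exact hasFiniteLimits_of_hasTerminal_and_pullbacks

end AssemblyCategory

/-! ### Regularity of the category of assemblies -/

section AssemblyRegular

variable {E : Type u} [Category.{v} E] [CartesianMonoidalCategory E] [HasFiniteLimits E]
  [MonoidalClosed E] [HasSubobjectClassifier E] {P : OPCAPair E}

attribute [local instance] regular_of_topos Assembly.hasFiniteLimits

namespace Assembly

/-- The image of the realizability relation of `X` along an arrow. -/
noncomputable def imageRel (X : Assembly P) {Y : E} (f : X.obj ⟶ Y) : Subobject (P.carrier ⊗ Y) :=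
  (exists_imageRel (P := P) X.down f).choose

theorem imageRel_downClosed (X : Assembly P) {Y : E} (f : X.obj ⟶ Y) :
    DownClosed (X.imageRel f) :=
  (exists_imageRel (P := P) X.down f).choose_spec.1

theorem imageRel_factors_iff (X : Assembly P) {Y : E} (f : X.obj ⟶ Y) {T : E}
    (a : T ⟶ P.carrier) (y : T ⟶ Y) : (X.imageRel f).Factors (lift a y) ↔
      ∃ (S : E) (e : S ⟶ T) (x : S ⟶ X.obj), IsRegularEpi e ∧ X.rel.Factors (lift (e ≫ a) x) ∧
        x ≫ f = e ≫ y :=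
  (exists_imageRel (P := P) X.down f).choose_spec.2 a y

theorem imageRel_entails {X Y : Assembly P} (f : X ⟶ Y) {Z : E} (g : Y.obj ⟶ Z) :
    Entails (X.imageRel (f.arrow ≫ g)) (Y.imageRel g) := by
  obtain ⟨V, H, hV⟩ := f.tracked
  refine ⟨V, hV, fun {T} a b z ha hb => ?_⟩
  obtain ⟨S, e, x, he, hx, h⟩ := (imageRel_factors_iff _ _ _ _).1 hb
  obtain ⟨c, hc, hc'⟩ := H (e ≫ a) (e ≫ b) x (Subobject.factors_of_factors_right _ ha) hx
  obtain ⟨c, h₁, rfl⟩ := App.of_isRegularEpi e he hc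
  exact ⟨c, h₁, (imageRel_factors_iff _ _ _ _).2 ⟨S, e, _, he, hc', by rw [Category.assoc, h]⟩⟩

variable (P) in
/-- The morphisms of assemblies that are locally surjective on realizers, uniformly. -/
def cover : MorphismProperty (Assembly P) :=
  fun X Y f => Entails Y.rel (X.imageRel f.arrow)

theorem cover_of_comp {X Y Z : Assembly P} (f : X ⟶ Y) (g : Y ⟶ Z) (h : cover P (f ≫ g)) :
    cover P g :=
  Entails.trans h (imageRel_entails f g.arrow) (imageRel_downClosed _ _)

/-- Let `q₁` track `f` and let `q₂` witness that `g` is a cover. From a realizer `b₀` of `x`, the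
element `q₂ (q₁ b₀)` realizes a local preimage of `f x`; paired with `b₀`, it realizes an element of
the pullback over `x`. -/
instance : (cover P).IsStableUnderBaseChange where
  of_isPullback {X Y Y' S f g f' g'} sq hg := by
    obtain ⟨W, a, b, sq', hE, V, hV, H⟩ := exists_isPullback f g
    suffices cover P a by
      have h : sq'.lift g' f' sq.w.symm ≫ a = g' := sq'.lift_fst _ _ _
      have h' : sq.lift b a sq'.w.symm ≫ g' = a := sq.lift_snd _ _ _
      exact cover_of_comp (sq.lift b a sq'.w.symm) g' (by rwa [h'])
    obtain ⟨T, p, hT, hp, hp'⟩ := hV.exists_factors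
    obtain ⟨T₁, q₁, hT₁, hq₁, H₁⟩ := f.entails.exists_element
    obtain ⟨T₂, q₂, hT₂, hq₂, H₂⟩ := Entails.exists_element hg
    refine entails_of_term (imageRel_downClosed _ _) (n := 3)
      (.app (.app (.var 0) (.var 3)) (.app (.var 2) (.app (.var 1) (.var 3))))
      (hT.tensor (hT₁.tensor hT₂))
      ![fst _ _ ≫ p, snd _ _ ≫ fst _ _ ≫ q₁, snd _ _ ≫ snd _ _ ≫ q₂]
      (fun i => ?_) fun {R} s b₀ x hx => ?_
    · fin_cases i
      · exact Subobject.factors_of_factors_right _ hp'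
      · exact Subobject.factors_of_factors_right _ (Subobject.factors_of_factors_right _ hq₁)
      · exact Subobject.factors_of_factors_right _ (Subobject.factors_of_factors_right _ hq₂)
    obtain ⟨c, hc, hc'⟩ := H₁ (s ≫ snd _ _ ≫ fst _ _) b₀ x hx
    rw [pullback_whiskerLeft_factors_iff] at hc'
    obtain ⟨d, hd, hd'⟩ := H₂ (s ≫ snd _ _ ≫ snd _ _) c _ hc'
    simp only [Category.assoc] at hc hd
    obtain ⟨Q, e, y, he, hy, h⟩ := (imageRel_factors_iff _ _ _ _).1 hd'
    rw [← Category.assoc] at h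
    obtain ⟨z, hz₁, hz₂⟩ : ∃ z : Q ⟶ W.obj, z ≫ a.arrow = e ≫ x ∧ z ≫ b.arrow = y :=
      ⟨hE.lift _ _ h.symm, hE.lift_fst _ _ _, hE.lift_snd _ _ _⟩
    obtain ⟨r, k, hr, hk, hk'⟩ := H (e ≫ s ≫ fst _ _ ≫ p) (e ≫ b₀) (e ≫ d) z
      (Subobject.factors_of_factors_right _ (Subobject.factors_of_factors_right _
        (Subobject.factors_of_factors_right _ hp)))
      (by rw [hz₁]; exact factors_lift_comp hx e) (by rwa [hz₂])
    obtain ⟨r, hr', rfl⟩ := App.of_isRegularEpi e he hr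
    obtain ⟨k, hk₁, rfl⟩ := App.of_isRegularEpi e he hk
    exact ⟨k, ⟨r, d, ⟨_, _, rfl, rfl, hr'⟩, ⟨_, c, rfl, ⟨_, _, rfl, rfl, hc⟩, hd⟩, hk₁⟩,
      (imageRel_factors_iff _ _ _ _).2 ⟨Q, e, z, he, hk', hz₁⟩⟩

/-- Every element of `Y` has a realizer locally, and the cover turns it into a realizer of a local
preimage. -/
theorem isRegularEpi_arrow_of_cover {X Y : Assembly P} (f : X ⟶ Y) (hf : cover P f) :
    IsRegularEpi f.arrow := by
  obtain ⟨V, hV, H⟩ := hf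
  obtain ⟨S, e, b, he, hb⟩ := Y.exists_cover (𝟙 Y.obj)
  obtain ⟨S', e', a, he', ha, -⟩ := hV.exists_cover S
  obtain ⟨c, -, hc⟩ := H a (e' ≫ b) (e' ≫ e ≫ 𝟙 _) ha (factors_lift_comp hb e')
  obtain ⟨S'', e'', x, he'', -, h⟩ := (imageRel_factors_iff _ _ _ _).1 hc
  refine isRegularEpi_of_comp x _ ?_
  rw [h, Category.comp_id]
  exact isRegularEpi_comp _ _ he'' (isRegularEpi_comp _ _ he' he)

/-- The underlying arrow is invertible; preimages are then unique, so the entailment that makes `f`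
a cover tracks the inverse. -/
theorem isIso_of_cover {X Y : Assembly P} (f : X ⟶ Y) (hf : cover P f) (_ : Mono f) : IsIso f := by
  have h1 := mono_arrow f
  have h2 := isIso_of_isRegularEpi_of_mono f.arrow (isRegularEpi_arrow_of_cover f hf)
  have hX : DownClosed X.rel := X.down
  refine ⟨homMk (inv f.arrow) (Entails.trans hf (entails_of_imp (hX.pullback _)
    fun {S} b y h => ?_) (hX.pullback _)), hom_ext (by simp), hom_ext (by simp)⟩
  obtain ⟨T, e, x, he, hx, h⟩ := (imageRel_factors_iff _ _ _ _).1 h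
  rw [pullback_whiskerLeft_factors_iff]
  refine factors_lift_of_isRegularEpi _ e he _ _ ?_
  rwa [← Category.assoc, ← h, Category.assoc, IsIso.hom_inv_id, Category.comp_id]

/-- On the image in `E`, an element is realized by the realizers of its preimages. A tracker of `f`
then also tracks the inclusion. -/
theorem exists_image {X Y : Assembly P} (f : X ⟶ Y) :
    ∃ (I : Assembly P) (e : X ⟶ I) (m : I ⟶ Y), cover P e ∧ Mono m ∧ e ≫ m = f := by
  obtain ⟨I, e, m, he, hm, h⟩ := RelReal.exists_image f.arrow
  obtain ⟨S, e₀, b, he₀, hb⟩ := X.exists_cover (𝟙 X.obj)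
  rw [Category.comp_id] at hb
  let J : Assembly P := ⟨I, X.imageRel e, isRegularEpi_arrow_snd (e₀ ≫ e)
    (isRegularEpi_comp _ _ he₀ he) b ((imageRel_factors_iff _ _ _ _).2
      ⟨S, 𝟙 S, e₀, inferInstance, by rwa [Category.id_comp], (Category.id_comp _).symm⟩),
    X.imageRel_downClosed e⟩
  refine ⟨J, homMk e (entails_of_imp (DownClosed.pullback (X.imageRel_downClosed e) e) fun {S} b x hx => ?_),
    homMk m ?_, entails_of_imp (X.imageRel_downClosed e) fun _ _ h => h, ⟨fun a b h => ?_⟩,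
    hom_ext h⟩
  · exact (pullback_whiskerLeft_factors_iff _ _ _ _).2 ((imageRel_factors_iff _ _ _ _).2
      ⟨S, 𝟙 S, x, inferInstance, by rwa [Category.id_comp], (Category.id_comp _).symm⟩)
  · obtain ⟨V, H, hV⟩ := f.tracked
    refine ⟨V, hV, fun {T} a b y ha hb => ?_⟩
    obtain ⟨S, s, x, hs, hx, h'⟩ := (imageRel_factors_iff _ _ _ _).1 hb
    obtain ⟨c, hc, hc'⟩ := H (s ≫ a) (s ≫ b) x (Subobject.factors_of_factors_right _ ha) hx
    obtain ⟨c, h₁, rfl⟩ := App.of_isRegularEpi s hs hc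
    refine ⟨c, h₁, (pullback_whiskerLeft_factors_iff _ _ _ _).2
      (factors_lift_of_isRegularEpi _ s hs _ _ ?_)⟩
    rwa [← Category.assoc, ← h', Category.assoc, h]
  · have h' := congrArg Assembly.Hom.arrow h
    exact hom_ext ((cancel_mono m).1 h')

instance regular : Regular (Assembly P) :=
  regular_of_cover (W := cover P) cover_of_comp isIso_of_cover exists_image

theorem isRegularEpi_iff_cover {X Y : Assembly P} (f : X ⟶ Y) : IsRegularEpi f ↔ cover P f :=
  ⟨cover_of_isRegularEpi exists_image f,
    isRegularEpi_of_cover cover_of_comp isIso_of_cover exists_image f⟩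

end Assembly

instance nabla_isRegularFunctor : IsRegularFunctor (nabla P) where
  preservesFiniteLimits := by
    have := (forgetNablaAdjunction P).rightAdjoint_preservesLimits
    infer_instance
  map_regularEpi {X Y} f hf := by
    rw [Assembly.isRegularEpi_iff_cover]
    refine entails_of_imp (Assembly.imageRel_downClosed _ _) fun {S} b y _ => ?_
    obtain ⟨T, e, x, he, h⟩ := exists_pullback_cover f hf y
    exact (Assembly.imageRel_factors_iff _ _ _ _).2
      ⟨T, e, x, he, Subobject.top_factors _, h.symm⟩

end AssemblyRegular

/-! ### The filter Å -/

section Ring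

variable {E : Type u} [Category.{v} E] [CartesianMonoidalCategory E] [HasFiniteLimits E]
  [MonoidalClosed E] [HasSubobjectClassifier E] {P : OPCAPair E}

attribute [local instance] regular_of_topos

theorem le_arrow {T : E} (t : T ⟶ (P.le : E)) :
    P.Le (t ≫ P.le.arrow ≫ fst _ _) (t ≫ P.le.arrow ≫ snd _ _) := by
  unfold OPAS.Le
  rw [← comp_lift, ← comp_lift, lift_fst_snd, Category.comp_id]
  exact Subobject.factors_comp_arrow _

theorem app_arrow {T : E} (t : T ⟶ (P.dom : E)) :
    P.App (t ≫ P.dom.arrow ≫ fst _ _) (t ≫ P.dom.arrow ≫ snd _ _) (t ≫ P.app) :=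
  ⟨t, by rw [← comp_lift, ← comp_lift, lift_fst_snd, Category.comp_id], rfl⟩

theorem downClosed_le : DownClosed P.le := fun _ _ _ h h' => P.le_trans _ _ _ h' h

/-- Membership in Å is thereby reduced to entailments: some element of A', given over an inhabited
object, sends realizers to lower bounds of the value of `x`. -/
theorem ring_factors_iff {X : Assembly P} (x : X ⟶ (nabla P).obj P.carrier) :
    (ring P).Factors x ↔
      Entails X.rel ((Subobject.pullback (P.carrier ◁ (x.arrow : X.obj ⟶ P.carrier))).obj P.le) := by
  rw [ring, mk_factors_iff_exists]
  constructor
  · rintro ⟨k, hk⟩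
    have h : k.arrow = x.arrow := by
      rw [← hk]
      exact (Category.comp_id _).symm
    rw [← h]
    exact k.entails
  · intro h
    exact ⟨Assembly.homMk (Y := ringAssembly P) x.arrow h,
      Assembly.hom_ext (Category.comp_id _)⟩

/-- The pullback of `Å` along the morphism of assemblies `∇ a`. -/
noncomputable def pullbackRing (P : OPCAPair E) {B : E} (a : B ⟶ P.carrier) : Assembly P :=
  ⟨B, (Subobject.pullback (P.carrier ◁ a)).obj P.le,
    isRegularEpi_arrow_snd (𝟙 B) inferInstance a (by
      rw [pullback_whiskerLeft_factors_iff, Category.id_comp]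
      exact P.le_refl a), downClosed_le.pullback a⟩

theorem pullbackRing_rel_factors_iff {B : E} (a : B ⟶ P.carrier) {T : E} (c : T ⟶ P.carrier)
    (b : T ⟶ B) : (pullbackRing P a).rel.Factors (lift c b) ↔ P.Le c (b ≫ a) :=
  pullback_whiskerLeft_factors_iff _ _ _ _

theorem ring_isFilter : IsFilter P (nabla P) (ring P) where
  up {T} t h := by
    rw [ring_factors_iff] at h ⊢
    refine Entails.trans h (entails_of_imp (downClosed_le.pullback _) fun {S} b x hb => ?_)
      (downClosed_le.pullback _)
    replace hb := (pullback_whiskerLeft_factors_iff _ _ _ _).1 hb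
    refine (pullback_whiskerLeft_factors_iff _ _ _ _).2 ?_
    let k : T.obj ⟶ (P.le : E) := t.arrow
    refine P.le_trans _ _ _ hb ?_
    have h := (le_arrow k).comp x
    exact h
  app {T} t h₁ h₂ := by
    rw [ring_factors_iff] at h₁ h₂ ⊢
    obtain ⟨T₁, q₁, hT₁, hq₁, H₁⟩ := h₁.exists_element
    obtain ⟨T₂, q₂, hT₂, hq₂, H₂⟩ := h₂.exists_element
    refine entails_of_term (downClosed_le.pullback _) (n := 2)
      (.app (.app (.var 0) (.var 2)) (.app (.var 1) (.var 2)))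
      (hT₁.tensor hT₂) ![fst _ _ ≫ q₁, snd _ _ ≫ q₂] (fun i => ?_) fun {R} s b x hx => ?_
    · fin_cases i
      · exact Subobject.factors_of_factors_right _ hq₁
      · exact Subobject.factors_of_factors_right _ hq₂
    obtain ⟨c, hc, hc'⟩ := H₁ (s ≫ fst _ _) b x hx
    obtain ⟨d, hd, hd'⟩ := H₂ (s ≫ snd _ _) b x hx
    rw [Category.assoc] at hc hd
    replace hc' := (pullback_whiskerLeft_factors_iff _ _ _ _).1 hc'
    replace hd' := (pullback_whiskerLeft_factors_iff _ _ _ _).1 hd'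
    let k : T.obj ⟶ (P.dom : E) := t.arrow
    have h := (app_arrow k).comp x
    obtain ⟨y, hy, hy'⟩ := h.mono hc' hd'
    exact ⟨y, ⟨c, d, ⟨_, _, rfl, rfl, hc⟩, ⟨_, _, rfl, rfl, hd⟩, hy⟩,
      (pullback_whiskerLeft_factors_iff _ _ _ _).2 hy'⟩
  meets U hU := by
    obtain ⟨T, a, hT, ha, ha'⟩ := hU.exists_factors
    -- With the structure pulled back along `a`, the object `T` stays inhabited as an assembly,
    -- since `a` realizes its elements uniformly and lies in A'.
    have hc : IsRegularEpi (toNabla P (X := pullbackRing P a) (terminal.from T)) := by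
      rw [Assembly.isRegularEpi_iff_cover]
      refine entails_of_term (Assembly.imageRel_downClosed _ _) (n := 1) (.var 0) hT ![a]
        (fun i => by fin_cases i; exact ha') fun {S} s b x _ => ⟨s ≫ a, rfl, ?_⟩
      refine (Assembly.imageRel_factors_iff _ _ _ _).2 ⟨S, 𝟙 S, s, inferInstance, ?_,
        terminal.hom_ext _ _⟩
      rw [pullbackRing_rel_factors_iff, Category.id_comp]
      exact P.le_refl _
    refine intersects_of_factors (isInhabited_of_isRegularEpi
      (isInhabited_map (nabla P) isInhabited_terminal) _ hc) (toNabla P (X := pullbackRing P a) a)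
      ((mapSub_factors_iff _ _ _).2 ⟨toNabla P (X := pullbackRing P a) (U.factorThru a ha), ?_⟩) ?_
    · exact Assembly.hom_ext (Subobject.factorThru_arrow U a ha)
    · rw [ring_factors_iff]
      exact entails_of_imp (downClosed_le.pullback _) fun _ _ h => h

end Ring

/-! ### Products under a regular functor -/

section MapProduct

variable {E : Type u} [Category.{v} E] [CartesianMonoidalCategory E]
  {D : Type u₂} [Category.{v₂} D] (F : E ⥤ D) [IsRegularFunctor F]

theorem exists_map_lift {A B : E} {S : D} (a : S ⟶ F.obj A) (b : S ⟶ F.obj B) :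
    ∃ w : S ⟶ F.obj (A ⊗ B), w ≫ F.map (fst A B) = a ∧ w ≫ F.map (snd A B) = b :=
  have h := mapIsLimitOfPreservesOfIsLimit F (fst A B) (snd A B) (tensorProductIsBinaryProduct A B)
  ⟨h.lift (BinaryFan.mk a b), h.fac _ ⟨.left⟩, h.fac _ ⟨.right⟩⟩

theorem map_lift_ext {A B : E} {S : D} {w w' : S ⟶ F.obj (A ⊗ B)}
    (h₁ : w ≫ F.map (fst A B) = w' ≫ F.map (fst A B))
    (h₂ : w ≫ F.map (snd A B) = w' ≫ F.map (snd A B)) : w = w' :=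
  BinaryFan.IsLimit.hom_ext (mapIsLimitOfPreservesOfIsLimit F (fst A B) (snd A B)
    (tensorProductIsBinaryProduct A B)) h₁ h₂

end MapProduct

/-! ### The elements realized by a filter -/

section Realized

variable {E : Type u} [Category.{v} E] [CartesianMonoidalCategory E] [HasFiniteLimits E]
  [MonoidalClosed E] [HasSubobjectClassifier E] {P : OPCAPair E}
  {D : Type u₂} [Category.{v₂} D] [Regular D] (F : E ⥤ D) [IsRegularFunctor F]
  (C : Subobject (F.obj P.carrier))

theorem exists_realized (X : Assembly P) : ∃ V : Subobject (F.obj X.obj),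
    ∀ {T : D} (x : T ⟶ F.obj X.obj), V.Factors x ↔ ∃ (S : D) (e : S ⟶ T) (r : S ⟶ F.obj (X.rel : E)),
      IsRegularEpi e ∧ C.Factors (r ≫ F.map (X.rel.arrow ≫ fst _ _)) ∧
        r ≫ F.map (X.rel.arrow ≫ snd _ _) = e ≫ x := by
  obtain ⟨V, hV⟩ := exists_imageSub ((Subobject.pullback (F.map (X.rel.arrow ≫ fst _ _))).obj C)
    (F.map (X.rel.arrow ≫ snd _ _))
  refine ⟨V, fun x => ?_⟩
  simp only [hV, Limits.pullback_factors_iff]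

/-- The subobject of `F X` of those elements that have a realizer in the filter `C`. -/
noncomputable def realized (X : Assembly P) : Subobject (F.obj X.obj) :=
  (exists_realized F C X).choose

theorem realized_factors_iff (X : Assembly P) {T : D} (x : T ⟶ F.obj X.obj) :
    (realized F C X).Factors x ↔ ∃ (S : D) (e : S ⟶ T) (r : S ⟶ F.obj (X.rel : E)),
      IsRegularEpi e ∧ C.Factors (r ≫ F.map (X.rel.arrow ≫ fst _ _)) ∧
        r ≫ F.map (X.rel.arrow ≫ snd _ _) = e ≫ x :=
  (exists_realized F C X).choose_spec x

variable {F C}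

/-- Locally, a filter contains elements of a subobject that intersects `A'`. -/
theorem IsFilter.exists_cover (hC : IsFilter P F C) {U : Subobject P.carrier}
    (hU : Intersects U P.sub) (T : D) : ∃ (S : D) (e : S ⟶ T) (a : S ⟶ F.obj (U : E)),
      IsRegularEpi e ∧ C.Factors (a ≫ F.map U.arrow) := by
  obtain ⟨S, e, a, he, ha, ha'⟩ := (hC.meets U hU).exists_cover T
  obtain ⟨k, rfl⟩ := (mapSub_factors_iff F U a).1 ha
  exact ⟨S, e, k, he, ha'⟩

/-- Realizers in the filter are closed under the application of elements of a subobject that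
intersects `A'`. -/
theorem IsFilter.exists_app (hC : IsFilter P F C) {G : E} {a b c : G ⟶ P.carrier}
    (h : P.App a b c) {S : D} (w : S ⟶ F.obj G) (ha : C.Factors (w ≫ F.map a))
    (hb : C.Factors (w ≫ F.map b)) : C.Factors (w ≫ F.map c) := by
  obtain ⟨d, hd, rfl⟩ := h
  have h₁ : d ≫ P.dom.arrow ≫ fst _ _ = a := by rw [← Category.assoc, hd, lift_fst]
  have h₂ : d ≫ P.dom.arrow ≫ snd _ _ = b := by rw [← Category.assoc, hd, lift_snd]
  rw [F.map_comp, ← Category.assoc]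
  refine hC.app _ ?_ ?_
  · rwa [Category.assoc, ← F.map_comp, h₁]
  · rwa [Category.assoc, ← F.map_comp, h₂]

theorem realized_of_rel (X : Assembly P) {G : E} {a : G ⟶ P.carrier} {x : G ⟶ X.obj}
    (h : X.rel.Factors (lift a x)) {S T : D} (e : S ⟶ T) (he : IsRegularEpi e) (w : S ⟶ F.obj G)
    (ha : C.Factors (w ≫ F.map a)) (t : T ⟶ F.obj X.obj) (ht : w ≫ F.map x = e ≫ t) :
    (realized F C X).Factors t := by
  have hr := Subobject.factorThru_arrow _ _ h
  refine (realized_factors_iff F C X t).2 ⟨S, e, w ≫ F.map (X.rel.factorThru _ h), he, ?_, ?_⟩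
  · rwa [Category.assoc, ← F.map_comp, ← Category.assoc (Subobject.factorThru _ _ _), hr, lift_fst]
  · rwa [Category.assoc, ← F.map_comp, ← Category.assoc (Subobject.factorThru _ _ _), hr, lift_snd]

theorem rel_arrow_factors {X : E} {R : Subobject (P.carrier ⊗ X)} {G : E} (r : G ⟶ (R : E)) :
    R.Factors (lift (r ≫ R.arrow ≫ fst _ _) (r ≫ R.arrow ≫ snd _ _)) := by
  rw [← comp_lift, ← comp_lift, lift_fst_snd, Category.comp_id]
  exact Subobject.factors_comp_arrow _

/-- Tracking is a statement in `E`, so it is applied to the generic tracker and realizer, over `V ⊗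
X.rel`, and then transported by `F`. The element `w` specializes it to a tracker in the filter and a
given realizer. -/
theorem realized_map (hC : IsFilter P F C) {X Y : Assembly P} (f : X ⟶ Y) {T : D}
    (x : T ⟶ F.obj X.obj) (hx : (realized F C X).Factors x) :
    (realized F C Y).Factors (x ≫ F.map f.arrow) := by
  obtain ⟨V, H, hV⟩ := f.tracked
  obtain ⟨S, e, r, he, hr, h⟩ := (realized_factors_iff F C X x).1 hx
  obtain ⟨S', e', a, he', ha⟩ := hC.exists_cover hV S
  obtain ⟨c, hc, hc'⟩ := H (fst (V : E) (X.rel : E) ≫ V.arrow)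
    (snd (V : E) (X.rel : E) ≫ X.rel.arrow ≫ fst _ _)
    (snd (V : E) (X.rel : E) ≫ X.rel.arrow ≫ snd _ _)
    (Subobject.factors_comp_arrow _) (rel_arrow_factors _)
  obtain ⟨w, hw₁, hw₂⟩ := exists_map_lift F a (e' ≫ r)
  refine realized_of_rel Y hc' (e' ≫ e) (isRegularEpi_comp _ _ he' he) w
    (hC.exists_app hc w ?_ ?_) _ ?_
  · rwa [F.map_comp, ← Category.assoc, hw₁]
  · rw [F.map_comp, ← Category.assoc, hw₂, Category.assoc]
    exact Subobject.factors_of_factors_right _ hr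
  · rw [F.map_comp, F.map_comp, ← Category.assoc w, ← Category.assoc w, hw₂, Category.assoc e' r,
      h]
    simp only [Category.assoc]

theorem realized_nabla (hC : IsFilter P F C) {X : E} {T : D} (x : T ⟶ F.obj X) :
    (realized F C ((nabla P).obj X)).Factors x := by
  obtain ⟨V, -, hV⟩ := exists_id_realizer P
  obtain ⟨S, e, a, he, ha⟩ := hC.exists_cover hV T
  obtain ⟨w, hw₁, hw₂⟩ := exists_map_lift F (a ≫ F.map V.arrow) (e ≫ x)
  exact realized_of_rel ((nabla P).obj X) (a := fst P.carrier X) (x := snd P.carrier X)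
    (Subobject.top_factors _) e he w (by rwa [hw₁]) x hw₂

/-- A realizer of `x` is a lower bound, so upward closure gives one inclusion; `x` realizes itself,
which gives the other. -/
theorem realized_ring (hC : IsFilter P F C) : realized F C (ringAssembly P) = C := by
  refine subobject_ext fun {T} (x : T ⟶ F.obj P.carrier) => ?_
  have hx : x ≫ F.map (𝟙 P.carrier) = x := by rw [F.map_id, Category.comp_id]
  constructor
  · intro h
    obtain ⟨S, e, r, he, hr, h⟩ := (realized_factors_iff F C (ringAssembly P) x).1 h
    exact factors_of_isRegularEpi _ e he _ (by rw [← h]; exact hC.up r hr)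
  · intro h
    exact realized_of_rel (ringAssembly P) (P.le_refl (𝟙 P.carrier)) (𝟙 T) inferInstance x
      (by rwa [hx]) x (hx.trans (Category.id_comp x).symm)

/-- The generic realizer of an element of `Y` yields a preimage over a regular epimorphism `g` in
`E`. Since `F.map g` is again a regular epimorphism, the preimage exists locally in `D`. -/
theorem realized_of_cover (hC : IsFilter P F C) {X Y : Assembly P} (f : X ⟶ Y)
    (hf : Assembly.cover P f) {T : D} (y : T ⟶ F.obj Y.obj) (hy : (realized F C Y).Factors y) :
    ∃ (S : D) (e : S ⟶ T) (x : S ⟶ F.obj X.obj), IsRegularEpi e ∧ (realized F C X).Factors x ∧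
      x ≫ F.map f.arrow = e ≫ y := by
  obtain ⟨V, hV, H⟩ := hf
  obtain ⟨S, e, r, he, hr, h⟩ := (realized_factors_iff F C Y y).1 hy
  obtain ⟨S', e', a, he', ha⟩ := hC.exists_cover hV S
  obtain ⟨c, hc, hc'⟩ := H (fst (V : E) (Y.rel : E) ≫ V.arrow)
    (snd (V : E) (Y.rel : E) ≫ Y.rel.arrow ≫ fst _ _)
    (snd (V : E) (Y.rel : E) ≫ Y.rel.arrow ≫ snd _ _)
    (Subobject.factors_comp_arrow _) (rel_arrow_factors _)
  obtain ⟨w, hw₁, hw₂⟩ := exists_map_lift F a (e' ≫ r)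
  obtain ⟨G, g, x, hg, hx, h'⟩ := (Assembly.imageRel_factors_iff _ _ _ _).1 hc'
  obtain ⟨Q, q, w', hq, hw'⟩ := exists_pullback_cover _ (IsRegularFunctor.map_regularEpi (F := F) g hg) w
  refine ⟨Q, q ≫ e' ≫ e, w' ≫ F.map x, isRegularEpi_comp _ _ hq (isRegularEpi_comp _ _ he' he),
    realized_of_rel X hx (𝟙 Q) inferInstance w' ?_ _ (Category.id_comp _).symm, ?_⟩
  · rw [F.map_comp, ← Category.assoc, ← hw', Category.assoc]
    refine Subobject.factors_of_factors_right _ (hC.exists_app hc w ?_ ?_)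
    · rwa [F.map_comp, ← Category.assoc, hw₁]
    · rw [F.map_comp, ← Category.assoc, hw₂, Category.assoc]
      exact Subobject.factors_of_factors_right _ hr
  · rw [Category.assoc, ← F.map_comp, h', F.map_comp, F.map_comp, ← Category.assoc w', ← hw',
      Category.assoc q, ← Category.assoc w, hw₂, Category.assoc e' r, h]
    simp only [Category.assoc]

/-- The generic situation is an element of `W` with realizers of its images under `a` and `b`. It
lives over the pullback of `m` along `lift a b`, which `F` preserves. -/
theorem realized_of_pairing (hC : IsFilter P F C) {X Y W : Assembly P} (a : W.obj ⟶ X.obj)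
    (b : W.obj ⟶ Y.obj) {V : Subobject P.carrier} (hV : Intersects V P.sub)
    (H : ∀ {T : E} (p x y : T ⟶ P.carrier) (z : T ⟶ W.obj), V.Factors p →
          X.rel.Factors (lift x (z ≫ a)) → Y.rel.Factors (lift y (z ≫ b)) →
            ∃ r c, P.App p x r ∧ P.App r y c ∧ W.rel.Factors (lift c z))
    {T : D} (z : T ⟶ F.obj W.obj) (hx : (realized F C X).Factors (z ≫ F.map a))
    (hy : (realized F C Y).Factors (z ≫ F.map b)) : (realized F C W).Factors z := by
  obtain ⟨S₁, e₁, r₁, he₁, hr₁, h₁⟩ := (realized_factors_iff F C X _).1 hx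
  obtain ⟨S₂, e₂, r₂, he₂, hr₂, h₂⟩ := (realized_factors_iff F C Y (e₁ ≫ z ≫ F.map b)).1
    (Subobject.factors_of_factors_right _ hy)
  obtain ⟨S, e, p, he, hp⟩ := hC.exists_cover hV S₂
  let m : (X.rel : E) ⊗ (Y.rel : E) ⟶ X.obj ⊗ Y.obj :=
    (X.rel.arrow ≫ snd _ _) ⊗ₘ (Y.rel.arrow ≫ snd _ _)
  have sq := IsPullback.of_hasPullback m (lift a b)
  obtain ⟨k, hk₁, hk₂⟩ := exists_map_lift F (e ≫ e₂ ≫ r₁) (e ≫ r₂)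
  have hw : k ≫ F.map m = (e ≫ e₂ ≫ e₁ ≫ z) ≫ F.map (lift a b) := by
    apply map_lift_ext F
    · simp only [Category.assoc, ← F.map_comp, lift_fst, m, tensorHom_fst]
      rw [F.map_comp, ← Category.assoc k, hk₁]
      simp only [Category.assoc, h₁]
    · simp only [Category.assoc, ← F.map_comp, lift_snd, m, tensorHom_snd]
      rw [F.map_comp, ← Category.assoc k, hk₂]
      simp only [Category.assoc, h₂]
  obtain ⟨l, hl₁, hl₂⟩ : ∃ l : S ⟶ F.obj (pullback m (lift a b)), l ≫ F.map (pullback.fst _ _) = k ∧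
      l ≫ F.map (pullback.snd _ _) = e ≫ e₂ ≫ e₁ ≫ z :=
    ⟨(sq.map F).lift _ _ hw, (sq.map F).lift_fst _ _ _, (sq.map F).lift_snd _ _ _⟩
  obtain ⟨w, hw₁, hw₂⟩ := exists_map_lift F p l
  let G := pullback m (lift a b)
  let g₁ : (V : E) ⊗ G ⟶ (X.rel : E) := snd _ _ ≫ pullback.fst _ _ ≫ fst _ _
  let g₂ : (V : E) ⊗ G ⟶ (Y.rel : E) := snd _ _ ≫ pullback.fst _ _ ≫ snd _ _
  let g₃ : (V : E) ⊗ G ⟶ W.obj := snd _ _ ≫ pullback.snd _ _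
  have i₁ : g₁ ≫ X.rel.arrow ≫ snd _ _ = g₃ ≫ a := by
    have := congrArg (fun t => snd (V : E) G ≫ t ≫ fst _ _) sq.w
    simpa [m, g₁, g₃] using this
  have i₂ : g₂ ≫ Y.rel.arrow ≫ snd _ _ = g₃ ≫ b := by
    have := congrArg (fun t => snd (V : E) G ≫ t ≫ snd _ _) sq.w
    simpa [m, g₂, g₃] using this
  have hx' := rel_arrow_factors (P := P) g₁
  have hy' := rel_arrow_factors (P := P) g₂
  rw [i₁] at hx'
  rw [i₂] at hy'
  obtain ⟨r, c, hr, hc, hc'⟩ := H (fst (V : E) G ≫ V.arrow) _ _ g₃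
    (Subobject.factors_comp_arrow _) hx' hy'
  have j₁ : w ≫ F.map g₁ = e ≫ e₂ ≫ r₁ := by
    simp only [g₁, F.map_comp]
    rw [reassoc_of% hw₂, reassoc_of% hl₁, hk₁]
  have j₂ : w ≫ F.map g₂ = e ≫ r₂ := by
    simp only [g₂, F.map_comp]
    rw [reassoc_of% hw₂, reassoc_of% hl₁, hk₂]
  refine realized_of_rel W hc' (e ≫ e₂ ≫ e₁) (isRegularEpi_comp _ _ he (isRegularEpi_comp _ _ he₂
    he₁)) w (hC.exists_app hc w (hC.exists_app hr w ?_ ?_) ?_) z ?_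
  · rwa [F.map_comp, ← Category.assoc, hw₁]
  · rw [F.map_comp, ← Category.assoc, j₁]
    simp only [Category.assoc]
    exact Subobject.factors_of_factors_right _ (Subobject.factors_of_factors_right _ hr₁)
  · rw [F.map_comp, ← Category.assoc, j₂, Category.assoc]
    exact Subobject.factors_of_factors_right _ hr₂
  · simp only [g₃, F.map_comp]
    rw [reassoc_of% hw₂, hl₂]
    simp only [Category.assoc]

end Realized

/-! ### The regular functor induced by a filter -/

section RealizedFunctor

variable {E : Type u} [Category.{v} E] [CartesianMonoidalCategory E] [HasFiniteLimits E]
  [MonoidalClosed E] [HasSubobjectClassifier E] {P : OPCAPair E}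
  {D : Type u₂} [Category.{v₂} D] [Regular D] {F : E ⥤ D} [IsRegularFunctor F]
  {C : Subobject (F.obj P.carrier)}

namespace IsFilter

variable (hC : IsFilter P F C)

/-- The functor from assemblies that is induced by a filter. -/
noncomputable def functor : Assembly P ⥤ D where
  obj X := (realized F C X : D)
  map {X Y} f := (realized F C Y).factorThru ((realized F C X).arrow ≫ F.map f.arrow)
    (realized_map hC f _ (Subobject.factors_self _))
  map_id X := by
    rw [← cancel_mono (realized F C X).arrow, Subobject.factorThru_arrow]
    simp
  map_comp {X Y Z} f g := by
    rw [← cancel_mono (realized F C Z).arrow]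
    simp

/-- The inclusion of the value of `hC.functor` at `X` into `F X`. -/
noncomputable def functorArrow (X : Assembly P) : hC.functor.obj X ⟶ F.obj X.obj :=
  (realized F C X).arrow

instance (X : Assembly P) : Mono (hC.functorArrow X) :=
  inferInstanceAs (Mono (realized F C X).arrow)

theorem functor_map_arrow {X Y : Assembly P} (f : X ⟶ Y) :
    hC.functor.map f ≫ hC.functorArrow Y = hC.functorArrow X ≫ F.map f.arrow :=
  Subobject.factorThru_arrow _ _ (realized_map hC f _ (Subobject.factors_self _))

theorem exists_functor_lift {X : Assembly P} {T : D} (x : T ⟶ F.obj X.obj)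
    (hx : (realized F C X).Factors x) : ∃ y : T ⟶ hC.functor.obj X, y ≫ hC.functorArrow X = x :=
  ⟨_, Subobject.factorThru_arrow _ _ hx⟩

theorem factors_functorArrow {X : Assembly P} {T : D} (y : T ⟶ hC.functor.obj X) :
    (realized F C X).Factors (y ≫ hC.functorArrow X) :=
  Subobject.factors_comp_arrow _

/-- The inclusion of the value of `hC.functor` at `∇ X` into `F X`, which is invertible. -/
noncomputable def nablaArrow (X : E) : hC.functor.obj ((nabla P).obj X) ⟶ F.obj X :=
  hC.functorArrow ((nabla P).obj X)

instance (X : E) : IsIso (hC.nablaArrow X) := by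
  have : Mono (hC.nablaArrow X) := inferInstanceAs (Mono (hC.functorArrow ((nabla P).obj X)))
  obtain ⟨y, hy⟩ := hC.exists_functor_lift (X := (nabla P).obj X) (𝟙 (F.obj X))
    (realized_nabla hC _)
  have : IsSplitEpi (hC.nablaArrow X) := ⟨⟨⟨y, hy⟩⟩⟩
  exact isIso_of_mono_of_isSplitEpi _

/-- The functor induced by a filter for `F` extends `F` along `∇`. -/
noncomputable def nablaIso : nabla P ⋙ hC.functor ≅ F :=
  NatIso.ofComponents (fun X => asIso (hC.nablaArrow X)) fun f =>
    hC.functor_map_arrow ((nabla P).map f)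

/-- `F` preserves the underlying pullback, and pairing shows that a lift of realized elements is
realized. Surjectivity for regular epimorphisms is the local existence of realized preimages. -/
theorem functor_isRegular : IsRegularFunctor hC.functor where
  preservesFiniteLimits := by
    have h₁ : PreservesLimit (Functor.empty.{0} (Assembly P)) hC.functor := by
      have i : IsLimit (asEmptyCone (F.obj (⊤_ E))) := terminalIsTerminal.isTerminalObj F _
      have j : IsTerminal (hC.functor.obj ((nabla P).obj (⊤_ E))) :=
        IsTerminal.ofIso i (hC.nablaIso.app (⊤_ E)).symm
      have k : IsTerminal ((nabla P).obj (⊤_ E)) := terminalIsTerminal.isTerminalObj (nabla P) _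
      exact preservesTerminal_of_iso _ ((hC.functor.mapIso
        (terminalIsTerminal.uniqueUpToIso k)) ≪≫ j.uniqueUpToIso terminalIsTerminal)
    have h₂ : PreservesLimitsOfShape (Discrete PEmpty.{1}) hC.functor :=
      preservesLimitsOfShape_pempty_of_preservesTerminal _
    have h₃ : PreservesLimitsOfShape WalkingCospan hC.functor := by
      have (X Y Z : Assembly P) (f : X ⟶ Z) (g : Y ⟶ Z) :
          PreservesLimit (cospan f g) hC.functor := by
        obtain ⟨W, a, b, sq, hE, V, hV, H⟩ := Assembly.exists_isPullback f g
        have hF := hE.map F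
        have lift : ∀ {T : D} (x : T ⟶ hC.functor.obj X) (y : T ⟶ hC.functor.obj Y),
            x ≫ hC.functor.map f = y ≫ hC.functor.map g → ∃ z : T ⟶ hC.functor.obj W,
              z ≫ hC.functor.map a = x ∧ z ≫ hC.functor.map b = y := fun {T} x y h => by
          have h' : (x ≫ hC.functorArrow X) ≫ F.map f.arrow =
              (y ≫ hC.functorArrow Y) ≫ F.map g.arrow := by
            simp only [Category.assoc, ← functor_map_arrow]
            rw [reassoc_of% h]
          obtain ⟨z, hz⟩ := hC.exists_functor_lift (X := W) (hF.lift _ _ h')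
            (realized_of_pairing hC a.arrow b.arrow hV H _
              (by rw [hF.lift_fst]; exact hC.factors_functorArrow x)
              (by rw [hF.lift_snd]; exact hC.factors_functorArrow y))
          refine ⟨z, ?_, ?_⟩
          · rw [← cancel_mono (hC.functorArrow X), Category.assoc, functor_map_arrow,
              reassoc_of% hz, hF.lift_fst]
          · rw [← cancel_mono (hC.functorArrow Y), Category.assoc, functor_map_arrow,
              reassoc_of% hz, hF.lift_snd]
        have sq' : IsPullback (hC.functor.map a) (hC.functor.map b) (hC.functor.map f)
            (hC.functor.map g) := ⟨⟨by rw [← Functor.map_comp, sq.w, Functor.map_comp]⟩,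
          ⟨PullbackCone.IsLimit.mk _ (fun c => (lift c.fst c.snd c.condition).choose)
            (fun c => (lift c.fst c.snd c.condition).choose_spec.1)
            (fun c => (lift c.fst c.snd c.condition).choose_spec.2) fun c m e₁ e₂ => by
              have h₁ := e₁.trans (lift c.fst c.snd c.condition).choose_spec.1.symm
              have h₂ := e₂.trans (lift c.fst c.snd c.condition).choose_spec.2.symm
              rw [← cancel_mono (hC.functorArrow W)]
              apply hF.hom_ext
              · simp only [Category.assoc, ← functor_map_arrow]
                rw [reassoc_of% h₁]
              · simp only [Category.assoc, ← functor_map_arrow]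
                rw [reassoc_of% h₂]⟩⟩
        exact preservesLimit_of_preserves_limit_cone sq.isLimit
          ((isLimitMapConePullbackConeEquiv hC.functor sq.w).symm sq'.isLimit)
      exact ⟨fun {K} => preservesLimit_of_iso_diagram _ (diagramIsoCospan K).symm⟩
    exact preservesFiniteLimits_of_preservesTerminal_and_pullbacks _
  map_regularEpi {X Y} f hf := by
    rw [Assembly.isRegularEpi_iff_cover] at hf
    obtain ⟨S, e, x, he, hx, h⟩ := realized_of_cover hC f hf (hC.functorArrow Y)
      (Subobject.factors_self _)
    obtain ⟨x, rfl⟩ := hC.exists_functor_lift x hx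
    refine isRegularEpi_of_comp x _ ?_
    have : x ≫ hC.functor.map f = e := by
      rw [← cancel_mono (hC.functorArrow Y), ← h, Category.assoc, Category.assoc,
        functor_map_arrow]
    rwa [this]

theorem mk_functor_ringArrow [IsRegularFunctor hC.functor] :
    Subobject.mk (hC.functor.map (ringArrow P) ≫ hC.nablaIso.hom.app P.carrier) = C := by
  have h : ∀ (m : hC.functor.obj (ringAssembly P) ⟶ F.obj P.carrier) [Mono m],
      m = hC.functorArrow (ringAssembly P) → Subobject.mk m = C := by
    rintro m _ rfl
    exact (Subobject.mk_arrow _).trans (realized_ring hC)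
  refine h _ ?_
  refine (hC.functor_map_arrow (ringArrow P)).trans ?_
  exact (congrArg (hC.functorArrow (ringAssembly P) ≫ ·) (F.map_id P.carrier)).trans
    (Category.comp_id _)

end IsFilter

end RealizedFunctor

/-! ### Uniqueness of regular extensions along ∇ -/

section Unit

variable {E : Type u} [Category.{v} E] [CartesianMonoidalCategory E] [HasFiniteLimits E]
  [MonoidalClosed E] [HasSubobjectClassifier E] {P : OPCAPair E}

attribute [local instance] regular_of_topos

/-- The monomorphism from an assembly `X` to `∇ X` whose underlying arrow is the identity. -/
def toNablaObj (X : Assembly P) : X ⟶ (nabla P).obj X.obj := toNabla P (𝟙 X.obj)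

instance (X : Assembly P) : Mono (toNablaObj X) where
  right_cancellation f g h := by
    have h' : f.arrow ≫ 𝟙 _ = g.arrow ≫ 𝟙 _ := congrArg Assembly.Hom.arrow h
    exact Assembly.hom_ext (by simpa using h')

theorem toNablaObj_naturality {X Y : Assembly P} (f : X ⟶ Y) :
    f ≫ toNablaObj Y = toNablaObj X ≫ (nabla P).map f.arrow :=
  Assembly.hom_ext ((Category.comp_id f.arrow).trans (Category.id_comp f.arrow).symm)

variable (P) in
theorem exists_isPullback_ringArrow {B : E} (a : B ⟶ P.carrier) :
    ∃ k : pullbackRing P a ⟶ ringAssembly P,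
      IsPullback k (toNablaObj (pullbackRing P a)) (ringArrow P) ((nabla P).map a) := by
  let k : pullbackRing P a ⟶ ringAssembly P :=
    Assembly.homMk (X := pullbackRing P a) (Y := ringAssembly P) a
      (entails_of_imp (downClosed_le.pullback a) fun _ _ h => h)
  have hk : k ≫ ringArrow P = toNablaObj (pullbackRing P a) ≫ (nabla P).map a :=
    Assembly.hom_ext ((Category.comp_id a).trans (Category.id_comp a).symm)
  have lift : ∀ {T : Assembly P} (x : T ⟶ ringAssembly P) (y : T ⟶ (nabla P).obj B),
      x ≫ ringArrow P = y ≫ (nabla P).map a → ∃ z : T ⟶ pullbackRing P a,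
        z ≫ toNablaObj (pullbackRing P a) = y := fun {T} x y h => by
    let y' : T.obj ⟶ B := y.arrow
    have h' : x.arrow = y' ≫ a :=
      (Category.comp_id x.arrow).symm.trans (congrArg Assembly.Hom.arrow h)
    obtain ⟨V, H, hV⟩ := x.tracked
    refine ⟨Assembly.homMk (Y := pullbackRing P a) y' ⟨V, hV, fun b c t hb hc => ?_⟩,
      Assembly.hom_ext (Category.comp_id y')⟩
    obtain ⟨d, hd, hd'⟩ := H b c t hb hc
    refine ⟨d, hd, (pullback_whiskerLeft_factors_iff _ _ _ _).2
      ((pullbackRing_rel_factors_iff _ _ _).2 ?_)⟩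
    exact (congrArg (P.Le d) ((Category.assoc t y' a).trans (congrArg (t ≫ ·) h'.symm))).mpr hd'
  refine ⟨k, ⟨⟨hk⟩, ⟨PullbackCone.IsLimit.mk _
    (fun c => (lift c.fst c.snd c.condition).choose) (fun c => ?_)
    (fun c => (lift c.fst c.snd c.condition).choose_spec) fun c m _ e => ?_⟩⟩⟩
  · rw [← cancel_mono (ringArrow P), Category.assoc, hk, ← Category.assoc,
      (lift c.fst c.snd c.condition).choose_spec, c.condition]
  · rw [← cancel_mono (toNablaObj (pullbackRing P a)),
      (lift c.fst c.snd c.condition).choose_spec, e]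

/-- Every assembly is covered by a pullback of `Å`. -/
theorem exists_regularEpi_pullbackRing (X : Assembly P) :
    ∃ q : pullbackRing P (X.rel.arrow ≫ fst _ _) ⟶ X, IsRegularEpi q ∧
      q.arrow = X.rel.arrow ≫ snd _ _ := by
  have hX : DownClosed X.rel := X.down
  refine ⟨Assembly.homMk (X := pullbackRing P (X.rel.arrow ≫ fst _ _)) (X.rel.arrow ≫ snd _ _)
    (entails_of_imp (hX.pullback _) fun b r h => ?_), ?_, rfl⟩
  · replace h := (pullbackRing_rel_factors_iff _ _ _).1 h
    exact (pullback_whiskerLeft_factors_iff _ _ _ _).2 (hX _ _ _ (rel_arrow_factors r) h)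
  · rw [Assembly.isRegularEpi_iff_cover]
    refine entails_of_imp (Assembly.imageRel_downClosed _ _) fun {S} b x h => ?_
    have hr := Subobject.factorThru_arrow _ _ h
    refine (Assembly.imageRel_factors_iff _ _ _ _).2 ⟨S, 𝟙 S, X.rel.factorThru _ h, inferInstance,
      ?_, ?_⟩
    · rw [pullbackRing_rel_factors_iff, ← Category.assoc, hr, lift_fst, Category.id_comp]
      exact P.le_refl b
    · rw [Category.id_comp]
      exact (Category.assoc _ _ _).symm.trans ((congrArg (· ≫ snd _ _) hr).trans (lift_snd _ _))

variable {D : Type u₂} [Category.{v₂} D] [Regular D] {F : E ⥤ D} [IsRegularFunctor F]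
  {C : Subobject (F.obj P.carrier)} (G : Assembly P ⥤ D) [IsRegularFunctor G]
  (η : nabla P ⋙ G ≅ F)

/-- The inclusion of `G X` into `F X`, if `G` is a regular functor that extends `F` along `∇`. -/
def extensionArrow (X : Assembly P) : G.obj X ⟶ F.obj X.obj :=
  G.map (toNablaObj X) ≫ η.hom.app X.obj

instance (X : Assembly P) : Mono (extensionArrow G η X) := by
  have : Mono (η.hom.app X.obj) := inferInstance
  exact mono_comp (G.map (toNablaObj X)) (η.hom.app X.obj)

theorem extensionArrow_naturality {X Y : Assembly P} (f : X ⟶ Y) :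
    G.map f ≫ extensionArrow G η Y = extensionArrow G η X ≫ F.map f.arrow := by
  have := η.hom.naturality f.arrow
  dsimp at this
  rw [extensionArrow, ← G.map_comp_assoc, toNablaObj_naturality, G.map_comp_assoc, this,
    ← Category.assoc]
  rfl

/-- `G` preserves the pullback of Å along the first projection of `X.rel`, and the cover of `X` by
it. So the image of `G X` in `F X` consists of the second components of those elements of `F X.rel`
whose first component lies in `C`. -/
theorem mk_extensionArrow (hη : Subobject.mk (G.map (ringArrow P) ≫ η.hom.app P.carrier) = C)
    (X : Assembly P) : Subobject.mk (extensionArrow G η X) = realized F C X := by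
  subst hη
  obtain ⟨q, hq, hq'⟩ := exists_regularEpi_pullbackRing X
  obtain ⟨k, sq⟩ := exists_isPullback_ringArrow P (X.rel.arrow ≫ fst P.carrier X.obj)
  have hn := η.hom.naturality (X.rel.arrow ≫ fst P.carrier X.obj)
  dsimp at hn
  have hq₁ := extensionArrow_naturality G η q
  rw [hq'] at hq₁
  have hk : G.map k ≫ G.map (ringArrow P) ≫ η.hom.app P.carrier =
      extensionArrow G η (pullbackRing P _) ≫ F.map (X.rel.arrow ≫ fst P.carrier X.obj) := by
    rw [← G.map_comp_assoc, sq.w, G.map_comp_assoc]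
    exact (congrArg (G.map (toNablaObj _) ≫ ·) hn).trans (Category.assoc _ _ _).symm
  have hGq := IsRegularFunctor.map_regularEpi (F := G) q hq
  refine subobject_ext fun {T} x => ?_
  rw [mk_factors_iff_exists, realized_factors_iff]
  constructor
  · rintro ⟨y, rfl⟩
    obtain ⟨S, e, z, he, h⟩ := exists_pullback_cover _ hGq y
    refine ⟨S, e, z ≫ extensionArrow G η (pullbackRing P _), he, ?_, ?_⟩
    · refine (mk_factors_iff_exists _ _).2 ⟨z ≫ G.map k, ?_⟩
      exact (Category.assoc _ _ _).trans ((congrArg (z ≫ ·) hk).trans (Category.assoc _ _ _).symm)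
    · refine (Category.assoc _ _ _).trans ((congrArg (z ≫ ·) hq₁.symm).trans ?_)
      rw [← Category.assoc, ← h, Category.assoc]
  · rintro ⟨S, e, r, he, hr, h⟩
    obtain ⟨m, hm⟩ := (mk_factors_iff_exists _ _).1 hr
    have sq' := sq.map G
    have w : m ≫ G.map (ringArrow P) =
        (r ≫ η.inv.app _) ≫ G.map ((nabla P).map (X.rel.arrow ≫ fst P.carrier X.obj)) := by
      rw [← cancel_mono (η.hom.app P.carrier), Category.assoc, hm, Category.assoc, Category.assoc,
        hn, Iso.inv_hom_id_app_assoc]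
    rw [← mk_factors_iff_exists]
    refine factors_of_isRegularEpi _ e he _ ((mk_factors_iff_exists _ _).2
      ⟨sq'.lift _ _ w ≫ G.map q, ?_⟩)
    rw [Category.assoc, hq₁, ← h, ← Category.assoc]
    refine congrArg (· ≫ F.map (X.rel.arrow ≫ snd P.carrier X.obj)) ?_
    refine (Category.assoc _ _ _).symm.trans
      ((congrArg (· ≫ η.hom.app _) (sq'.lift_snd m _ w)).trans ((Category.assoc _ _ _).trans ?_))
    exact (congrArg (r ≫ ·) (η.inv_hom_id_app _)).trans (Category.comp_id r)

/-- A regular functor on assemblies is determined by its restriction along `∇` and its value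
at `Å`. -/
theorem existsUnique_iso (G' : Assembly P ⥤ D) [IsRegularFunctor G'] (η' : nabla P ⋙ G' ≅ F)
    (hη : Subobject.mk (G.map (ringArrow P) ≫ η.hom.app P.carrier) = C)
    (hη' : Subobject.mk (G'.map (ringArrow P) ≫ η'.hom.app P.carrier) = C) :
    ∃! θ : G ≅ G', ∀ X : E, θ.hom.app ((nabla P).obj X) ≫ η'.hom.app X = η.hom.app X := by
  have h (X : Assembly P) :
      Subobject.mk (extensionArrow G η X) = Subobject.mk (extensionArrow G' η' X) :=
    (mk_extensionArrow G η hη X).trans (mk_extensionArrow G' η' hη' X).symm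
  let θ : G ≅ G' := NatIso.ofComponents (fun X => Subobject.isoOfMkEqMk _ _ (h X)) fun {X Y} f => by
    rw [← cancel_mono (extensionArrow G' η' Y)]
    simp only [Category.assoc, extensionArrow_naturality, Subobject.isoOfMkEqMk_hom,
      Subobject.ofMkLEMk_comp]
    rw [← Category.assoc, Subobject.ofMkLEMk_comp]
  have hθ (X : Assembly P) : θ.hom.app X ≫ extensionArrow G' η' X = extensionArrow G η X := by
    simp [θ]
  have hN (H : Assembly P ⥤ D) [IsRegularFunctor H] (ε : nabla P ⋙ H ≅ F) (X : E) :
      extensionArrow H ε ((nabla P).obj X) = ε.hom.app X := by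
    exact (congrArg (· ≫ ε.hom.app X) (H.map_id ((nabla P).obj X))).trans (Category.id_comp _)
  refine ⟨θ, fun X => ?_, fun θ' h' => ?_⟩
  · rw [← hN G η, ← hθ]
    exact congrArg (θ.hom.app _ ≫ ·) (hN G' η' X).symm
  -- Naturality at the inclusion of `X` in its `nabla` object determines the composite of `θ'` with
  -- a monomorphism.
  · ext X
    rw [← cancel_mono (extensionArrow G' η' X), hθ, extensionArrow, ← θ'.hom.naturality_assoc,
      h', extensionArrow]

end Unit

/-! ### Transport of filters along regular functors -/

section MapFilter

variable {C : Type u₁} [Category.{v₁} C] {D : Type u₂} [Category.{v₂} D]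

/-- Since `L` preserves the pullback of `U` along `g`, the element `t` is an instance of the generic
element of `Y` that `g` sends into `U`. The filter axioms for the image under `L` can thus be
checked before `L` is applied. -/
theorem exists_factors_of_mapSub [HasPullbacks C] (L : C ⥤ D) [IsRegularFunctor L] {X Y : C}
    (U : Subobject X) (g : Y ⟶ X) {T : D} (t : T ⟶ L.obj Y)
    (h : (mapSub L U).Factors (t ≫ L.map g)) :
    ∃ (Z : C) (z : Z ⟶ Y) (k : T ⟶ L.obj Z), U.Factors (z ≫ g) ∧ k ≫ L.map z = t := by
  obtain ⟨k, hk⟩ := (mapSub_factors_iff L U _).1 h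
  have sq := (Subobject.isPullback g U).map L
  refine ⟨_, ((Subobject.pullback g).obj U).arrow, sq.lift k t hk, ?_, sq.lift_snd _ _ _⟩
  rw [← (Subobject.isPullback g U).w]
  exact Subobject.factors_comp_arrow _

theorem mk_map_arrow_comp (L : C ⥤ D) [PreservesLimitsOfShape WalkingCospan L] {X Y : C}
    (m : Y ⟶ X) [Mono m] {Z : D} (i : L.obj X ⟶ Z) [Mono i] :
    Subobject.mk (L.map (Subobject.mk m).arrow ≫ i) = Subobject.mk (L.map m ≫ i) :=
  Subobject.mk_eq_mk_of_comm _ _ (L.mapIso (Subobject.underlyingIso m)) (by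
    rw [Functor.mapIso_hom, ← L.map_comp_assoc, Subobject.underlyingIso_hom_comp_eq_mk])

theorem mk_iso_comp {X Y Y' : D} (e : Y ≅ Y') (m : Y ⟶ X) (m' : Y' ⟶ X) [Mono m] [Mono m']
    (h : e.hom ≫ m' = m) : Subobject.mk m = Subobject.mk m' :=
  Subobject.mk_eq_mk_of_comm _ _ e h

end MapFilter

section Filter

variable {E : Type u} [Category.{v} E] [CartesianMonoidalCategory E] [HasFiniteLimits E]
  {P : OPCAPair E} {D : Type u₁} [Category.{v₁} D] [Regular D] {D' : Type u₂} [Category.{v₂} D']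
  [Regular D'] {F : E ⥤ D} [IsRegularFunctor F] {C : Subobject (F.obj P.carrier)}

/-- Regular functors preserve filters. -/
theorem IsFilter.map (hC : IsFilter P F C) (L : D ⥤ D') [IsRegularFunctor L] :
    IsFilter P (F ⋙ L) (mapSub L C) where
  up {T} t h := by
    obtain ⟨Z, z, k, hz, rfl⟩ := exists_factors_of_mapSub L C _ t h
    have := factors_mapSub L C _ (hC.up z hz)
    rw [L.map_comp] at this
    exact (congrArg (mapSub L C).Factors (Category.assoc _ _ _)).mpr
      (Subobject.factors_of_factors_right k this)
  app {T} t h₁ h₂ := by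
    obtain ⟨Z, z, k, hz, rfl⟩ := exists_factors_of_mapSub L C _ t h₁
    have h₃ : (mapSub L C).Factors (k ≫ L.map (z ≫ F.map (P.dom.arrow ≫ snd _ _))) := by
      rw [L.map_comp]
      exact (congrArg (mapSub L C).Factors (Category.assoc _ _ _)).mp h₂
    obtain ⟨Z', z', k', hz', rfl⟩ := exists_factors_of_mapSub L C _ k h₃
    have := factors_mapSub L C _ (hC.app (z' ≫ z)
      (by rw [Category.assoc]; exact Subobject.factors_of_factors_right _ hz)
      (by rwa [Category.assoc]))
    rw [L.map_comp, L.map_comp] at this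
    have h := Subobject.factors_of_factors_right k' this
    simp only [Category.assoc] at h ⊢
    exact h
  meets U hU := by
    obtain ⟨T, a, hT, ha, ha'⟩ := (hC.meets U hU).exists_factors
    obtain ⟨k, rfl⟩ := (mapSub_factors_iff F U a).1 ha
    refine intersects_of_factors (isInhabited_map L hT) (L.map (k ≫ F.map U.arrow))
      ((mapSub_factors_iff (F ⋙ L) U _).2 ⟨L.map k, (L.map_comp _ _).symm⟩)
      (factors_mapSub L C _ ha')

end Filter

/-! ### Pseudoinitiality of the exact completion -/

section Pseudoinitial

variable {E : Type u} [Category.{v} E] [CartesianMonoidalCategory E] [HasFiniteLimits E]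
  [MonoidalClosed E] [HasSubobjectClassifier E] {P : OPCAPair E}

theorem mk_map_mapSub_ring_arrow {X : Type u₁} [Category.{v₁} X] {D : Type u₂} [Category.{v₂} D]
    (I : Assembly P ⥤ X) [IsRegularFunctor I] (L : X ⥤ D) [IsRegularFunctor L] {Z : D}
    (i : L.obj (I.obj ((nabla P).obj P.carrier)) ⟶ Z) [Mono i] :
    Subobject.mk (L.map (mapSub I (ring P)).arrow ≫ i) =
      Subobject.mk (L.map (I.map (ringArrow P)) ≫ i) := by
  have h : mapSub I (ring P) = Subobject.mk (I.map (ringArrow P)) := mapSub_mk I (ringArrow P)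
  rw [← mk_map_arrow_comp L (I.map (ringArrow P)) i]
  congr 1 <;> rw [h]

/-- The exact completion of the category of assemblies is a pseudoinitial exact model. -/
theorem IsExactCompletion.isPseudoinitial {X : Type u₁} [Category.{v₁} X] {I : Assembly P ⥤ X}
    (hI : IsExactCompletion.{max u v, v, u₁, v₁, u₂, v₂} I) [BarrExact X] [IsRegularFunctor I]
    [IsRegularFunctor (nabla P ⋙ I)] (h : IsFilter P (nabla P ⋙ I) (mapSub I (ring P))) :
    ExactModel.IsPseudoinitial.{u, v, u₁, v₁, u₂, v₂}
      { category := X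
        functor := nabla P ⋙ I
        filter := mapSub I (ring P)
        isFilter := h } := by
  intro N
  have : Regular N.category := BarrExact.toRegular
  refine ⟨?_, fun f g => ?_⟩
  · have hN := N.isFilter
    have := hN.functor_isRegular
    obtain ⟨L, hL, ⟨ε⟩⟩ := hI.exists_extension N.category hN.functor
    let η : (nabla P ⋙ I) ⋙ L ≅ N.functor := Functor.isoWhiskerLeft (nabla P) ε ≪≫ hN.nablaIso
    refine ⟨⟨L, η, ?_⟩⟩
    refine (mk_map_mapSub_ring_arrow I L (η.hom.app P.carrier)).trans ?_
    rw [← hN.mk_functor_ringArrow]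
    refine mk_iso_comp (ε.app (ringAssembly P)) _ _ ?_
    have := ε.hom.naturality (ringArrow P)
    simp only [Functor.comp_map] at this
    simp [η, reassoc_of% this]
  · have := f.regular
    have := g.regular
    let η : nabla P ⋙ (I ⋙ f.functor) ≅ N.functor := f.iso
    let η' : nabla P ⋙ (I ⋙ g.functor) ≅ N.functor := g.iso
    have hη := (mk_map_mapSub_ring_arrow I f.functor (f.iso.hom.app P.carrier)).symm.trans
      f.map_filter
    have hη' := (mk_map_mapSub_ring_arrow I g.functor (g.iso.hom.app P.carrier)).symm.trans
      g.map_filter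
    obtain ⟨θ, hθ, huniq⟩ := existsUnique_iso (I ⋙ f.functor) η (I ⋙ g.functor) η' hη hη'
    -- The comparison over assemblies and its inverse extend to the completion, and injectivity of
    -- whiskering makes the extensions mutually inverse.
    obtain ⟨α, hα⟩ := (hI.bijective_whiskerLeft N.category f.functor g.functor).2 θ.hom
    obtain ⟨β, hβ⟩ := (hI.bijective_whiskerLeft N.category g.functor f.functor).2 θ.inv
    have hαβ : α ≫ β = 𝟙 _ := (hI.bijective_whiskerLeft N.category f.functor f.functor).1 (by
      change Functor.whiskerLeft I (α ≫ β) = Functor.whiskerLeft I (𝟙 _)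
      rw [Functor.whiskerLeft_comp, Functor.whiskerLeft_id']
      exact (congrArg₂ (· ≫ ·) hα hβ).trans θ.hom_inv_id)
    have hβα : β ≫ α = 𝟙 _ := (hI.bijective_whiskerLeft N.category g.functor g.functor).1 (by
      change Functor.whiskerLeft I (β ≫ α) = Functor.whiskerLeft I (𝟙 _)
      rw [Functor.whiskerLeft_comp, Functor.whiskerLeft_id']
      exact (congrArg₂ (· ≫ ·) hβ hα).trans θ.inv_hom_id)
    refine ⟨⟨α, β, hαβ, hβα⟩, fun Z => ?_, fun θ' h' => ?_⟩
    · refine Eq.trans ?_ (hθ Z)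
      exact congrArg (fun w => NatTrans.app w ((nabla P).obj Z) ≫ g.iso.hom.app Z) hα
    · have e := huniq (Functor.isoWhiskerLeft I θ') h'
      refine Iso.ext ((hI.bijective_whiskerLeft N.category f.functor g.functor).1 ?_)
      exact (congrArg Iso.hom e).trans hα.symm

end Pseudoinitial

end RelReal

open RelReal
theorem mainTheorem3 {E : Type u} [Category.{v} E] [CartesianMonoidalCategory E]
    [HasFiniteLimits E] [MonoidalClosed E] [HasSubobjectClassifier E] (P : OPCAPair E) :
    -- `Asm(A', A)` is a regular category, and `(∇, Å)` is a regular model in it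
    (∃ (_ : Regular (Assembly P)) (_ : IsRegularFunctor (nabla P)),
      IsFilter P (nabla P) (ring P)) ∧
    -- `Asm(A', A)` has an exact completion
    (∃ (X : Type max u v) (_ : Category.{max u v} X) (I : Assembly P ⥤ X),
      IsExactCompletion.{max u v, v, max u v, max u v, u₂, v₂} I) ∧
    -- for every exact completion `I`, the pair `(I ∇, I Å)` is a pseudoinitial exact model
    (∀ (X : Type u₁) [Category.{v₁} X] (I : Assembly P ⥤ X),
      IsExactCompletion.{max u v, v, u₁, v₁, u₂, v₂} I →
      ∃ (_ : BarrExact X) (_ : IsRegularFunctor I) (_ : IsRegularFunctor (nabla P ⋙ I))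
        (h : IsFilter P (nabla P ⋙ I) (mapSub I (ring P))),
        ExactModel.IsPseudoinitial.{u, v, u₁, v₁, u₂, v₂}
          { category := X
            functor := nabla P ⋙ I
            filter := mapSub I (ring P)
            isFilter := h }) := by
  refine ⟨⟨inferInstance, inferInstance, ring_isFilter⟩,
    exists_isExactCompletion.{u, v, u₂, v₂} (Assembly P), fun X _ I hI => ?_⟩
  have := hI.exact
  have := hI.regular
  exact ⟨hI.exact, hI.regular, inferInstance, ring_isFilter.map I, hI.isPseudoinitial _⟩
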